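/- Let $k\in\mathbb C$, let $Q:\,]0,\infty[\to\mathbb C$ be locally integrable, and for $m\in\mathbb C$ consider the equation $$\Big(-\partial_x^2+\big(m^2-\tfrac14\big)\tfrac1{x^2}+Q(x)\Big)g=-k^2g \qquad (*)$$ for $g\in AC^1]0,\infty[$, that is, $g$ differentiable with locally absolutely continuous derivative, the equation holding almost everywhere. For $\varepsilon\ge0$ and $\beta\ge 0$ write $Q\in\mathscr L^{(0)}_{\varepsilon}$ if $\int_0^1x^{1-\varepsilon}|Q(x)|\,dx<\infty$ and $Q\in\mathscr L^{(0)}_{\varepsilon,\ln^\beta}$ if $\int_0^1x^{1-\varepsilon}(1+|\ln x|^\beta)|Q(x)|\,dx<\infty$ (with $\ln=\ln^1$). Let $$u_m^0(x,k)=\big(\tfrac2k\big)^m\sqrt x\,I_m(kx)=x^{\frac12+m}\sum_{n\ge0}\frac{(k^2x^2/4)^n}{n!\,\Gamma(m+n+1)},\qquad u_m^0(x,0)=\frac{x^{\frac12+m}}{\Gamma(m+1)},$$ $$p_0^0(x,k)=-\sqrt x\,K_0(kx)-\big(\ln\tfrac k2+\gamma\big)u_0^0(x,k)\ (k\ne0),\qquad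 p_0^0(x,0)=\sqrt x\,\ln x,$$ where $I_m$, $K_0$ are the modified Bessel and Macdonald functions and $\gamma$ is Euler's constant. The forward Green's operator $G^0_\to$ is the integral operator on $]0,\infty[$ with kernel $$G^0_\to(x,y)=\theta(x-y)\,\frac{h_1(x)h_2(y)-h_2(x)h_1(y)}{h_1h_2'-h_1'h_2},$$ where $h_1,h_2$ is any pair of linearly independent solutions of $(*)$ with $Q=0$. For $a>0$ and $\phi>0$ let $L^\infty(]0,a[,\phi)$ be the space of (classes of) measurable $f$ with $\|f/\phi\|_{L^\infty(]0,a[)}<\infty$. (i) Let $m\in\mathbb C$ and $\varepsilon\ge2\max(-\operatorname{Re}m,0)$, and suppose $Q\in\mathscr L^{(0)}_\varepsilon$ if $m\ne0$, and $Q\in\mathscr L^{(0)}_{\varepsilon,\ln}$ if $m=0$. Then $\mathbb 1+G^0_\to Q$ is boundedly invertible on $L^\infty(]0,a[,x^{\frac12+\operatorname{Re}m})$ for every $a>0$, and $$u_m(\cdot,k):=(\mathbb 1+G^0_\to Q)^{-1}u_m^0(\cdot,k)$$ (the function on $]0,\infty[$ whose restriction to each $]0,a[$ is the preimage of $u^0_m(\cdot,k)|_{]0,a[}$)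 is the unique solution in $AC^1]0,\infty[$ of $(*)$ such that, as $x\to0$, $$u_m(x,k)-u_m^0(x,k)=o\big(x^{\frac12+\operatorname{Re}m+\varepsilon}\big),\qquad \partial_xu_m(x,k)-\partial_xu_m^0(x,k)=o\big(x^{-\frac12+\operatorname{Re}m+\varepsilon}\big).$$ It is also the unique solution in $AC^1]0,\infty[$ of $(*)$ such that, as $x\to0$, $$u_m(x,k)-u_m^0(x,k)=o\big(x^{\frac12+|\operatorname{Re}m|}\big),\qquad \partial_xu_m(x,k)-\partial_xu_m^0(x,k)=o\big(x^{-\frac12+|\operatorname{Re}m|}\big).$$ (ii) Let $m=0$, $\varepsilon\ge0$ and $Q\in\mathscr L^{(0)}_{\varepsilon,\ln^2}$. Then $\mathbb 1+G^0_\to Q$ is boundedly invertible on $L^\infty(]0,a[,x^{\frac12}(1+|\ln x|))$ for every $a>0$, and, in the same sense as in (i), $$p_0(\cdot,k):=(\mathbb 1+G^0_\to Q)^{-1}p_0^0(\cdot,k)$$ is the unique solution in $AC^1]0,\infty[$ of $(*)$ such that, as $x\to0$, $$p_0(x,k)-p_0^0(x,k)=o\big(x^{\frac12+\varepsilon}\big),\qquad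 \partial_xp_0(x,k)-\partial_xp_0^0(x,k)=o\big(x^{-\frac12+\varepsilon}\big).$$ It is also the unique solution in $AC^1]0,\infty[$ of $(*)$ for which these two relations hold with $\varepsilon$ replaced by $0$. -/

import Mathlib

open Filter Topology MeasureTheory Set Asymptotics

noncomputable section

namespace PerturbedBessel

/-! Functions on the open half-line `]0,∞[` are represented by functions `ℝ → ℂ`, of which only the
restriction to `Ioi 0` matters. -/

/-! ### Unperturbed eigenfunctions -/

/-- The modified Bessel function `I_m(z)`, principal branch. At the poles of `Γ` the value
`Complex.Gamma` is `0`, so the corresponding coefficients `1/Γ` vanish, as they should. -/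
def besselI (m z : ℂ) : ℂ :=
  (z / 2) ^ m * ∑' n : ℕ, (z ^ 2 / 4) ^ n / ((n.factorial : ℂ) * Complex.Gamma (m + n + 1))

/-- The Macdonald function `K_m(z)`: `(π/2) (I_{-m}(z) - I_m(z)) / sin (π m)`, with its limiting
value at integer `m`. -/
def besselK (m z : ℂ) : ℂ :=
  limUnder (𝓝[≠] m) fun μ : ℂ =>
    (Real.pi : ℂ) / 2 * (besselI (-μ) z - besselI μ z) / Complex.sin (Real.pi * μ)

/-- `u_m^0(x,k) = (2/k)^m √x I_m(kx)`, and `x^{1/2+m}/Γ(m+1)` at `k = 0`. The factor `(2/k)^m`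
is written `(k/2)^{-m}`; then the branches cancel for every `k ≠ 0`. -/
def u0 (m k : ℂ) (x : ℝ) : ℂ :=
  if k = 0 then (x : ℂ) ^ (1 / 2 + m) / Complex.Gamma (m + 1)
  else (k / 2) ^ (-m) * (Real.sqrt x : ℂ) * besselI m (k * x)

/-- `v_0^0(x,k) = √x K_0(kx)` for `k ≠ 0`. -/
def v00 (k : ℂ) (x : ℝ) : ℂ := (Real.sqrt x : ℂ) * besselK 0 (k * x)

/-- The logarithmic solution `p_0^0(x,k) = -v_0^0(x,k) - (ln(k/2) + γ) u_0^0(x,k)` for `m = 0`, and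
`√x ln x` at `k = 0`. -/
def p00 (k : ℂ) (x : ℝ) : ℂ :=
  if k = 0 then (Real.sqrt x : ℂ) * (Real.log x : ℂ)
  else -v00 k x - (Complex.log (k / 2) + (Real.eulerMascheroniConstant : ℂ)) * u0 0 k x

/-! ### The perturbed equation -/

/-- `AC¹]0,∞[`: differentiable functions with locally absolutely continuous derivative. -/
def AC1 (f : ℝ → ℂ) : Prop :=
  (∀ x, 0 < x → DifferentiableAt ℝ f x) ∧
    ∀ a b : ℝ, 0 < a → 0 < b → AbsolutelyContinuousOnInterval (deriv f) a b

/-- `f ∈ AC¹]0,∞[` and `-f'' + (m² - 1/4) x⁻² f + Q f = -k² f` almost everywhere. The unperturbed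
equation is the case `Q = 0`. -/
def IsEigensolution (m k : ℂ) (Q f : ℝ → ℂ) : Prop :=
  AC1 f ∧ ∀ᵐ x ∂(volume.restrict (Ioi (0 : ℝ))),
    -deriv (deriv f) x + (m ^ 2 - 1 / 4) / (x : ℂ) ^ 2 * f x + Q x * f x = -k ^ 2 * f x

/-- `𝓛^{(0)}_ε`. -/
def L0 (ε : ℝ) (Q : ℝ → ℂ) : Prop :=
  LocallyIntegrableOn Q (Ioi 0) ∧
    IntegrableOn (fun x : ℝ => x ^ (1 - ε) * ‖Q x‖) (Ioo 0 1)

/-- `𝓛^{(0)}_{ε,ln^β}`. -/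
def L0ln (ε β : ℝ) (Q : ℝ → ℂ) : Prop :=
  LocallyIntegrableOn Q (Ioi 0) ∧
    IntegrableOn (fun x : ℝ => x ^ (1 - ε) * (1 + |Real.log x| ^ β) * ‖Q x‖) (Ioo 0 1)

/-- `g` solves the perturbed equation, with `g - g⁰ = o(x^{1/2+s})` and
`g' - g⁰' = o(x^{-1/2+s})` as `x → 0`. -/
def ApproximatesAtZero (m k : ℂ) (Q g0 : ℝ → ℂ) (s : ℝ) (g : ℝ → ℂ) : Prop :=
  IsEigensolution m k Q g ∧
    (fun x => g x - g0 x) =o[𝓝[>] (0 : ℝ)] (fun x => x ^ (1 / 2 + s)) ∧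
    (fun x => deriv g x - deriv g0 x) =o[𝓝[>] (0 : ℝ)] (fun x => x ^ (-1 / 2 + s))

/-- `g` is the only solution on `]0,∞[` that approximates `g⁰` to order `s`. -/
def IsUniqueApproximation (m k : ℂ) (Q g0 : ℝ → ℂ) (s : ℝ) (g : ℝ → ℂ) : Prop :=
  ApproximatesAtZero m k Q g0 s g ∧
    ∀ f, ApproximatesAtZero m k Q g0 s f → EqOn f g (Ioi 0)

/-! ### The forward Green's operator -/

/-- `h₁`, `h₂` solve the unperturbed equation and their Wronskian `h₁ h₂' - h₁' h₂` is the nonzero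
constant `w`. -/
def IsFundamentalPair (m k : ℂ) (h₁ h₂ : ℝ → ℂ) (w : ℂ) : Prop :=
  IsEigensolution m k 0 h₁ ∧ IsEigensolution m k 0 h₂ ∧ w ≠ 0 ∧
    ∀ x, 0 < x → h₁ x * deriv h₂ x - deriv h₁ x * h₂ x = w

/-- The kernel `G_→(x,y) = θ(x-y) (h₁(x) h₂(y) - h₂(x) h₁(y)) / w`. -/
def forwardGreen (h₁ h₂ : ℝ → ℂ) (w : ℂ) (x y : ℝ) : ℂ :=
  if y ≤ x then (h₁ x * h₂ y - h₂ x * h₁ y) / w else 0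

/-- `(G Q f)(x) = ∫₀^∞ G(x,y) Q(y) f(y) dy`. -/
def applyGQ (G : ℝ → ℝ → ℂ) (Q f : ℝ → ℂ) (x : ℝ) : ℂ :=
  ∫ y in Ioi (0 : ℝ), G x y * Q y * f y

/-- The norm of the weighted space `L^∞(]0,a[, φ)`. -/
def wNorm (a : ℝ) (φ : ℝ → ℝ) (f : ℝ → ℂ) : ENNReal :=
  eLpNorm (fun x => f x / (φ x : ℂ)) ⊤ (volume.restrict (Ioo 0 a))

/-- Membership in the weighted space `L^∞(]0,a[, φ)`. -/
def MemW (a : ℝ) (φ : ℝ → ℝ) (f : ℝ → ℂ) : Prop :=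
  MemLp (fun x => f x / (φ x : ℂ)) ⊤ (volume.restrict (Ioo 0 a))

/-- For a forward Volterra kernel `G`: the operator `1 + G Q` is well defined, bounded, and
boundedly invertible on `L^∞(]0,a[, φ)` (elements being identified when equal almost everywhere
on `]0,a[`). -/
structure InvertibleOn (G : ℝ → ℝ → ℂ) (Q : ℝ → ℂ) (a : ℝ) (φ : ℝ → ℝ) : Prop where
  integrable : ∀ f, MemW a φ f → ∀ x ∈ Ioo 0 a, IntegrableOn (fun y => G x y * Q y * f y) (Ioi 0)
  bounded : ∃ C : NNReal, ∀ f, MemW a φ f →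
    MemW a φ (applyGQ G Q f) ∧ wNorm a φ (applyGQ G Q f) ≤ C * wNorm a φ f
  injective : ∀ f g, MemW a φ f → MemW a φ g →
    (∀ᵐ x ∂(volume.restrict (Ioo 0 a)), f x + applyGQ G Q f x = g x + applyGQ G Q g x) →
    ∀ᵐ x ∂(volume.restrict (Ioo 0 a)), f x = g x
  surjective : ∃ C : NNReal, ∀ f, MemW a φ f → ∃ g, MemW a φ g ∧
    (∀ᵐ x ∂(volume.restrict (Ioo 0 a)), g x + applyGQ G Q g x = f x) ∧ wNorm a φ g ≤ C * wNorm a φ f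

/-- `g = (1 + G_→^0 Q)^{-1} g⁰`: for every interval `]0,a[` the operator `1 + G_→^0 Q` is invertible
on `L^∞(]0,a[, φ)`, `g⁰` restricts to an element of that space, and its preimage is the restriction
of `g`. The forward Green's operator may be computed from any fundamental pair, and there is such
a pair. -/
def IsInverseImage (m k : ℂ) (Q : ℝ → ℂ) (φ : ℝ → ℝ) (g0 g : ℝ → ℂ) : Prop :=
  (∃ h₁ h₂ w, IsFundamentalPair m k h₁ h₂ w) ∧
    ∀ h₁ h₂ w, IsFundamentalPair m k h₁ h₂ w → ∀ a : ℝ, 0 < a →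
      InvertibleOn (forwardGreen h₁ h₂ w) Q a φ ∧ MemW a φ g0 ∧ MemW a φ g ∧
        ∀ x ∈ Ioo 0 a, g x + applyGQ (forwardGreen h₁ h₂ w) Q g x = g0 x

end PerturbedBessel

end

/-!
Variation of constants turns the perturbed equation into the Volterra equation `g + G_→^0 Q g = g⁰`.
If the kernel, multiplied by the weight `φ(y)`, is dominated by `x^{1/2+s} ω(y)` with `ω Q`
integrable at the origin, then for large `λ` the operator `G_→^0 Q` is a contraction in the norm of
the weight `φ(x) exp(λ ∫₀ˣ ω |Q|)`, which is equivalent to `φ` on every `]0,a[`, and the remainder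
`G_→^0 Q g` is `o(x^{1/2+s})` together with the corresponding statement for its derivative.

For `m ≠ 0` the kernel is bounded through an energy of the free equation that grows between `y`
and `x` at most by a constant times `(x/y)^{1+2|Re m|}`; for `m = 0` it is read off from the
power series of `u_0^0` and of the regular part of `p_0^0`. The difference of two solutions with
the same asymptotics is again controlled by the Volterra equation, so uniqueness reduces to the
free equation, where Wronskians with a fundamental pair exclude nonzero solutions that are
`o(x^{1/2+|Re m|})` with derivative `o(x^{-1/2+|Re m|})`.
-/

noncomputable section

namespace PerturbedBessel

/-! ### Absolutely continuous vector-valued functions -/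

section AbsolutelyContinuous

variable {X Y E : Type*} [PseudoMetricSpace X] [PseudoMetricSpace Y]
  [NormedAddCommGroup E] [NormedSpace ℝ E] {a b : ℝ}

theorem absolutelyContinuousOnInterval_of_dist_le_mul {f : ℝ → X} {g : ℝ → Y} {K : NNReal}
    (hf : AbsolutelyContinuousOnInterval f a b)
    (h : ∀ x ∈ uIcc a b, ∀ y ∈ uIcc a b, dist (g x) (g y) ≤ K * dist (f x) (f y)) :
    AbsolutelyContinuousOnInterval g a b := by
  rw [absolutelyContinuousOnInterval_iff] at hf ⊢
  intro ε hε
  obtain ⟨δ, hδ, hfδ⟩ := hf (ε / (K + 1)) (by positivity)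
  refine ⟨δ, hδ, fun I hI hlt => ?_⟩
  calc ∑ i ∈ Finset.range I.1, dist (g (I.2 i).1) (g (I.2 i).2)
      ≤ ∑ i ∈ Finset.range I.1, (K + 1) * dist (f (I.2 i).1) (f (I.2 i).2) :=
        Finset.sum_le_sum fun i hi => (h _ (hI.1 i hi).1 _ (hI.1 i hi).2).trans
          (mul_le_mul_of_nonneg_right (by linarith) dist_nonneg)
    _ = (K + 1) * ∑ i ∈ Finset.range I.1, dist (f (I.2 i).1) (f (I.2 i).2) := by
        rw [Finset.mul_sum]
    _ < ε := by
        rw [mul_comm, ← lt_div_iff₀ (by positivity)]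
        exact hfδ I hI hlt

theorem absolutelyContinuousOnInterval_congr {f g : ℝ → X}
    (hf : AbsolutelyContinuousOnInterval f a b) (h : EqOn g f (uIcc a b)) :
    AbsolutelyContinuousOnInterval g a b :=
  absolutelyContinuousOnInterval_of_dist_le_mul (K := 1) hf fun x hx y hy => by
    simp [h hx, h hy]

theorem absolutelyContinuousOnInterval_of_hasDerivAt {f f' : ℝ → E}
    (hf : ∀ x ∈ uIcc a b, HasDerivAt f (f' x) x) (hf' : ContinuousOn f' (uIcc a b)) :
    AbsolutelyContinuousOnInterval f a b := by
  obtain ⟨C, hC⟩ := isCompact_uIcc.exists_bound_of_continuousOn hf'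
  have hlip : LipschitzOnWith C.toNNReal f (uIcc a b) :=
    (convex_uIcc a b).lipschitzOnWith_of_nnnorm_hasDerivWithin_le
      (fun x hx => (hf x hx).hasDerivWithinAt) fun x hx =>
        NNReal.coe_le_coe.1 ((hC x hx).trans (Real.le_coe_toNNReal C))
  exact hlip.absolutelyContinuousOnInterval

theorem absolutelyContinuousOnInterval_intervalIntegral {f : ℝ → E} {c : ℝ}
    (hf : IntervalIntegrable f volume a b) (hc : c ∈ uIcc a b) :
    AbsolutelyContinuousOnInterval (fun x => ∫ t in c..x, f t) a b := by
  have hint {g : ℝ → ℝ} (hg : IntervalIntegrable g volume a b) {x : ℝ} (hx : x ∈ uIcc a b) :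
      IntervalIntegrable g volume c x := hg.mono_set (uIcc_subset_uIcc hc hx)
  refine absolutelyContinuousOnInterval_of_dist_le_mul (K := 1)
    (hf.norm.absolutelyContinuousOnInterval_intervalIntegral hc) fun x hx y hy => ?_
  rw [dist_comm, dist_comm (∫ t in c..x, ‖f t‖), dist_eq_norm, Real.dist_eq,
    intervalIntegral.integral_interval_sub_left (hint hf.norm hy) (hint hf.norm hx),
    intervalIntegral.integral_interval_sub_left
      (hf.mono_set (uIcc_subset_uIcc hc hy)) (hf.mono_set (uIcc_subset_uIcc hc hx))]
  simpa using intervalIntegral.norm_integral_le_abs_integral_norm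

theorem ae_differentiableAt_of_absolutelyContinuousOnInterval {f : ℝ → ℂ}
    (hf : AbsolutelyContinuousOnInterval f a b) : ∀ᵐ x, x ∈ uIcc a b → DifferentiableAt ℝ f x := by
  have hre : AbsolutelyContinuousOnInterval (fun x => (f x).re) a b :=
    absolutelyContinuousOnInterval_of_dist_le_mul (K := 1) hf fun x _ y _ => by
      simpa [Complex.dist_eq, Real.dist_eq] using Complex.abs_re_le_norm (f x - f y)
  have him : AbsolutelyContinuousOnInterval (fun x => (f x).im) a b :=
    absolutelyContinuousOnInterval_of_dist_le_mul (K := 1) hf fun x _ y _ => by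
      simpa [Complex.dist_eq, Real.dist_eq] using Complex.abs_im_le_norm (f x - f y)
  filter_upwards [hre.ae_differentiableAt, him.ae_differentiableAt] with x hx_re hx_im hx
  have hsum := (hx_re hx).hasDerivAt.ofReal_comp.add
    ((hx_im hx).hasDerivAt.ofReal_comp.mul_const Complex.I)
  exact hsum.differentiableAt.congr_of_eventuallyEq
    (Eventually.of_forall fun y => (Complex.re_add_im (f y)).symm)

variable [CompleteSpace E]

theorem integral_eq_sub_of_absolutelyContinuousOnInterval {f f' : ℝ → E}
    (hf : AbsolutelyContinuousOnInterval f a b) (hd : ∀ᵐ x, x ∈ uIcc a b → HasDerivAt f (f' x) x)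
    (hf' : IntervalIntegrable f' volume a b) : ∫ x in a..b, f' x = f b - f a := by
  have hzero : ∀ᵐ x, x ∈ uIcc a b → HasDerivAt (fun x => f x - ∫ t in a..x, f' t) 0 x := by
    filter_upwards [hd, hf'.ae_hasDerivAt_integral] with x hfx hix hx
    simpa using (hfx hx).fun_sub (hix hx a left_mem_uIcc)
  obtain ⟨C, hC⟩ := (hf.fun_sub (absolutelyContinuousOnInterval_intervalIntegral hf'
    left_mem_uIcc)).const_of_ae_hasDerivAt_zero hzero
  have ha : f a = C := by simpa using hC a left_mem_uIcc
  rw [ha, ← hC b right_mem_uIcc, sub_sub_cancel]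

theorem integral_mul_exp_primitive {ρ : ℝ → ℝ} (c : ℝ) (hρ : IntervalIntegrable ρ volume a b) :
    ∫ y in a..b, ρ y * (c * Real.exp (c * ∫ t in a..y, ρ t)) =
      Real.exp (c * ∫ t in a..b, ρ t) - 1 := by
  have hac := (absolutelyContinuousOnInterval_intervalIntegral hρ left_mem_uIcc).const_mul c
  obtain ⟨B, hB⟩ := hac.exists_bound
  obtain ⟨K, hK⟩ := (Real.contDiff_exp (n := 1)).contDiffOn.exists_lipschitzOnWith
    (by decide) (convex_Icc (-B) B) isCompact_Icc
  have hexp : AbsolutelyContinuousOnInterval (fun y => Real.exp (c * ∫ t in a..y, ρ t)) a b :=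
    absolutelyContinuousOnInterval_of_dist_le_mul hac fun x hx y hy =>
      hK.dist_le_mul _ (abs_le.1 (hB x hx)) _ (abs_le.1 (hB y hy))
  rw [integral_eq_sub_of_absolutelyContinuousOnInterval hexp, intervalIntegral.integral_same,
    mul_zero, Real.exp_zero]
  · filter_upwards [hρ.ae_hasDerivAt_integral] with y hy hyab
    exact ((hy hyab a left_mem_uIcc).const_mul c).exp.congr_deriv (by ring)
  · exact hρ.mul_continuousOn (continuousOn_const.mul hexp.continuousOn)

end AbsolutelyContinuous

section LocallyAC

variable {E : Type*} [NormedAddCommGroup E] {f g : ℝ → E}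

/-- Local absolute continuity on `]0,∞[`. -/
def LocallyAC (f : ℝ → E) : Prop :=
  ∀ a b : ℝ, 0 < a → 0 < b → AbsolutelyContinuousOnInterval f a b

theorem pos_of_mem_uIcc {a b x : ℝ} (ha : 0 < a) (hb : 0 < b) (hx : x ∈ uIcc a b) : 0 < x :=
  (lt_min ha hb).trans_le hx.1

theorem LocallyAC.congr (hf : LocallyAC f) (h : EqOn g f (Ioi 0)) : LocallyAC g :=
  fun a b ha hb => absolutelyContinuousOnInterval_congr (hf a b ha hb)
    fun _ hx => h (pos_of_mem_uIcc ha hb hx)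

theorem LocallyAC.add (hf : LocallyAC f) (hg : LocallyAC g) : LocallyAC fun x => f x + g x :=
  fun a b ha hb => (hf a b ha hb).fun_add (hg a b ha hb)

theorem LocallyAC.sub (hf : LocallyAC f) (hg : LocallyAC g) : LocallyAC fun x => f x - g x :=
  fun a b ha hb => (hf a b ha hb).fun_sub (hg a b ha hb)

theorem LocallyAC.continuousOn (hf : LocallyAC f) : ContinuousOn f (Ioi 0) := by
  intro x hx
  have hIcc := (hf (x / 2) (x + 1) (half_pos hx) (add_pos hx one_pos)).continuousOn
  rw [mem_Ioi] at hx
  rw [uIcc_of_le (by linarith)] at hIcc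
  exact (hIcc.continuousAt (Icc_mem_nhds (by linarith) (by linarith))).continuousWithinAt

theorem LocallyAC.mul {f g : ℝ → ℂ} (hf : LocallyAC f) (hg : LocallyAC g) :
    LocallyAC fun x => f x * g x :=
  fun a b ha hb => (hf a b ha hb).fun_smul (hg a b ha hb)

theorem LocallyAC.div_const {f : ℝ → ℂ} (hf : LocallyAC f) (w : ℂ) : LocallyAC fun x => f x / w :=
  fun a b ha hb => absolutelyContinuousOnInterval_congr ((hf a b ha hb).const_smul w⁻¹)
    fun x _ => by simp [div_eq_inv_mul]

theorem LocallyAC.ae_differentiableAt {f : ℝ → ℂ} (hf : LocallyAC f) :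
    ∀ᵐ x, x ∈ Ioi (0 : ℝ) → DifferentiableAt ℝ f x := by
  refine ae_of_mem_of_ae_of_mem_inter_Ioo fun a b ha hb _ => ?_
  filter_upwards [ae_differentiableAt_of_absolutelyContinuousOnInterval (hf a b ha hb)] with x hx hI
  exact hx (Icc_subset_uIcc (Ioo_subset_Icc_self hI.2))

variable [NormedSpace ℝ E]

theorem locallyAC_of_hasDerivAt {f' : ℝ → E} (hf : ∀ x, 0 < x → HasDerivAt f (f' x) x)
    (hf' : ContinuousOn f' (Ioi 0)) : LocallyAC f := fun _ _ ha hb =>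
  absolutelyContinuousOnInterval_of_hasDerivAt (fun x hx => hf x (pos_of_mem_uIcc ha hb hx))
    (hf'.mono fun _ hx => pos_of_mem_uIcc ha hb hx)

theorem locallyAC_primitive (hf : ∀ a, 0 < a → IntervalIntegrable f volume 0 a) :
    LocallyAC fun x => ∫ t in (0 : ℝ)..x, f t := by
  intro a b ha hb
  have hmax : 0 < max a b := lt_max_of_lt_left ha
  refine (absolutelyContinuousOnInterval_intervalIntegral (hf _ hmax) left_mem_uIcc).mono ?_
  rw [uIcc_of_le hmax.le]
  exact uIcc_subset_Icc ⟨ha.le, le_max_left a b⟩ ⟨hb.le, le_max_right a b⟩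

variable [CompleteSpace E]

theorem ae_hasDerivAt_primitive (hf : ∀ a, 0 < a → IntervalIntegrable f volume 0 a) :
    ∀ᵐ x, x ∈ Ioi (0 : ℝ) → HasDerivAt (fun x => ∫ t in (0 : ℝ)..x, f t) (f x) x := by
  refine ae_of_mem_of_ae_of_mem_inter_Ioo fun a b _ hb _ => ?_
  filter_upwards [(hf b hb).ae_hasDerivAt_integral] with x hx hI
  refine hx ?_ 0 left_mem_uIcc
  rw [uIcc_of_le (le_of_lt hb)]
  exact ⟨le_of_lt hI.1, hI.2.2.le⟩

theorem LocallyAC.hasDerivAt_of_ae {f' : ℝ → E} (hf : LocallyAC f)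
    (hf' : ContinuousOn f' (Ioi 0)) (h : ∀ᵐ x, x ∈ Ioi (0 : ℝ) → HasDerivAt f (f' x) x) {x : ℝ}
    (hx : 0 < x) : HasDerivAt f (f' x) x := by
  have hftc {y : ℝ} (hy : 0 < y) : ∫ t in x..y, f' t = f y - f x := by
    refine integral_eq_sub_of_absolutelyContinuousOnInterval (hf x y hx hy) ?_
      (hf'.mono fun t ht => pos_of_mem_uIcc hx hy ht).intervalIntegrable
    filter_upwards [h] with t ht hI using ht (pos_of_mem_uIcc hx hy hI)
  have hprim : HasDerivAt (fun y => ∫ t in x..y, f' t) (f' x) x :=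
    intervalIntegral.integral_hasDerivAt_right (by simp)
      (hf'.stronglyMeasurableAtFilter isOpen_Ioi x hx) (hf'.continuousAt (Ioi_mem_nhds hx))
  refine (hprim.add_const (f x)).congr_of_eventuallyEq ?_
  filter_upwards [Ioi_mem_nhds hx] with y hy
  rw [hftc hy, sub_add_cancel]

end LocallyAC

theorem AC1.continuousOn {f : ℝ → ℂ} (hf : AC1 f) : ContinuousOn f (Ioi 0) :=
  fun x hx => (hf.1 x hx).continuousAt.continuousWithinAt

theorem AC1.locallyAC_deriv {f : ℝ → ℂ} (hf : AC1 f) : LocallyAC (deriv f) := hf.2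

theorem AC1.locallyAC {f : ℝ → ℂ} (hf : AC1 f) : LocallyAC f :=
  locallyAC_of_hasDerivAt (fun x hx => (hf.1 x hx).hasDerivAt) hf.locallyAC_deriv.continuousOn

theorem AC1.sub {f g : ℝ → ℂ} (hf : AC1 f) (hg : AC1 g) : AC1 fun x => f x - g x :=
  ⟨fun x hx => (hf.1 x hx).sub (hg.1 x hx), (hf.locallyAC_deriv.sub hg.locallyAC_deriv).congr
    fun x hx => deriv_fun_sub (hf.1 x hx) (hg.1 x hx)⟩

section Eigensolution

variable {m k : ℂ} {Q f g : ℝ → ℂ}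

theorem isEigensolution_iff_ae_hasDerivAt : IsEigensolution m k Q f ↔
    AC1 f ∧ ∀ᵐ x, x ∈ Ioi (0 : ℝ) →
      HasDerivAt (deriv f) (((m ^ 2 - 1 / 4) / (x : ℂ) ^ 2 + k ^ 2) * f x + Q x * f x) x := by
  refine and_congr_right fun hf => ?_
  rw [ae_restrict_iff' measurableSet_Ioi]
  constructor
  · intro h
    filter_upwards [h, hf.locallyAC_deriv.ae_differentiableAt] with x heq hd hx
    exact (hd hx).hasDerivAt.congr_deriv (by linear_combination -heq hx)
  · intro h
    filter_upwards [h] with x hd hx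
    rw [(hd hx).deriv]
    ring

theorem IsEigensolution.sub (hf : IsEigensolution m k Q f) (hg : IsEigensolution m k Q g) :
    IsEigensolution m k Q fun x => f x - g x := by
  rw [isEigensolution_iff_ae_hasDerivAt] at hf hg ⊢
  refine ⟨hf.1.sub hg.1, ?_⟩
  filter_upwards [hf.2, hg.2] with x hfx hgx hx
  refine (((hfx hx).fun_sub (hgx hx)).congr_of_eventuallyEq ?_).congr_deriv (by ring)
  filter_upwards [Ioi_mem_nhds hx] with y hy using deriv_fun_sub (hf.1.1 y hy) (hg.1.1 y hy)

end Eigensolution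

/-! ### Solutions of the unperturbed equation -/

/-- `f` is a classical solution of the unperturbed equation on `]0,∞[`, with derivative `f'`. -/
def IsFreeSolution (m k : ℂ) (f f' : ℝ → ℂ) : Prop :=
  ∀ x : ℝ, 0 < x → HasDerivAt f (f' x) x ∧
    HasDerivAt f' (((m ^ 2 - 1 / 4) / (x : ℂ) ^ 2 + k ^ 2) * f x) x

section FreeSolution

variable {m k w : ℂ} {f f' g g' h₁ h₂ : ℝ → ℂ}

theorem IsFreeSolution.continuousOn (h : IsFreeSolution m k f f') : ContinuousOn f (Ioi 0) :=
  fun x hx => (h x hx).1.continuousAt.continuousWithinAt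

theorem IsFreeSolution.continuousOn_deriv (h : IsFreeSolution m k f f') :
    ContinuousOn f' (Ioi 0) :=
  fun x hx => (h x hx).2.continuousAt.continuousWithinAt

theorem continuousOn_potential_mul (m k : ℂ) (hf : ContinuousOn f (Ioi 0)) :
    ContinuousOn (fun x : ℝ => ((m ^ 2 - 1 / 4) / (x : ℂ) ^ 2 + k ^ 2) * f x) (Ioi 0) :=
  ((continuousOn_const.div (by fun_prop) fun _ hx =>
    pow_ne_zero 2 (Complex.ofReal_ne_zero.2 (ne_of_gt hx))).add continuousOn_const).mul hf

theorem IsFreeSolution.locallyAC (h : IsFreeSolution m k f f') : LocallyAC f :=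
  locallyAC_of_hasDerivAt (fun x hx => (h x hx).1) h.continuousOn_deriv

theorem IsFreeSolution.locallyAC_deriv (h : IsFreeSolution m k f f') : LocallyAC f' :=
  locallyAC_of_hasDerivAt (fun x hx => (h x hx).2) (continuousOn_potential_mul m k h.continuousOn)

theorem IsFreeSolution.eqOn_deriv (h : IsFreeSolution m k f f') : EqOn (deriv f) f' (Ioi 0) :=
  fun x hx => (h x hx).1.deriv

theorem IsFreeSolution.congr (h : IsFreeSolution m k f f') (hfg : EqOn g f (Ioi 0)) :
    IsFreeSolution m k g f' := by
  intro x hx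
  refine ⟨(h x hx).1.congr_of_eventuallyEq ?_, by rw [hfg hx]; exact (h x hx).2⟩
  filter_upwards [Ioi_mem_nhds hx] with y hy using hfg hy

theorem IsFreeSolution.isEigensolution (h : IsFreeSolution m k f f') :
    IsEigensolution m k 0 f := by
  refine isEigensolution_iff_ae_hasDerivAt.2
    ⟨⟨fun x hx => (h x hx).1.differentiableAt, h.locallyAC_deriv.congr h.eqOn_deriv⟩,
      Eventually.of_forall fun x hx => ?_⟩
  refine ((h x hx).2.congr_of_eventuallyEq ?_).congr_deriv (by simp)
  filter_upwards [Ioi_mem_nhds hx] with y hy using h.eqOn_deriv hy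

theorem IsEigensolution.isFreeSolution (h : IsEigensolution m k 0 f) :
    IsFreeSolution m k f (deriv f) := by
  obtain ⟨hf, hd⟩ := isEigensolution_iff_ae_hasDerivAt.1 h
  refine fun x hx => ⟨(hf.1 x hx).hasDerivAt, hf.locallyAC_deriv.hasDerivAt_of_ae
    (continuousOn_potential_mul m k hf.continuousOn) ?_ hx⟩
  simpa using hd

theorem IsFreeSolution.wronskian_eq (hf : IsFreeSolution m k f f') (hg : IsFreeSolution m k g g')
    {x y : ℝ} (hx : 0 < x) (hy : 0 < y) :
    f x * g' x - f' x * g x = f y * g' y - f' y * g y := by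
  have hd : ∀ z ∈ Ioi (0 : ℝ), HasDerivAt (fun z => f z * g' z - f' z * g z) 0 z := fun z hz =>
    (((hf z hz).1.fun_mul (hg z hz).2).fun_sub
      ((hf z hz).2.fun_mul (hg z hz).1)).congr_deriv (by ring)
  exact isOpen_Ioi.is_const_of_deriv_eq_zero isPreconnected_Ioi
    (fun z hz => (hd z hz).differentiableAt.differentiableWithinAt)
    (fun z hz => (hd z hz).deriv) hx hy

theorem IsFundamentalPair.left (h : IsFundamentalPair m k h₁ h₂ w) :
    IsFreeSolution m k h₁ (deriv h₁) := h.1.isFreeSolution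

theorem IsFundamentalPair.right (h : IsFundamentalPair m k h₁ h₂ w) :
    IsFreeSolution m k h₂ (deriv h₂) := h.2.1.isFreeSolution

theorem IsFundamentalPair.wronskian_ne_zero (h : IsFundamentalPair m k h₁ h₂ w) : w ≠ 0 := h.2.2.1

theorem IsFundamentalPair.wronskian (h : IsFundamentalPair m k h₁ h₂ w) {x : ℝ} (hx : 0 < x) :
    h₁ x * deriv h₂ x - deriv h₁ x * h₂ x = w := h.2.2.2 x hx

theorem IsFreeSolution.isFundamentalPair (hf : IsFreeSolution m k f f')
    (hg : IsFreeSolution m k g g') (hw : w ≠ 0)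
    (h : ∀ x, 0 < x → f x * g' x - f' x * g x = w) : IsFundamentalPair m k f g w :=
  ⟨hf.isEigensolution, hg.isEigensolution, hw, fun x hx => by
    rw [hf.eqOn_deriv hx, hg.eqOn_deriv hx, h x hx]⟩

theorem IsFundamentalPair.exists_eq_combination (h : IsFundamentalPair m k h₁ h₂ w)
    (hf : IsFreeSolution m k f f') : ∃ c₁ c₂ : ℂ, ∀ x, 0 < x →
      f x = c₁ * h₁ x + c₂ * h₂ x ∧ f' x = c₁ * deriv h₁ x + c₂ * deriv h₂ x := by
  refine ⟨(f 1 * deriv h₂ 1 - f' 1 * h₂ 1) / w, (h₁ 1 * f' 1 - deriv h₁ 1 * f 1) / w,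
    fun x hx => ?_⟩
  have hw := h.wronskian_ne_zero
  rw [hf.wronskian_eq h.right one_pos hx, h.left.wronskian_eq hf one_pos hx]
  constructor <;> field_simp <;> rw [← h.wronskian hx] <;> ring

theorem IsFundamentalPair.exists_kernel_eq_mul {p₁ p₂ : ℝ → ℂ} {w' : ℂ}
    (h : IsFundamentalPair m k h₁ h₂ w) (p : IsFundamentalPair m k p₁ p₂ w') :
    ∃ c : ℂ, w' = c * w ∧ ∀ x y, 0 < x → 0 < y →
      p₁ x * p₂ y - p₂ x * p₁ y = c * (h₁ x * h₂ y - h₂ x * h₁ y) ∧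
      deriv p₁ x * p₂ y - deriv p₂ x * p₁ y = c * (deriv h₁ x * h₂ y - deriv h₂ x * h₁ y) := by
  obtain ⟨a₁, b₁, hp₁⟩ := h.exists_eq_combination p.left
  obtain ⟨a₂, b₂, hp₂⟩ := h.exists_eq_combination p.right
  refine ⟨a₁ * b₂ - a₂ * b₁, ?_, fun x y hx hy => ?_⟩
  · rw [← p.wronskian one_pos, ← h.wronskian one_pos, (hp₁ 1 one_pos).1, (hp₁ 1 one_pos).2,
      (hp₂ 1 one_pos).1, (hp₂ 1 one_pos).2]
    ring
  · rw [(hp₁ x hx).1, (hp₁ x hx).2, (hp₁ y hy).1, (hp₂ x hx).1, (hp₂ x hx).2, (hp₂ y hy).1]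
    constructor <;> ring

theorem IsFundamentalPair.forwardGreen_eq {p₁ p₂ : ℝ → ℂ} {w' : ℂ}
    (h : IsFundamentalPair m k h₁ h₂ w) (p : IsFundamentalPair m k p₁ p₂ w') {x y : ℝ}
    (hx : 0 < x) (hy : 0 < y) : forwardGreen p₁ p₂ w' x y = forwardGreen h₁ h₂ w x y := by
  obtain ⟨c, hw', hkernel⟩ := h.exists_kernel_eq_mul p
  have hc : c ≠ 0 := left_ne_zero_of_mul (hw' ▸ p.wronskian_ne_zero)
  rw [forwardGreen, forwardGreen, (hkernel x y hx hy).1, hw', mul_div_mul_left _ _ hc]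

theorem IsFundamentalPair.applyGQ_forwardGreen_eq {p₁ p₂ : ℝ → ℂ} {w' : ℂ}
    (h : IsFundamentalPair m k h₁ h₂ w) (p : IsFundamentalPair m k p₁ p₂ w') (Q f : ℝ → ℂ)
    {x : ℝ} (hx : 0 < x) :
    applyGQ (forwardGreen p₁ p₂ w') Q f x = applyGQ (forwardGreen h₁ h₂ w) Q f x :=
  setIntegral_congr_fun measurableSet_Ioi fun y hy => by
    simp only [h.forwardGreen_eq p hx hy]

end FreeSolution

/-! ### Variation of constants -/

section VariationOfConstants

variable {m k w : ℂ} {h₁ h₂ p₁ p₂ p₁' p₂' Q f g g₀ g₀' : ℝ → ℂ} {a x : ℝ}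

/-- The combination `(p₁ ∫₀ˣ h₂ Q f - p₂ ∫₀ˣ h₁ Q f) / w`. It is `G_→ Q f` for `pᵢ = hᵢ`, and the
derivative of `G_→ Q f` for `pᵢ = hᵢ'`. -/
def greenInt (h₁ h₂ : ℝ → ℂ) (w : ℂ) (Q f p₁ p₂ : ℝ → ℂ) (x : ℝ) : ℂ :=
  (p₁ x * (∫ y in (0 : ℝ)..x, h₂ y * Q y * f y) -
    p₂ x * ∫ y in (0 : ℝ)..x, h₁ y * Q y * f y) / w

/-- Integrability of `h₁ Q f` and `h₂ Q f` from the origin to `a`. -/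
structure PairIntegrable (h₁ h₂ Q f : ℝ → ℂ) (a : ℝ) : Prop where
  left : IntervalIntegrable (fun y => h₁ y * Q y * f y) volume 0 a
  right : IntervalIntegrable (fun y => h₂ y * Q y * f y) volume 0 a

theorem forwardGreen_mul_eq_indicator (h₁ h₂ : ℝ → ℂ) (w : ℂ) (Q f : ℝ → ℂ) (x : ℝ) :
    (fun y => forwardGreen h₁ h₂ w x y * Q y * f y) =
      (Iic x).indicator fun y =>
        h₁ x / w * (h₂ y * Q y * f y) - h₂ x / w * (h₁ y * Q y * f y) := by
  ext y
  by_cases hy : y ≤ x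
  · rw [indicator_of_mem (mem_Iic.2 hy), forwardGreen, if_pos hy]
    ring
  · rw [indicator_of_notMem (notMem_Iic.2 (not_le.1 hy)), forwardGreen, if_neg hy]
    ring

theorem PairIntegrable.integrableOn_forwardGreen (h : PairIntegrable h₁ h₂ Q f x) (w : ℂ) :
    IntegrableOn (fun y => forwardGreen h₁ h₂ w x y * Q y * f y) (Ioi 0) := by
  rw [forwardGreen_mul_eq_indicator, IntegrableOn, integrable_indicator_iff measurableSet_Iic,
    IntegrableOn, Measure.restrict_restrict measurableSet_Iic, inter_comm, Ioi_inter_Iic]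
  exact (h.right.1.const_mul _).sub (h.left.1.const_mul _)

theorem PairIntegrable.applyGQ_eq (h : PairIntegrable h₁ h₂ Q f x) (hx : 0 ≤ x) (w : ℂ) :
    applyGQ (forwardGreen h₁ h₂ w) Q f x = greenInt h₁ h₂ w Q f h₁ h₂ x := by
  rw [applyGQ, forwardGreen_mul_eq_indicator, setIntegral_indicator measurableSet_Iic,
    Ioi_inter_Iic, integral_sub (h.right.1.const_mul _) (h.left.1.const_mul _),
    integral_const_mul, integral_const_mul, greenInt, intervalIntegral.integral_of_le hx,
    intervalIntegral.integral_of_le hx]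
  ring

theorem applyGQ_forwardGreen_congr_ae (h₁ h₂ : ℝ → ℂ) (w : ℂ) (Q : ℝ → ℂ)
    (h : f =ᵐ[volume.restrict (Ioo 0 x)] g) :
    applyGQ (forwardGreen h₁ h₂ w) Q f x = applyGQ (forwardGreen h₁ h₂ w) Q g x := by
  rw [restrict_Ioo_eq_restrict_Ioc, EventuallyEq, ae_restrict_iff' measurableSet_Ioc] at h
  refine setIntegral_congr_ae measurableSet_Ioi ?_
  filter_upwards [h] with y hy hy0
  by_cases hyx : y ≤ x
  · rw [hy ⟨hy0, hyx⟩]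
  · simp only [forwardGreen, if_neg hyx, zero_mul]

theorem locallyAC_greenInt (hi : ∀ a, 0 < a → PairIntegrable h₁ h₂ Q f a) (hp₁ : LocallyAC p₁)
    (hp₂ : LocallyAC p₂) : LocallyAC (greenInt h₁ h₂ w Q f p₁ p₂) :=
  ((hp₁.mul (locallyAC_primitive fun a ha => (hi a ha).right)).sub
    (hp₂.mul (locallyAC_primitive fun a ha => (hi a ha).left))).div_const w

theorem ae_hasDerivAt_greenInt (hi : ∀ a, 0 < a → PairIntegrable h₁ h₂ Q f a)
    (hp₁ : ∀ x, 0 < x → HasDerivAt p₁ (p₁' x) x) (hp₂ : ∀ x, 0 < x → HasDerivAt p₂ (p₂' x) x) :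
    ∀ᵐ x, x ∈ Ioi (0 : ℝ) → HasDerivAt (greenInt h₁ h₂ w Q f p₁ p₂)
      (greenInt h₁ h₂ w Q f p₁' p₂' x + (p₁ x * h₂ x - p₂ x * h₁ x) / w * (Q x * f x)) x := by
  filter_upwards [ae_hasDerivAt_primitive fun a ha => (hi a ha).left,
    ae_hasDerivAt_primitive fun a ha => (hi a ha).right] with x hI₁ hI₂ hx
  refine ((((hp₁ x hx).mul (hI₂ hx)).sub ((hp₂ x hx).mul (hI₁ hx))).div_const w).congr_deriv ?_
  rw [greenInt]
  ring

section FundamentalPair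

variable (hp : IsFundamentalPair m k h₁ h₂ w)
include hp

theorem IsFundamentalPair.ae_hasDerivAt_greenInt
    (hi : ∀ a, 0 < a → PairIntegrable h₁ h₂ Q f a) :
    ∀ᵐ x, x ∈ Ioi (0 : ℝ) → HasDerivAt (greenInt h₁ h₂ w Q f h₁ h₂)
      (greenInt h₁ h₂ w Q f (deriv h₁) (deriv h₂) x) x := by
  filter_upwards [PerturbedBessel.ae_hasDerivAt_greenInt hi (w := w)
    (fun x hx => (hp.left x hx).1) (fun x hx => (hp.right x hx).1)] with x hd hx
  exact (hd hx).congr_deriv (by ring)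

theorem IsFundamentalPair.ae_hasDerivAt_greenInt_deriv
    (hi : ∀ a, 0 < a → PairIntegrable h₁ h₂ Q f a) :
    ∀ᵐ x, x ∈ Ioi (0 : ℝ) → HasDerivAt (greenInt h₁ h₂ w Q f (deriv h₁) (deriv h₂))
      (((m ^ 2 - 1 / 4) / (x : ℂ) ^ 2 + k ^ 2) * greenInt h₁ h₂ w Q f h₁ h₂ x - Q x * f x) x := by
  filter_upwards [PerturbedBessel.ae_hasDerivAt_greenInt hi (w := w)
    (fun x hx => (hp.left x hx).2) (fun x hx => (hp.right x hx).2)] with x hd hx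
  refine (hd hx).congr_deriv ?_
  have hwx : (deriv h₁ x * h₂ x - deriv h₂ x * h₁ x) / w = -1 := by
    rw [div_eq_iff hp.wronskian_ne_zero, ← hp.wronskian hx]
    ring
  rw [hwx, greenInt, greenInt]
  ring

theorem hasDerivAt_of_volterra (hg₀ : IsFreeSolution m k g₀ g₀')
    (hi : ∀ a, 0 < a → PairIntegrable h₁ h₂ Q g a)
    (hg : ∀ x, 0 < x → g x + greenInt h₁ h₂ w Q g h₁ h₂ x = g₀ x) (hx : 0 < x) :
    HasDerivAt g (g₀' x - greenInt h₁ h₂ w Q g (deriv h₁) (deriv h₂) x) x := by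
  have hg' : EqOn g (fun x => g₀ x - greenInt h₁ h₂ w Q g h₁ h₂ x) (Ioi 0) :=
    fun x hx => eq_sub_of_add_eq (hg x hx)
  have hac : LocallyAC g :=
    (hg₀.locallyAC.sub (locallyAC_greenInt hi hp.left.locallyAC hp.right.locallyAC)).congr hg'
  refine hac.hasDerivAt_of_ae (hg₀.continuousOn_deriv.sub
    (locallyAC_greenInt hi hp.left.locallyAC_deriv hp.right.locallyAC_deriv).continuousOn) ?_ hx
  filter_upwards [hp.ae_hasDerivAt_greenInt hi] with y hy hy0
  refine ((hg₀ y hy0).1.sub (hy hy0)).congr_of_eventuallyEq ?_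
  filter_upwards [Ioi_mem_nhds hy0] with z hz using hg' hz

theorem isEigensolution_of_volterra (hg₀ : IsFreeSolution m k g₀ g₀')
    (hi : ∀ a, 0 < a → PairIntegrable h₁ h₂ Q g a)
    (hg : ∀ x, 0 < x → g x + greenInt h₁ h₂ w Q g h₁ h₂ x = g₀ x) :
    IsEigensolution m k Q g := by
  have hd := fun x hx => hasDerivAt_of_volterra hp hg₀ hi hg (x := x) hx
  have hderiv : EqOn (deriv g)
      (fun x => g₀' x - greenInt h₁ h₂ w Q g (deriv h₁) (deriv h₂) x) (Ioi 0) :=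
    fun x hx => (hd x hx).deriv
  refine isEigensolution_iff_ae_hasDerivAt.2 ⟨⟨fun x hx => (hd x hx).differentiableAt,
    (hg₀.locallyAC_deriv.sub (locallyAC_greenInt hi hp.left.locallyAC_deriv
      hp.right.locallyAC_deriv)).congr hderiv⟩, ?_⟩
  filter_upwards [hp.ae_hasDerivAt_greenInt_deriv hi] with x hG hx
  refine (((hg₀ x hx).2.sub (hG hx)).congr_of_eventuallyEq ?_).congr_deriv ?_
  · filter_upwards [Ioi_mem_nhds hx] with y hy using hderiv hy
  · rw [← hg x hx]
    ring

theorem IsEigensolution.isFreeSolution_add_greenInt (hf : IsEigensolution m k Q f)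
    (hi : ∀ a, 0 < a → PairIntegrable h₁ h₂ Q f a) :
    IsFreeSolution m k (fun x => f x + greenInt h₁ h₂ w Q f h₁ h₂ x)
      fun x => deriv f x + greenInt h₁ h₂ w Q f (deriv h₁) (deriv h₂) x := by
  obtain ⟨hac, hf⟩ := isEigensolution_iff_ae_hasDerivAt.1 hf
  have hG := locallyAC_greenInt (w := w) hi hp.left.locallyAC hp.right.locallyAC
  have hG' := locallyAC_greenInt (w := w) hi hp.left.locallyAC_deriv hp.right.locallyAC_deriv
  refine fun x hx => ⟨(hac.locallyAC.add hG).hasDerivAt_of_ae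
      (hac.locallyAC_deriv.continuousOn.add hG'.continuousOn) ?_ hx,
    (hac.locallyAC_deriv.add hG').hasDerivAt_of_ae
      (continuousOn_potential_mul m k (hac.continuousOn.add hG.continuousOn)) ?_ hx⟩
  · filter_upwards [hp.ae_hasDerivAt_greenInt hi] with y hy hy0
    exact (hac.1 y hy0).hasDerivAt.add (hy hy0)
  · filter_upwards [hf, hp.ae_hasDerivAt_greenInt_deriv hi] with y hfy hy hy0
    exact ((hfy hy0).add (hy hy0)).congr_deriv (by rw [Pi.add_apply]; ring)

end FundamentalPair

end VariationOfConstants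

/-! ### Weighted spaces and contractions -/

theorem exists_memLp_of_contraction {α E : Type*} [MeasurableSpace α] {μ : Measure α}
    [NormedAddCommGroup E] [CompleteSpace E] {p : ENNReal} [Fact (1 ≤ p)] {K : NNReal}
    (hK : K < 1) {Φ : (α → E) → α → E} (hΦ : ∀ f, MemLp f p μ → MemLp (Φ f) p μ)
    (hlip : ∀ f g, MemLp f p μ → MemLp g p μ →
      eLpNorm (Φ f - Φ g) p μ ≤ K * eLpNorm (f - g) p μ) :
    ∃ g, MemLp g p μ ∧ g =ᵐ[μ] Φ g := by
  set Ψ : Lp E p μ → Lp E p μ := fun f => (hΦ f (Lp.memLp f)).toLp (Φ f) with hΨ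
  have hΨc : ContractingWith K Ψ := by
    refine ⟨hK, fun f g => ?_⟩
    rw [hΨ, Lp.edist_toLp_toLp, Lp.edist_def]
    exact hlip f g (Lp.memLp f) (Lp.memLp g)
  obtain ⟨g, hg⟩ : ∃ g, Ψ g = g := ⟨_, hΨc.fixedPoint_isFixedPt⟩
  refine ⟨g, Lp.memLp g, ?_⟩
  have hgΦ := (hΦ g (Lp.memLp g)).coeFn_toLp
  rwa [show (hΦ g (Lp.memLp g)).toLp (Φ g) = g from hg] at hgΦ

/-- The weights on `]0,a[` for which `f ↦ f / φ` identifies the weighted space with `L^∞`. -/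
structure IsWeight (a : ℝ) (φ : ℝ → ℝ) : Prop where
  pos : ∀ x ∈ Ioo 0 a, 0 < φ x
  continuousOn : ContinuousOn φ (Ioo 0 a)

theorem ae_mem_Ioo (a : ℝ) : ∀ᵐ x ∂(volume.restrict (Ioo 0 a)), x ∈ Ioo 0 a :=
  ae_restrict_mem measurableSet_Ioo

section WeightedSpace

variable {a b K M : ℝ} {φ ψ : ℝ → ℝ} {f g : ℝ → ℂ} {G : ℝ → ℝ → ℂ} {Q : ℝ → ℂ}

theorem IsWeight.norm_div (hφ : IsWeight a φ) (f : ℝ → ℂ) {x : ℝ} (hx : x ∈ Ioo 0 a) :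
    ‖f x / (φ x : ℂ)‖ = ‖f x‖ / φ x := by
  rw [_root_.norm_div, Complex.norm_of_nonneg (hφ.pos x hx).le]

theorem IsWeight.aestronglyMeasurable_ofReal (hφ : IsWeight a φ) :
    AEStronglyMeasurable (fun x => (φ x : ℂ)) (volume.restrict (Ioo 0 a)) :=
  (Complex.continuous_ofReal.comp_continuousOn hφ.continuousOn).aestronglyMeasurable
    measurableSet_Ioo

theorem MemW.aestronglyMeasurable (hf : MemW a φ f) (hφ : IsWeight a φ) :
    AEStronglyMeasurable f (volume.restrict (Ioo 0 a)) := by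
  refine (hf.1.mul hφ.aestronglyMeasurable_ofReal).congr ?_
  filter_upwards [ae_mem_Ioo a] with x hx
  exact div_mul_cancel₀ _ (Complex.ofReal_ne_zero.2 (hφ.pos x hx).ne')

theorem IsWeight.memW (hφ : IsWeight a φ)
    (hf : AEStronglyMeasurable f (volume.restrict (Ioo 0 a))) (h : wNorm a φ f < ⊤) :
    MemW a φ f :=
  ⟨(hf.aemeasurable.div hφ.aestronglyMeasurable_ofReal.aemeasurable).aestronglyMeasurable, h⟩

theorem IsWeight.wNorm_le (hφ : IsWeight a φ)
    (h : ∀ᵐ x ∂(volume.restrict (Ioo 0 a)), ‖f x‖ ≤ M * φ x) :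
    wNorm a φ f ≤ ENNReal.ofReal M := by
  rw [wNorm, eLpNorm_exponent_top]
  refine eLpNormEssSup_le_of_ae_bound ?_
  filter_upwards [h, ae_mem_Ioo a] with x hx hx0
  rwa [hφ.norm_div f hx0, div_le_iff₀ (hφ.pos x hx0)]

theorem MemW.ae_norm_le (hf : MemW a φ f) (hφ : IsWeight a φ) :
    ∀ᵐ x ∂(volume.restrict (Ioo 0 a)), ‖f x‖ ≤ (wNorm a φ f).toReal * φ x := by
  filter_upwards [ae_le_eLpNormEssSup (f := fun x => f x / (φ x : ℂ))
    (μ := volume.restrict (Ioo 0 a)), ae_mem_Ioo a] with x hx hx0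
  rw [← eLpNorm_exponent_top] at hx
  have hle := ENNReal.toReal_mono hf.2.ne hx
  rwa [toReal_enorm, hφ.norm_div f hx0, div_le_iff₀ (hφ.pos x hx0)] at hle

theorem IsWeight.wNorm_le_mul_wNorm (hφ : IsWeight a φ) (hψ : IsWeight a ψ)
    (h : ∀ x ∈ Ioo 0 a, ψ x ≤ K * φ x) (f : ℝ → ℂ) :
    wNorm a φ f ≤ ENNReal.ofReal K * wNorm a ψ f := by
  refine eLpNorm_le_mul_eLpNorm_of_ae_le_mul ?_ ⊤
  filter_upwards [ae_mem_Ioo a] with x hx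
  rw [hφ.norm_div f hx, hψ.norm_div f hx, ← mul_div_assoc,
    div_le_div_iff₀ (hφ.pos x hx) (hψ.pos x hx)]
  calc ‖f x‖ * ψ x ≤ ‖f x‖ * (K * φ x) := by gcongr; exact h x hx
    _ = K * ‖f x‖ * φ x := by ring

theorem MemW.of_weight_le (hf : MemW a ψ f) (hφ : IsWeight a φ) (hψ : IsWeight a ψ)
    (h : ∀ x ∈ Ioo 0 a, ψ x ≤ K * φ x) : MemW a φ f :=
  hφ.memW (hf.aestronglyMeasurable hψ) ((hφ.wNorm_le_mul_wNorm hψ h f).trans_lt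
    (ENNReal.mul_lt_top ENNReal.ofReal_lt_top hf.2))

theorem MemW.mono (hf : MemW a φ f) (h : b ≤ a) : MemW b φ f :=
  hf.mono_measure (Measure.restrict_mono (Ioo_subset_Ioo_right h) le_rfl)

theorem MemW.sub (hf : MemW a φ f) (hg : MemW a φ g) : MemW a φ fun x => f x - g x := by
  simp only [MemW, sub_div]
  exact MemLp.sub hf hg

theorem MemW.congr_ae (hf : MemW a φ f) (h : f =ᵐ[volume.restrict (Ioo 0 a)] g) : MemW a φ g :=
  hf.ae_eq (h.div .rfl)

theorem wNorm_congr_ae (h : f =ᵐ[volume.restrict (Ioo 0 a)] g) : wNorm a φ f = wNorm a φ g :=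
  eLpNorm_congr_ae (h.div .rfl)

theorem wNorm_neg (a : ℝ) (φ : ℝ → ℝ) (f : ℝ → ℂ) :
    wNorm a φ (fun x => -f x) = wNorm a φ f := by
  simp only [wNorm, neg_div]
  exact eLpNorm_neg (fun x => f x / (φ x : ℂ)) _ _

theorem wNorm_sub_comm (a : ℝ) (φ : ℝ → ℝ) (f g : ℝ → ℂ) :
    wNorm a φ (fun x => f x - g x) = wNorm a φ fun x => g x - f x := by
  rw [← wNorm_neg]
  simp only [neg_sub]

theorem MemW.wNorm_sub_le (hf : MemW a φ f) (hg : MemW a φ g) :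
    wNorm a φ (fun x => f x - g x) ≤ wNorm a φ f + wNorm a φ g := by
  simp only [wNorm, sub_div]
  exact eLpNorm_sub_le hf.1 hg.1 le_top

theorem IsWeight.ae_eq_zero (hφ : IsWeight a φ) (hf : MemW a φ f) (h : wNorm a φ f = 0) :
    f =ᵐ[volume.restrict (Ioo 0 a)] 0 := by
  filter_upwards [hf.ae_norm_le hφ] with x hx
  simpa only [h, ENNReal.toReal_zero, zero_mul, norm_le_zero_iff, Pi.zero_apply] using hx

theorem IsWeight.exists_memW_of_contraction (hψ : IsWeight a ψ) {T : (ℝ → ℂ) → ℝ → ℂ}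
    {K : NNReal} (hK : K < 1) (hT : ∀ f, MemW a ψ f → MemW a ψ (T f))
    (hlip : ∀ f g, MemW a ψ f → MemW a ψ g →
      wNorm a ψ (fun x => T f x - T g x) ≤ K * wNorm a ψ fun x => f x - g x) :
    ∃ g, MemW a ψ g ∧ g =ᵐ[volume.restrict (Ioo 0 a)] T g := by
  set μ := volume.restrict (Ioo 0 a)
  have hdiv (F : ℝ → ℂ) : (fun x => ψ x * F x / ψ x) =ᵐ[μ] F := by
    filter_upwards [ae_mem_Ioo a] with x hx
    exact mul_div_cancel_left₀ _ (Complex.ofReal_ne_zero.2 (hψ.pos x hx).ne')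
  have hmem {F : ℝ → ℂ} (hF : MemLp F ⊤ μ) : MemW a ψ fun x => ψ x * F x :=
    hF.ae_eq (hdiv F).symm
  obtain ⟨F, hF, hFT⟩ := exists_memLp_of_contraction (μ := μ) (p := ⊤) hK
    (Φ := fun F x => T (fun y => ψ y * F y) x / ψ x) (fun F hF => hT _ (hmem hF))
    fun F₁ F₂ hF₁ hF₂ => by
      have hle := hlip _ _ (hmem hF₁) (hmem hF₂)
      simp only [wNorm, ← mul_sub] at hle
      rw [eLpNorm_congr_ae (hdiv fun x => F₁ x - F₂ x)] at hle
      simp only [sub_div] at hle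
      exact hle
  refine ⟨fun x => ψ x * F x, hmem hF, ?_⟩
  filter_upwards [hFT, ae_mem_Ioo a] with x hx hx0
  rw [hx, mul_div_cancel₀ _ (Complex.ofReal_ne_zero.2 (hψ.pos x hx0).ne')]

theorem applyGQ_sub {x : ℝ} (hf : IntegrableOn (fun y => G x y * Q y * f y) (Ioi 0))
    (hg : IntegrableOn (fun y => G x y * Q y * g y) (Ioi 0)) :
    applyGQ G Q (fun y => f y - g y) x = applyGQ G Q f x - applyGQ G Q g x := by
  simp only [applyGQ, mul_sub]
  exact integral_sub hf hg

theorem InvertibleOn.of_weight_le (h : InvertibleOn G Q a ψ) (hφ : IsWeight a φ)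
    (hψ : IsWeight a ψ) (hφψ : ∀ x ∈ Ioo 0 a, φ x ≤ ψ x)
    (hψφ : ∀ x ∈ Ioo 0 a, ψ x ≤ K * φ x) : InvertibleOn G Q a φ := by
  have hφψ' : ∀ x ∈ Ioo 0 a, φ x ≤ 1 * ψ x := by simpa only [one_mul] using hφψ
  have toψ {f : ℝ → ℂ} (hf : MemW a φ f) : MemW a ψ f := hf.of_weight_le hψ hφ hφψ'
  have norm_of_le {f g : ℝ → ℂ} {C : NNReal} (hfg : wNorm a ψ g ≤ C * wNorm a ψ f) :
      wNorm a φ g ≤ (K.toNNReal * C : NNReal) * wNorm a φ f := by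
    have hf := hψ.wNorm_le_mul_wNorm hφ hφψ' f
    rw [ENNReal.ofReal_one, one_mul] at hf
    calc wNorm a φ g ≤ ENNReal.ofReal K * wNorm a ψ g := hφ.wNorm_le_mul_wNorm hψ hψφ g
      _ ≤ ENNReal.ofReal K * (C * wNorm a φ f) := by gcongr; exact hfg.trans (by gcongr)
      _ = _ := by rw [ENNReal.coe_mul, mul_assoc]; rfl
  obtain ⟨C, hC⟩ := h.bounded
  obtain ⟨D, hD⟩ := h.surjective
  refine ⟨fun f hf => h.integrable f (toψ hf), ⟨K.toNNReal * C, fun f hf => ?_⟩,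
    fun f g hf hg => h.injective f g (toψ hf) (toψ hg), ⟨K.toNNReal * D, fun f hf => ?_⟩⟩
  · exact ⟨(hC f (toψ hf)).1.of_weight_le hφ hψ hψφ, norm_of_le (hC f (toψ hf)).2⟩
  · obtain ⟨g, hg, hgf, hle⟩ := hD f (toψ hf)
    exact ⟨g, hg.of_weight_le hφ hψ hψφ, hgf, norm_of_le hle⟩

section Contraction

variable (hψ : IsWeight a ψ)
  (hint : ∀ f, MemW a ψ f → ∀ x ∈ Ioo 0 a, IntegrableOn (fun y => G x y * Q y * f y) (Ioi 0))
  (hT : ∀ f, MemW a ψ f → MemW a ψ (applyGQ G Q f))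
  (hle : ∀ f, MemW a ψ f → wNorm a ψ (applyGQ G Q f) ≤ (1 / 2 : NNReal) * wNorm a ψ f)
include hψ hint hle

theorem ae_eq_of_contraction (hf : MemW a ψ f) (hg : MemW a ψ g)
    (h : ∀ᵐ x ∂(volume.restrict (Ioo 0 a)), f x + applyGQ G Q f x = g x + applyGQ G Q g x) :
    ∀ᵐ x ∂(volume.restrict (Ioo 0 a)), f x = g x := by
  have hfix : (fun x => f x - g x) =ᵐ[volume.restrict (Ioo 0 a)]
      fun x => -applyGQ G Q (fun y => f y - g y) x := by
    filter_upwards [h, ae_mem_Ioo a] with x hx hx0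
    rw [applyGQ_sub (hint f hf x hx0) (hint g hg x hx0)]
    linear_combination hx
  have hhalf : wNorm a ψ (fun x => f x - g x) ≤
      (1 / 2 : NNReal) * wNorm a ψ fun x => f x - g x := by
    calc wNorm a ψ (fun x => f x - g x)
        = wNorm a ψ (applyGQ G Q fun y => f y - g y) := by rw [wNorm_congr_ae hfix, wNorm_neg]
      _ ≤ _ := hle _ (hf.sub hg)
  have hzero : wNorm a ψ (fun x => f x - g x) = 0 := by
    by_contra hne
    have hlt := ENNReal.half_lt_self hne (hf.sub hg).2.ne
    rw [ENNReal.div_eq_inv_mul] at hlt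
    exact absurd hhalf (not_le.2 (by simpa using hlt))
  filter_upwards [hψ.ae_eq_zero (hf.sub hg) hzero] with x hx using sub_eq_zero.1 hx

include hT

theorem exists_preimage_of_contraction (hf : MemW a ψ f) :
    ∃ g, MemW a ψ g ∧ (∀ᵐ x ∂(volume.restrict (Ioo 0 a)), g x + applyGQ G Q g x = f x) ∧
      wNorm a ψ g ≤ (2 : NNReal) * wNorm a ψ f := by
  obtain ⟨g, hg, hfix⟩ := hψ.exists_memW_of_contraction (K := 1 / 2) (by norm_num)
    (T := fun g x => f x - applyGQ G Q g x) (fun g hg => hf.sub (hT g hg)) fun g₁ g₂ hg₁ hg₂ => by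
      refine (wNorm_congr_ae ?_).trans_le (hle _ (hg₂.sub hg₁)) |>.trans_eq ?_
      · filter_upwards [ae_mem_Ioo a] with x hx
        rw [applyGQ_sub (hint _ hg₂ x hx) (hint _ hg₁ x hx)]
        ring
      · rw [wNorm_sub_comm]
  refine ⟨g, hg, by filter_upwards [hfix] with x hx using by linear_combination hx, ?_⟩
  have htri : wNorm a ψ g ≤ wNorm a ψ f + (1 / 2 : NNReal) * wNorm a ψ g := by
    rw [wNorm_congr_ae hfix]
    refine (hf.wNorm_sub_le (hT g hg)).trans ?_
    rw [← wNorm_congr_ae hfix]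
    gcongr
    exact hle g hg
  lift wNorm a ψ g to NNReal using hg.2.ne with N
  lift wNorm a ψ f to NNReal using hf.2.ne with N₀
  norm_cast at htri ⊢
  rw [← NNReal.coe_le_coe] at htri ⊢
  push_cast at htri ⊢
  linarith

theorem invertibleOn_of_contraction : InvertibleOn G Q a ψ where
  integrable := hint
  bounded := ⟨1 / 2, fun f hf => ⟨hT f hf, hle f hf⟩⟩
  injective := fun _ _ hf hg h => ae_eq_of_contraction hψ hint hle hf hg h
  surjective := ⟨2, fun _ hf => exists_preimage_of_contraction hψ hint hT hle hf⟩

end Contraction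

end WeightedSpace

/-! ### Volterra inversion -/

/-- `f` is bounded by a multiple of `φ` on every interval `]0,a]`. -/
def LocallyDominated (f φ : ℝ → ℝ) : Prop :=
  ∀ a, 0 < a → ∃ C, 0 ≤ C ∧ ∀ x ∈ Ioc 0 a, f x ≤ C * φ x

/-- The data under which the perturbation theory at the origin works: a fundamental pair, the
weight `φ`, a majorant `ω` of its product with the Green's kernel such that `ω Q` is integrable at
`0`, and the order `s` to which solutions are approximated. -/
structure Admissible (m k : ℂ) (Q : ℝ → ℂ) (φ ω : ℝ → ℝ) (s : ℝ) (h₁ h₂ : ℝ → ℂ) (w : ℂ) :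
    Prop where
  pair : IsFundamentalPair m k h₁ h₂ w
  weight : ∀ a, IsWeight a φ
  weight_lower : LocallyDominated (fun x => x ^ (1 / 2 + s)) φ
  meas : AEStronglyMeasurable Q (volume.restrict (Ioi 0))
  majorant_nonneg : ∀ x, 0 < x → 0 ≤ ω x
  majorant_int : ∀ a, 0 < a → IntegrableOn (fun y => ω y * ‖Q y‖) (Ioc 0 a)
  green : ∀ a, 0 < a → ∃ C, 0 ≤ C ∧ ∀ x y, 0 < y → y ≤ x → x ≤ a →
    ‖h₁ x * h₂ y - h₂ x * h₁ y‖ * φ y ≤ C * x ^ (1 / 2 + s) * ω y ∧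
      ‖deriv h₁ x * h₂ y - deriv h₂ x * h₁ y‖ * φ y ≤ C * x ^ (-1 / 2 + s) * ω y

theorem PairIntegrable.mono {h₁ h₂ Q f : ℝ → ℂ} {a b : ℝ} (h : PairIntegrable h₁ h₂ Q f a)
    (hb : 0 ≤ b) (hba : b ≤ a) : PairIntegrable h₁ h₂ Q f b :=
  have hsub : uIcc 0 b ⊆ uIcc 0 a := by
    rw [uIcc_of_le hb, uIcc_of_le (hb.trans hba)]
    exact Icc_subset_Icc_right hba
  ⟨h.left.mono_set hsub, h.right.mono_set hsub⟩

theorem PairIntegrable.greenInt_eq_integral {h₁ h₂ Q f : ℝ → ℂ} {x : ℝ}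
    (h : PairIntegrable h₁ h₂ Q f x) (w : ℂ) (p₁ p₂ : ℝ → ℂ) :
    greenInt h₁ h₂ w Q f p₁ p₂ x =
      ∫ y in (0 : ℝ)..x, (p₁ x * h₂ y - p₂ x * h₁ y) / w * Q y * f y := by
  rw [greenInt, ← intervalIntegral.integral_const_mul, ← intervalIntegral.integral_const_mul,
    ← intervalIntegral.integral_sub (h.right.const_mul _) (h.left.const_mul _),
    ← intervalIntegral.integral_div]
  congr 1
  ext y
  ring

theorem continuousOn_primitive_Icc {E : Type*} [NormedAddCommGroup E] [NormedSpace ℝ E]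
    {F : ℝ → E} {a : ℝ} (ha : 0 ≤ a) (hF : IntervalIntegrable F volume 0 a) :
    ContinuousOn (fun x => ∫ y in (0 : ℝ)..x, F y) (Icc 0 a) := by
  simpa only [uIcc_of_le ha] using
    intervalIntegral.continuousOn_primitive_interval' hF left_mem_uIcc

theorem norm_greenInt_le {h₁ h₂ Q f p₁ p₂ : ℝ → ℂ} {φ ω B : ℝ → ℝ} {x D : ℝ} (hx : 0 < x)
    (hf : PairIntegrable h₁ h₂ Q f x) (w : ℂ) (hB₀ : ∀ y ∈ Ioo 0 x, 0 ≤ B y)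
    (hB : IntegrableOn (fun y => ω y * ‖Q y‖ * B y) (Ioc 0 x))
    (hfB : ∀ᵐ y ∂(volume.restrict (Ioo 0 x)), ‖f y‖ ≤ B y * φ y)
    (hK : ∀ y ∈ Ioo 0 x, ‖p₁ x * h₂ y - p₂ x * h₁ y‖ * φ y ≤ D * ω y) :
    ‖greenInt h₁ h₂ w Q f p₁ p₂ x‖ ≤ D / ‖w‖ * ∫ y in (0 : ℝ)..x, ω y * ‖Q y‖ * B y := by
  rw [hf.greenInt_eq_integral, ← intervalIntegral.integral_const_mul]
  refine intervalIntegral.norm_integral_le_of_norm_le hx.le ?_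
    (((intervalIntegrable_iff_integrableOn_Ioc_of_le hx.le).2 hB).const_mul _)
  rw [← ae_restrict_iff' measurableSet_Ioc, ← restrict_Ioo_eq_restrict_Ioc]
  filter_upwards [hfB, ae_mem_Ioo x] with y hy hyx
  have hBy := hB₀ y hyx
  calc ‖(p₁ x * h₂ y - p₂ x * h₁ y) / w * Q y * f y‖
      = ‖p₁ x * h₂ y - p₂ x * h₁ y‖ / ‖w‖ * ‖Q y‖ * ‖f y‖ := by
        rw [norm_mul, norm_mul, norm_div]
    _ ≤ ‖p₁ x * h₂ y - p₂ x * h₁ y‖ / ‖w‖ * ‖Q y‖ * (B y * φ y) := by gcongr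
    _ = ‖p₁ x * h₂ y - p₂ x * h₁ y‖ * φ y * (‖Q y‖ * B y / ‖w‖) := by ring
    _ ≤ D * ω y * (‖Q y‖ * B y / ‖w‖) := mul_le_mul_of_nonneg_right (hK y hyx) (by positivity)
    _ = D / ‖w‖ * (ω y * ‖Q y‖ * B y) := by ring

theorem aestronglyMeasurable_greenInt {h₁ h₂ Q f p₁ p₂ : ℝ → ℂ} {a : ℝ} (ha : 0 ≤ a)
    (hf : PairIntegrable h₁ h₂ Q f a) (w : ℂ) (hp₁ : ContinuousOn p₁ (Ioi 0))
    (hp₂ : ContinuousOn p₂ (Ioi 0)) :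
    AEStronglyMeasurable (greenInt h₁ h₂ w Q f p₁ p₂) (volume.restrict (Ioo 0 a)) :=
  ((((hp₁.mono Ioo_subset_Ioi_self).mul ((continuousOn_primitive_Icc ha hf.right).mono
    Ioo_subset_Icc_self)).sub ((hp₂.mono Ioo_subset_Ioi_self).mul
      ((continuousOn_primitive_Icc ha hf.left).mono Ioo_subset_Icc_self))).div_const
        w).aestronglyMeasurable measurableSet_Ioo

/-- The weight `φ exp (2 ∫₀ˣ ρ)`, for which a Volterra operator with kernel bounded by
`φ(x) ρ(y) / φ(y)` is a contraction. -/
def expWeight (φ ρ : ℝ → ℝ) (x : ℝ) : ℝ := φ x * Real.exp (2 * ∫ t in (0 : ℝ)..x, ρ t)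

section ExpWeight

variable {a : ℝ} {φ ρ : ℝ → ℝ}

theorem isWeight_expWeight (hφ : IsWeight a φ) (hρ : IntervalIntegrable ρ volume 0 a) :
    IsWeight a (expWeight φ ρ) where
  pos := fun x hx => mul_pos (hφ.pos x hx) (Real.exp_pos _)
  continuousOn := by
    rcases le_total a 0 with ha | ha
    · simp only [Ioo_eq_empty (not_lt.2 ha), continuousOn_empty]
    · exact hφ.continuousOn.mul (continuousOn_const.mul
        ((continuousOn_primitive_Icc ha hρ).mono Ioo_subset_Icc_self)).rexp

theorem integral_le_integral_of_nonneg_of_le (hρ : IntervalIntegrable ρ volume 0 a)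
    (hρ₀ : ∀ x, 0 < x → 0 ≤ ρ x) {x y : ℝ} (hx : 0 ≤ x) (hxy : x ≤ y) (hya : y ≤ a) :
    ∫ t in (0 : ℝ)..x, ρ t ≤ ∫ t in (0 : ℝ)..y, ρ t := by
  refine intervalIntegral.integral_mono_interval le_rfl hx hxy ?_ (hρ.mono_set ?_)
  · filter_upwards [ae_restrict_mem measurableSet_Ioc] with t ht using hρ₀ t ht.1
  · rw [uIcc_of_le (hx.trans hxy), uIcc_of_le ((hx.trans hxy).trans hya)]
    exact Icc_subset_Icc_right hya

theorem le_expWeight (hφ : IsWeight a φ) (hρ : IntervalIntegrable ρ volume 0 a)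
    (hρ₀ : ∀ x, 0 < x → 0 ≤ ρ x) {x : ℝ} (hx : x ∈ Ioo 0 a) : φ x ≤ expWeight φ ρ x := by
  have hR := integral_le_integral_of_nonneg_of_le hρ hρ₀ le_rfl hx.1.le hx.2.le
  rw [intervalIntegral.integral_same] at hR
  exact le_mul_of_one_le_right (hφ.pos x hx).le (Real.one_le_exp (by positivity))

theorem expWeight_le (hφ : IsWeight a φ) (hρ : IntervalIntegrable ρ volume 0 a)
    (hρ₀ : ∀ x, 0 < x → 0 ≤ ρ x) {x : ℝ} (hx : x ∈ Ioo 0 a) :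
    expWeight φ ρ x ≤ Real.exp (2 * ∫ t in (0 : ℝ)..a, ρ t) * φ x := by
  have hφx := hφ.pos x hx
  have hR := integral_le_integral_of_nonneg_of_le hρ hρ₀ hx.1.le hx.2.le le_rfl
  rw [expWeight, mul_comm]
  gcongr

theorem integral_mul_exp_primitive_le {b : ℝ} (hρ : IntervalIntegrable ρ volume a b) :
    ∫ y in a..b, ρ y * Real.exp (2 * ∫ t in a..y, ρ t) ≤
      Real.exp (2 * ∫ t in a..b, ρ t) / 2 := by
  have h := integral_mul_exp_primitive 2 hρ
  simp only [mul_left_comm _ (2 : ℝ), intervalIntegral.integral_const_mul] at h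
  linarith

end ExpWeight

section Admissible

variable {m k w : ℂ} {Q h₁ h₂ : ℝ → ℂ} {φ ω : ℝ → ℝ} {s a : ℝ}

theorem intervalIntegrable_mul_of_norm_mul_weight_le {p f : ℝ → ℂ} {D : ℝ} (ha : 0 ≤ a)
    (hφ : IsWeight a φ) (hf : MemW a φ f) (hp : ContinuousOn p (Ioi 0))
    (hQ : AEStronglyMeasurable Q (volume.restrict (Ioi 0)))
    (hω : IntegrableOn (fun y => ω y * ‖Q y‖) (Ioc 0 a))
    (hpω : ∀ y ∈ Ioo 0 a, ‖p y‖ * φ y ≤ D * ω y) :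
    IntervalIntegrable (fun y => p y * Q y * f y) volume 0 a := by
  rw [intervalIntegrable_iff_integrableOn_Ioc_of_le ha, integrableOn_Ioc_iff_integrableOn_Ioo]
  refine Integrable.mono'
    ((hω.mono_set Ioo_subset_Ioc_self).const_mul ((wNorm a φ f).toReal * D)) ?_ ?_
  · exact (((hp.mono Ioo_subset_Ioi_self).aestronglyMeasurable measurableSet_Ioo).mul
      (hQ.mono_set Ioo_subset_Ioi_self)).mul (hf.aestronglyMeasurable hφ)
  · filter_upwards [hf.ae_norm_le hφ, ae_mem_Ioo a] with y hy hya
    set M := (wNorm a φ f).toReal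
    calc ‖p y * Q y * f y‖ = ‖p y‖ * ‖Q y‖ * ‖f y‖ := by rw [norm_mul, norm_mul]
      _ ≤ ‖p y‖ * ‖Q y‖ * (M * φ y) := by gcongr
      _ = ‖p y‖ * φ y * (M * ‖Q y‖) := by ring
      _ ≤ D * ω y * (M * ‖Q y‖) := mul_le_mul_of_nonneg_right (hpω y hya) (by positivity)
      _ = M * D * (ω y * ‖Q y‖) := by ring

variable (A : Admissible m k Q φ ω s h₁ h₂ w)
include A

-- The two kernels at `x = a` determine `h₁` and `h₂` through the Wronskian.
theorem Admissible.pairIntegrable {f : ℝ → ℂ} (ha : 0 < a) (hf : MemW a φ f) :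
    PairIntegrable h₁ h₂ Q f a := by
  obtain ⟨C, -, hC⟩ := A.green a ha
  have kernel {p q : ℂ} {D : ℝ} (h : ∀ y ∈ Ioo 0 a, ‖p * h₂ y - q * h₁ y‖ * φ y ≤ D * ω y) :
      IntervalIntegrable (fun y => (p * h₂ y - q * h₁ y) * Q y * f y) volume 0 a :=
    intervalIntegrable_mul_of_norm_mul_weight_le ha.le (A.weight a) hf
      ((continuousOn_const.mul A.pair.right.continuousOn).sub
        (continuousOn_const.mul A.pair.left.continuousOn)) A.meas (A.majorant_int a ha) h
  have hK := kernel fun y hy => (hC a y hy.1 hy.2.le le_rfl).1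
  have hK' := kernel fun y hy => (hC a y hy.1 hy.2.le le_rfl).2
  have hw := A.pair.wronskian_ne_zero
  have hW := A.pair.wronskian ha
  constructor
  · refine ((hK.const_mul (deriv h₁ a / w)).sub (hK'.const_mul (h₁ a / w))).congr
      (fun y _ => ?_)
    field_simp
    linear_combination h₁ y * Q y * f y * hW
  · refine ((hK.const_mul (deriv h₂ a / w)).sub (hK'.const_mul (h₂ a / w))).congr
      (fun y _ => ?_)
    field_simp
    linear_combination h₂ y * Q y * f y * hW

theorem Admissible.pairIntegrable_of_mem {f : ℝ → ℂ} {x : ℝ} (hf : MemW a φ f)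
    (hx : x ∈ Ioo 0 a) : PairIntegrable h₁ h₂ Q f x :=
  (A.pairIntegrable (hx.1.trans hx.2) hf).mono hx.1.le hx.2.le

theorem Admissible.applyGQ_eq_greenInt {f : ℝ → ℂ} {x : ℝ} (hf : MemW a φ f)
    (hx : x ∈ Ioo 0 a) :
    applyGQ (forwardGreen h₁ h₂ w) Q f x = greenInt h₁ h₂ w Q f h₁ h₂ x :=
  (A.pairIntegrable_of_mem hf hx).applyGQ_eq hx.1.le w

theorem Admissible.aestronglyMeasurable_applyGQ {f : ℝ → ℂ} (ha : 0 < a) (hf : MemW a φ f) :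
    AEStronglyMeasurable (applyGQ (forwardGreen h₁ h₂ w) Q f) (volume.restrict (Ioo 0 a)) := by
  refine (aestronglyMeasurable_greenInt ha.le (A.pairIntegrable ha hf) w
    A.pair.left.continuousOn A.pair.right.continuousOn).congr ?_
  filter_upwards [ae_mem_Ioo a] with x hx using (A.applyGQ_eq_greenInt hf hx).symm

theorem Admissible.exists_kernel_le (ha : 0 < a) :
    ∃ K, 0 ≤ K ∧ ∀ x y, 0 < y → y ≤ x → x ≤ a →
      ‖h₁ x * h₂ y - h₂ x * h₁ y‖ * φ y ≤ K * φ x * ω y := by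
  obtain ⟨C, hC₀, hC⟩ := A.green a ha
  obtain ⟨C', hC'₀, hC'⟩ := A.weight_lower a ha
  refine ⟨C * C', mul_nonneg hC₀ hC'₀, fun x y hy hyx hxa => (hC x y hy hyx hxa).1.trans ?_⟩
  refine mul_le_mul_of_nonneg_right ?_ (A.majorant_nonneg y hy)
  rw [mul_assoc]
  exact mul_le_mul_of_nonneg_left (hC' x ⟨hy.trans_le hyx, hxa⟩) hC₀

theorem Admissible.norm_applyGQ_le {f : ℝ → ℂ} {K M x : ℝ}
    (hK : ∀ x y, 0 < y → y ≤ x → x ≤ a →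
      ‖h₁ x * h₂ y - h₂ x * h₁ y‖ * φ y ≤ K * φ x * ω y)
    (hM : 0 ≤ M) (hf : MemW a φ f) (hx : x ∈ Ioo 0 a)
    (hfM : ∀ᵐ y ∂(volume.restrict (Ioo 0 a)),
      ‖f y‖ ≤ M * expWeight φ (fun t => K / ‖w‖ * (ω t * ‖Q t‖)) y) :
    ‖applyGQ (forwardGreen h₁ h₂ w) Q f x‖ ≤
      M / 2 * expWeight φ (fun t => K / ‖w‖ * (ω t * ‖Q t‖)) x := by
  set ρ := fun t => K / ‖w‖ * (ω t * ‖Q t‖) with hρ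
  set E := fun y => Real.exp (2 * ∫ t in (0 : ℝ)..y, ρ t)
  have hωQ : IntervalIntegrable (fun y => ω y * ‖Q y‖) volume 0 x :=
    (intervalIntegrable_iff_integrableOn_Ioc_of_le hx.1.le).2 (A.majorant_int x hx.1)
  have hρx : IntervalIntegrable ρ volume 0 x := hωQ.const_mul _
  have hEcont : ContinuousOn E (uIcc 0 x) := by
    rw [uIcc_of_le hx.1.le]
    exact (continuousOn_const.mul (continuousOn_primitive_Icc hx.1.le hρx)).rexp
  have hφx := (A.weight a).pos x hx
  rw [A.applyGQ_eq_greenInt hf hx]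
  calc ‖greenInt h₁ h₂ w Q f h₁ h₂ x‖
      ≤ K * φ x / ‖w‖ * ∫ y in (0 : ℝ)..x, ω y * ‖Q y‖ * (M * E y) := by
        refine norm_greenInt_le hx.1 (A.pairIntegrable_of_mem hf hx) w
          (fun y _ => by positivity) ?_ ?_ fun y hy => hK x y hy.1 hy.2.le hx.2.le
        · exact (intervalIntegrable_iff_integrableOn_Ioc_of_le hx.1.le).1
            (hωQ.mul_continuousOn (continuousOn_const.mul hEcont))
        · filter_upwards [ae_restrict_of_ae_restrict_of_subset
            (Ioo_subset_Ioo_right hx.2.le) hfM] with y hy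
          rwa [mul_right_comm, mul_assoc]
    _ = M * φ x * ∫ y in (0 : ℝ)..x, ρ y * E y := by
        rw [← intervalIntegral.integral_const_mul, ← intervalIntegral.integral_const_mul]
        refine intervalIntegral.integral_congr fun y _ => ?_
        simp only [hρ]
        ring
    _ ≤ M * φ x * (E x / 2) := by gcongr; exact integral_mul_exp_primitive_le hρx
    _ = M / 2 * expWeight φ ρ x := by rw [expWeight]; ring

theorem Admissible.invertibleOn (ha : 0 < a) : InvertibleOn (forwardGreen h₁ h₂ w) Q a φ := by
  obtain ⟨K, hK₀, hK⟩ := A.exists_kernel_le ha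
  set ρ := fun t => K / ‖w‖ * (ω t * ‖Q t‖)
  have hφ := A.weight a
  have hρ : IntervalIntegrable ρ volume 0 a :=
    ((intervalIntegrable_iff_integrableOn_Ioc_of_le ha.le).2 (A.majorant_int a ha)).const_mul _
  have hρ₀ : ∀ x, 0 < x → 0 ≤ ρ x := fun x hx =>
    mul_nonneg (by positivity) (mul_nonneg (A.majorant_nonneg x hx) (norm_nonneg _))
  have hψ := isWeight_expWeight hφ hρ
  have hle := fun x hx => expWeight_le hφ hρ hρ₀ (x := x) hx
  have toφ {f : ℝ → ℂ} (hf : MemW a (expWeight φ ρ) f) : MemW a φ f :=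
    hf.of_weight_le hφ hψ hle
  have hhalf {f : ℝ → ℂ} (hf : MemW a (expWeight φ ρ) f) :
      wNorm a (expWeight φ ρ) (applyGQ (forwardGreen h₁ h₂ w) Q f) ≤
        (1 / 2 : NNReal) * wNorm a (expWeight φ ρ) f := by
    refine (hψ.wNorm_le (M := (wNorm a (expWeight φ ρ) f).toReal / 2) ?_).trans_eq ?_
    · filter_upwards [ae_mem_Ioo a] with x hx using
        A.norm_applyGQ_le hK ENNReal.toReal_nonneg (toφ hf) hx (hf.ae_norm_le hψ)
    · rw [div_eq_inv_mul, ENNReal.ofReal_mul (by norm_num), ENNReal.ofReal_toReal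
        (show wNorm a (expWeight φ ρ) f ≠ ⊤ from hf.2.ne), ENNReal.ofReal_inv_of_pos two_pos]
      simp
  refine (invertibleOn_of_contraction hψ (fun f hf x hx => ?_) (fun f hf => ?_)
    fun f hf => hhalf hf).of_weight_le hφ hψ (fun x hx => le_expWeight hφ hρ hρ₀ hx) hle
  · exact (A.pairIntegrable_of_mem (toφ hf) hx).integrableOn_forwardGreen w
  · exact hψ.memW (A.aestronglyMeasurable_applyGQ ha (toφ hf))
      ((hhalf hf).trans_lt (ENNReal.mul_lt_top ENNReal.coe_lt_top hf.2))

end Admissible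

/-! ### Solutions with prescribed behaviour at the origin -/

section Pointwise

variable {h₁ h₂ Q f g g0 : ℝ → ℂ} {w : ℂ} {a : ℝ} {φ : ℝ → ℝ}

-- The integral operator depends only on the almost everywhere class of its argument, so it turns
-- a solution up to null sets into a solution at every point.
theorem InvertibleOn.exists_pointwise (h : InvertibleOn (forwardGreen h₁ h₂ w) Q a φ)
    (hg0 : MemW a φ g0) :
    ∃ v, MemW a φ v ∧ ∀ x ∈ Ioo 0 a, v x + applyGQ (forwardGreen h₁ h₂ w) Q v x = g0 x := by
  obtain ⟨C, hC⟩ := h.surjective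
  obtain ⟨g, hg, hge, -⟩ := hC g0 hg0
  have hgv : g =ᵐ[volume.restrict (Ioo 0 a)]
      fun x => g0 x - applyGQ (forwardGreen h₁ h₂ w) Q g x := by
    filter_upwards [hge] with x hx using eq_sub_of_add_eq hx
  refine ⟨_, hg.congr_ae hgv, fun x hx => ?_⟩
  rw [← applyGQ_forwardGreen_congr_ae h₁ h₂ w Q
    (ae_restrict_of_ae_restrict_of_subset (Ioo_subset_Ioo_right hx.2.le) hgv), sub_add_cancel]

theorem InvertibleOn.eqOn (h : InvertibleOn (forwardGreen h₁ h₂ w) Q a φ) (hf : MemW a φ f)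
    (hg : MemW a φ g)
    (hfg : ∀ x ∈ Ioo 0 a, f x + applyGQ (forwardGreen h₁ h₂ w) Q f x =
      g x + applyGQ (forwardGreen h₁ h₂ w) Q g x) : EqOn f g (Ioo 0 a) := by
  intro x hx
  have hae : f =ᵐ[volume.restrict (Ioo 0 a)] g :=
    h.injective f g hf hg (by filter_upwards [ae_mem_Ioo a] using hfg)
  have hxfg := hfg x hx
  rwa [applyGQ_forwardGreen_congr_ae h₁ h₂ w Q
    (ae_restrict_of_ae_restrict_of_subset (Ioo_subset_Ioo_right hx.2.le) hae),
    add_left_inj] at hxfg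

theorem exists_global_of_invertibleOn
    (h : ∀ a, 0 < a → InvertibleOn (forwardGreen h₁ h₂ w) Q a φ)
    (hg0 : ∀ a, 0 < a → MemW a φ g0) :
    ∃ u, (∀ a, 0 < a → MemW a φ u) ∧
      ∀ x, 0 < x → u x + applyGQ (forwardGreen h₁ h₂ w) Q u x = g0 x := by
  choose! v hv hve using fun a ha => (h a ha).exists_pointwise (hg0 a ha)
  have hagree {a b : ℝ} (ha : 0 < a) (hab : a ≤ b) : EqOn (v a) (v b) (Ioo 0 a) := by
    have hb := ha.trans_le hab
    refine (h a ha).eqOn (hv a ha) ((hv b hb).mono hab) fun x hx => ?_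
    rw [hve a ha x hx, hve b hb x ⟨hx.1, hx.2.trans_le hab⟩]
  have hglue {a : ℝ} (ha : 0 < a) : EqOn (v a) (fun x => v (x + 1) x) (Ioo 0 a) := by
    intro x hx
    have hx1 : 0 < x + 1 := by linarith [hx.1]
    rcases le_total a (x + 1) with hax | hax
    · exact hagree ha hax hx
    · exact (hagree hx1 hax ⟨hx.1, lt_add_one x⟩).symm
  have hglue_ae {a b : ℝ} (hb : 0 < b) (hab : a ≤ b) :
      v b =ᵐ[volume.restrict (Ioo 0 a)] fun x => v (x + 1) x := by
    filter_upwards [ae_mem_Ioo a] with x hx using hglue hb ⟨hx.1, hx.2.trans_le hab⟩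
  refine ⟨fun x => v (x + 1) x, fun a ha => (hv a ha).congr_ae (hglue_ae ha le_rfl),
    fun x hx => ?_⟩
  have hx1 : 0 < x + 1 := by linarith
  rw [← applyGQ_forwardGreen_congr_ae h₁ h₂ w Q (hglue_ae hx1 (le_add_of_nonneg_right zero_le_one))]
  exact hve (x + 1) hx1 x ⟨hx, lt_add_one x⟩

end Pointwise

section Asymptotics

theorem isLittleO_of_norm_le_mul {f : ℝ → ℂ} {p C : ℝ} {η : ℝ → ℝ}
    (hη : Tendsto η (𝓝[>] 0) (𝓝 0))
    (h : ∀ᶠ x in 𝓝[>] (0 : ℝ), ‖f x‖ ≤ C * x ^ p * η x) :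
    f =o[𝓝[>] (0 : ℝ)] fun x => x ^ p := by
  have hO : f =O[𝓝[>] (0 : ℝ)] fun x => x ^ p * η x := by
    refine IsBigO.of_bound |C| ?_
    filter_upwards [h] with x hx
    calc ‖f x‖ ≤ |C * x ^ p * η x| := hx.trans (le_abs_self _)
      _ = |C| * ‖x ^ p * η x‖ := by rw [mul_assoc, abs_mul, Real.norm_eq_abs]
  simpa only [mul_one] using
    hO.trans_isLittleO ((isBigO_refl _ _).mul_isLittleO ((isLittleO_one_iff ℝ).2 hη))

theorem rpow_isBigO_rpow {p q : ℝ} (h : p ≤ q) :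
    (fun x : ℝ => x ^ q) =O[𝓝[>] (0 : ℝ)] fun x => x ^ p := by
  refine IsBigO.of_bound 1 ?_
  filter_upwards [Ioo_mem_nhdsGT (zero_lt_one (α := ℝ))] with x hx
  rw [one_mul, Real.norm_of_nonneg (Real.rpow_nonneg hx.1.le _),
    Real.norm_of_nonneg (Real.rpow_nonneg hx.1.le _)]
  exact Real.rpow_le_rpow_of_exponent_ge hx.1 hx.2.le h

theorem tendsto_primitive_nhdsGT_zero {F : ℝ → ℝ} {a : ℝ} (ha : 0 < a)
    (hF : IntegrableOn F (Ioc 0 a)) :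
    Tendsto (fun x => ∫ y in (0 : ℝ)..x, F y) (𝓝[>] 0) (𝓝 0) := by
  have h := continuousOn_primitive_Icc ha.le
    ((intervalIntegrable_iff_integrableOn_Ioc_of_le ha.le).2 hF) 0 (left_mem_Icc.2 ha.le)
  rw [ContinuousWithinAt, intervalIntegral.integral_same] at h
  rw [← nhdsWithin_Ioo_eq_nhdsGT ha]
  exact h.mono_left (nhdsWithin_mono _ Ioo_subset_Icc_self)

theorem ApproximatesAtZero.mono {m k : ℂ} {Q g0 f : ℝ → ℂ} {r s : ℝ} (hrs : r ≤ s)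
    (hf : ApproximatesAtZero m k Q g0 s f) : ApproximatesAtZero m k Q g0 r f :=
  ⟨hf.1, hf.2.1.trans_isBigO (rpow_isBigO_rpow (by linarith)),
    hf.2.2.trans_isBigO (rpow_isBigO_rpow (by linarith))⟩

theorem memW_of_continuousOn_of_locallyDominated {φ : ℝ → ℝ} {f : ℝ → ℂ} {a : ℝ} (ha : 0 < a)
    (hφ : IsWeight a φ) (hf : ContinuousOn f (Ioi 0))
    (hfφ : LocallyDominated (fun x => ‖f x‖) φ) : MemW a φ f := by
  obtain ⟨C, -, hC⟩ := hfφ a ha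
  refine hφ.memW ((hf.mono Ioo_subset_Ioi_self).aestronglyMeasurable measurableSet_Ioo)
    ((hφ.wNorm_le (M := C) ?_).trans_lt ENNReal.ofReal_lt_top)
  filter_upwards [ae_mem_Ioo a] with x hx using hC x ⟨hx.1, hx.2.le⟩

theorem locallyDominated_of_continuousOn_of_isBigO {φ : ℝ → ℝ} {f : ℝ → ℂ} {p : ℝ}
    (hφ : ∀ a, IsWeight a φ) (hf : ContinuousOn f (Ioi 0))
    (hp : LocallyDominated (fun x => x ^ p) φ)
    (ho : f =O[𝓝[>] (0 : ℝ)] fun x => x ^ p) : LocallyDominated (fun x => ‖f x‖) φ := by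
  intro a ha
  have hφ₀ (x : ℝ) (hx : 0 < x) : 0 < φ x := (hφ (x + 1)).pos x ⟨hx, lt_add_one x⟩
  obtain ⟨C, hC, hCφ⟩ := hp a ha
  obtain ⟨B, hB, hBf⟩ := ho.exists_nonneg
  obtain ⟨δ, hδ, hδf⟩ := mem_nhdsGT_iff_exists_Ioo_subset.1 hBf.bound
  have hsub : Icc δ a ⊆ Ioo 0 (a + 1) := fun x hx =>
    ⟨lt_of_lt_of_le hδ hx.1, hx.2.trans_lt (lt_add_one a)⟩
  obtain ⟨N, hN⟩ := isCompact_Icc.exists_bound_of_continuousOn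
    ((hf.norm.mono (hsub.trans Ioo_subset_Ioi_self)).div ((hφ (a + 1)).continuousOn.mono hsub)
      fun x hx => (hφ₀ x (hsub hx).1).ne')
  refine ⟨max (B * C) N, le_max_of_le_left (by positivity), fun x hx => ?_⟩
  have hφx := hφ₀ x hx.1
  rcases lt_or_ge x δ with hxδ | hxδ
  · have hfx := hδf ⟨hx.1, hxδ⟩
    rw [mem_ofPred_eq, Real.norm_of_nonneg (Real.rpow_nonneg hx.1.le _)] at hfx
    calc ‖f x‖ ≤ B * (C * φ x) := hfx.trans (by gcongr; exact hCφ x hx)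
      _ = B * C * φ x := by ring
      _ ≤ max (B * C) N * φ x := by gcongr; exact le_max_left _ _
  · rw [← div_le_iff₀ hφx]
    exact (le_abs_self _).trans ((hN x ⟨hxδ, hx.2⟩).trans (le_max_right _ _))

end Asymptotics

section Approximation

variable {m k w : ℂ} {Q h₁ h₂ f : ℝ → ℂ} {φ ω : ℝ → ℝ} {r s : ℝ}

theorem Admissible.isLittleO_greenInt_of_kernel_le (A : Admissible m k Q φ ω s h₁ h₂ w)
    (hf : MemW 1 φ f) {p₁ p₂ : ℝ → ℂ} {C q : ℝ}
    (hK : ∀ x y, 0 < y → y ≤ x → x ≤ 1 →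
      ‖p₁ x * h₂ y - p₂ x * h₁ y‖ * φ y ≤ C * x ^ q * ω y) :
    greenInt h₁ h₂ w Q f p₁ p₂ =o[𝓝[>] (0 : ℝ)] fun x => x ^ q := by
  set M := (wNorm 1 φ f).toReal
  have hI : IntegrableOn (fun y => ω y * ‖Q y‖ * M) (Ioc 0 1) :=
    (A.majorant_int 1 one_pos).mul_const M
  refine isLittleO_of_norm_le_mul (C := C / ‖w‖) (tendsto_primitive_nhdsGT_zero one_pos hI) ?_
  filter_upwards [Ioo_mem_nhdsGT (zero_lt_one (α := ℝ))] with x hx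
  rw [div_mul_eq_mul_div]
  refine norm_greenInt_le hx.1 (A.pairIntegrable_of_mem hf hx) w
    (fun _ _ => ENNReal.toReal_nonneg) (hI.mono_set (Ioc_subset_Ioc_right hx.2.le))
    (ae_restrict_of_ae_restrict_of_subset (Ioo_subset_Ioo_right hx.2.le)
      (hf.ae_norm_le (A.weight 1))) fun y hy => hK x y hy.1 hy.2.le hx.2.le

theorem Admissible.isLittleO_greenInt (A : Admissible m k Q φ ω s h₁ h₂ w) (hf : MemW 1 φ f) :
    (greenInt h₁ h₂ w Q f h₁ h₂ =o[𝓝[>] (0 : ℝ)] fun x => x ^ (1 / 2 + s)) ∧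
      greenInt h₁ h₂ w Q f (deriv h₁) (deriv h₂) =o[𝓝[>] (0 : ℝ)] fun x => x ^ (-1 / 2 + s) := by
  obtain ⟨C, -, hC⟩ := A.green 1 one_pos
  exact ⟨A.isLittleO_greenInt_of_kernel_le hf fun x y hy hyx hx => (hC x y hy hyx hx).1,
    A.isLittleO_greenInt_of_kernel_le hf fun x y hy hyx hx => (hC x y hy hyx hx).2⟩

theorem Admissible.approximatesAtZero (A : Admissible m k Q φ ω s h₁ h₂ w) {g0 g0' u : ℝ → ℂ}
    (hg0 : IsFreeSolution m k g0 g0') (hu : ∀ a, 0 < a → MemW a φ u)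
    (hug : ∀ x, 0 < x → u x + greenInt h₁ h₂ w Q u h₁ h₂ x = g0 x) :
    ApproximatesAtZero m k Q g0 s u := by
  have hi := fun a ha => A.pairIntegrable ha (hu a ha)
  obtain ⟨ho, ho'⟩ := A.isLittleO_greenInt (hu 1 one_pos)
  refine ⟨isEigensolution_of_volterra A.pair hg0 hi hug, ho.neg_left.congr' ?_ .rfl,
    ho'.neg_left.congr' ?_ .rfl⟩
  · filter_upwards [self_mem_nhdsWithin] with x hx
    linear_combination -hug x hx
  · filter_upwards [self_mem_nhdsWithin] with x hx
    rw [(hasDerivAt_of_volterra A.pair hg0 hi hug hx).deriv, hg0.eqOn_deriv hx]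
    ring

variable (hrs : r ≤ s) (hφr : LocallyDominated (fun x => x ^ (1 / 2 + r)) φ)
  (hzero : ∀ e e' : ℝ → ℂ, IsFreeSolution m k e e' →
    (e =o[𝓝[>] (0 : ℝ)] fun x => x ^ (1 / 2 + r)) →
    (e' =o[𝓝[>] (0 : ℝ)] fun x => x ^ (-1 / 2 + r)) → EqOn e 0 (Ioi 0))
include hrs hφr hzero

theorem Admissible.eqOn_zero_of_isLittleO (A : Admissible m k Q φ ω s h₁ h₂ w) {d : ℝ → ℂ}
    (hd : IsEigensolution m k Q d) (ho : d =o[𝓝[>] (0 : ℝ)] fun x => x ^ (1 / 2 + r))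
    (ho' : deriv d =o[𝓝[>] (0 : ℝ)] fun x => x ^ (-1 / 2 + r)) : EqOn d 0 (Ioi 0) := by
  have hdφ (a : ℝ) (ha : 0 < a) : MemW a φ d :=
    memW_of_continuousOn_of_locallyDominated ha (A.weight a) hd.1.continuousOn
      (locallyDominated_of_continuousOn_of_isBigO A.weight hd.1.continuousOn hφr ho.isBigO)
  obtain ⟨hT, hT'⟩ := A.isLittleO_greenInt (hdφ 1 one_pos)
  have hvolterra := hzero _ _
    (hd.isFreeSolution_add_greenInt A.pair fun a ha => A.pairIntegrable ha (hdφ a ha))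
    (ho.add (hT.trans_isBigO (rpow_isBigO_rpow (by linarith))))
    (ho'.add (hT'.trans_isBigO (rpow_isBigO_rpow (by linarith))))
  intro x hx
  have hx1 : 0 < x + 1 := add_pos hx one_pos
  refine (A.invertibleOn hx1).eqOn (hdφ _ hx1) (g := 0) ?_ (fun y hy => ?_) ⟨hx, lt_add_one x⟩
  · simpa only [sub_self] using! (hdφ _ hx1).sub (hdφ _ hx1)
  · rw [A.applyGQ_eq_greenInt (hdφ _ hx1) hy]
    simpa [applyGQ] using hvolterra hy.1

theorem exists_unique_approximation (hpair : ∃ h₁ h₂ w, IsFundamentalPair m k h₁ h₂ w)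
    (hA : ∀ h₁ h₂ w, IsFundamentalPair m k h₁ h₂ w → Admissible m k Q φ ω s h₁ h₂ w)
    {g0 g0' : ℝ → ℂ} (hg0 : IsFreeSolution m k g0 g0')
    (hg0φ : LocallyDominated (fun x => ‖g0 x‖) φ) :
    ∃ u : ℝ → ℂ, IsInverseImage m k Q φ g0 u ∧ IsUniqueApproximation m k Q g0 s u ∧
      IsUniqueApproximation m k Q g0 r u := by
  obtain ⟨h₁, h₂, w, hp⟩ := id hpair
  have A := hA h₁ h₂ w hp
  have hg0W (a : ℝ) (ha : 0 < a) : MemW a φ g0 :=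
    memW_of_continuousOn_of_locallyDominated ha (A.weight a) hg0.continuousOn hg0φ
  obtain ⟨u, hu, hue⟩ := exists_global_of_invertibleOn (fun a ha => A.invertibleOn ha) hg0W
  have hus : ApproximatesAtZero m k Q g0 s u := A.approximatesAtZero hg0 hu fun x hx => by
    rw [← (A.pairIntegrable hx (hu x hx)).applyGQ_eq hx.le, hue x hx]
  have hunique (f : ℝ → ℂ) (hf : ApproximatesAtZero m k Q g0 r f) : EqOn f u (Ioi 0) := by
    have hur := hus.mono hrs
    have hd := A.eqOn_zero_of_isLittleO hrs hφr hzero (hf.1.sub hus.1)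
      ((hf.2.1.sub hur.2.1).congr_left fun x => by ring)
      ((hf.2.2.sub hur.2.2).congr' (by
        filter_upwards [self_mem_nhdsWithin] with x hx
        rw [deriv_fun_sub (hf.1.1.1 x hx) (hus.1.1.1 x hx)]
        ring) .rfl)
    exact fun x hx => sub_eq_zero.1 (hd hx)
  refine ⟨u, ⟨hpair, fun p₁ p₂ w' hp' a ha => ⟨(hA p₁ p₂ w' hp').invertibleOn ha, hg0W a ha,
    hu a ha, fun x hx => ?_⟩⟩, ⟨hus, fun f hf => hunique f (hf.mono hrs)⟩, hus.mono hrs, hunique⟩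
  rw [hp.applyGQ_forwardGreen_eq hp' Q u hx.1, hue x hx.1]

end Approximation

/-! ### Entire power series -/

/-- The sequence `c` is the sequence of Taylor coefficients of an entire function, encoded as
absolute convergence at every radius. -/
def IsEntireCoeff (c : ℕ → ℂ) : Prop :=
  ∀ R : ℝ, 0 ≤ R → Summable fun n => ‖c n‖ * R ^ n

/-- The power series with coefficients `c`. -/
def powerSum (c : ℕ → ℂ) (z : ℂ) : ℂ := ∑' n : ℕ, c n * z ^ n

/-- The coefficients of the derivative of the power series with coefficients `c`. -/
def derivCoeff (c : ℕ → ℂ) (n : ℕ) : ℂ := (n + 1) * c (n + 1)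

section PowerSum

variable {c d : ℕ → ℂ}

theorem isEntireCoeff_of_norm_le_pow_div_factorial {M B : ℝ}
    (h : ∀ n, ‖c n‖ ≤ M * (B ^ n / n.factorial)) : IsEntireCoeff c := fun R _ =>
  Summable.of_nonneg_of_le (fun n => by positivity)
    (fun n => (mul_le_mul_of_nonneg_right (h n) (by positivity)).trans_eq
      (by rw [mul_pow]; ring)) ((Real.summable_pow_div_factorial (B * R)).mul_left M)

theorem IsEntireCoeff.coeff_deriv (h : IsEntireCoeff c) : IsEntireCoeff (derivCoeff c) := by
  intro R hR
  refine Summable.of_nonneg_of_le (fun n => by positivity) (fun n => ?_)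
    ((summable_nat_add_iff 1).2 (h (2 * (R + 1)) (by positivity)))
  have hn : ((n : ℝ) + 1) ≤ 2 ^ (n + 1) := by exact_mod_cast (n + 1).lt_two_pow_self.le
  have hpow : R ^ n ≤ (R + 1) ^ (n + 1) :=
    (pow_le_pow_left₀ hR (by linarith) n).trans (pow_le_pow_right₀ (by linarith) n.le_succ)
  calc ‖derivCoeff c n‖ * R ^ n = ‖c (n + 1)‖ * (((n : ℝ) + 1) * R ^ n) := by
        rw [derivCoeff, norm_mul, ← Nat.cast_add_one, Complex.norm_natCast]
        push_cast
        ring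
    _ ≤ ‖c (n + 1)‖ * (2 * (R + 1)) ^ (n + 1) := by
        rw [mul_pow]
        gcongr

theorem IsEntireCoeff.hasSum (h : IsEntireCoeff c) (z : ℂ) :
    HasSum (fun n => c n * z ^ n) (powerSum c z) :=
  (Summable.of_norm ((h ‖z‖ (norm_nonneg z)).congr fun n => by
    rw [norm_mul, norm_pow])).hasSum

theorem IsEntireCoeff.hasDerivAt (h : IsEntireCoeff c) (z : ℂ) :
    HasDerivAt (powerSum c) (powerSum (derivCoeff c) z) z := by
  set U := Metric.ball (0 : ℂ) (‖z‖ + 1)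
  have hz : z ∈ U := by simp [U]
  have hsum := h (‖z‖ + 1) (by positivity)
  have hdiff (n : ℕ) : DifferentiableOn ℂ (fun w => c n * w ^ n) U := by fun_prop
  have hle (n : ℕ) (w : ℂ) (hw : w ∈ U) : ‖c n * w ^ n‖ ≤ ‖c n‖ * (‖z‖ + 1) ^ n := by
    rw [norm_mul, norm_pow]
    gcongr
    exact (mem_ball_zero_iff.1 hw).le
  have hdiffSum : DifferentiableOn ℂ (powerSum c) U :=
    Complex.differentiableOn_tsum_of_summable_norm hsum hdiff Metric.isOpen_ball hle
  refine ((hdiffSum z hz).differentiableAt (Metric.isOpen_ball.mem_nhds hz)).hasDerivAt.congr_deriv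
    ?_
  have hderiv := Complex.hasSum_deriv_of_summable_norm hsum hdiff Metric.isOpen_ball hle hz
  have hshift := (hasSum_nat_add_iff' 1).2 hderiv
  simp only [Finset.range_one, Finset.sum_singleton, pow_zero, mul_one, deriv_const,
    sub_zero] at hshift
  refine hshift.unique ((h.coeff_deriv.hasSum z).congr_fun fun n => ?_)
  simp only [derivCoeff, deriv_const_mul_field', deriv_pow_field, Nat.add_sub_cancel]
  push_cast
  ring

theorem IsEntireCoeff.continuous (h : IsEntireCoeff c) : Continuous (powerSum c) :=
  continuous_iff_continuousAt.2 fun z => (h.hasDerivAt z).continuousAt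

theorem IsEntireCoeff.hasSum_mul_deriv (h : IsEntireCoeff c) (z : ℂ) :
    HasSum (fun n : ℕ => n * c n * z ^ n) (z * powerSum (derivCoeff c) z) := by
  have hshift : HasSum (fun n : ℕ => ((n + 1 : ℕ) : ℂ) * c (n + 1) * z ^ (n + 1))
      (z * powerSum (derivCoeff c) z) :=
    ((h.coeff_deriv.hasSum z).mul_left z).congr_fun fun n => by
      rw [derivCoeff, pow_succ]
      push_cast
      ring
  simpa using (hasSum_nat_add_iff (f := fun n : ℕ => n * c n * z ^ n) 1).1 hshift

theorem IsEntireCoeff.mul_deriv_deriv_add_mul_deriv (h : IsEntireCoeff c) (α : ℂ)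
    (hd : ∀ n : ℕ, (n + α) * derivCoeff c n = d n) (z : ℂ) :
    z * powerSum (derivCoeff (derivCoeff c)) z +
      α * powerSum (derivCoeff c) z = powerSum d z := by
  have hsum := (h.coeff_deriv.hasSum_mul_deriv z).add ((h.coeff_deriv.hasSum z).mul_left α)
  refine hsum.tsum_eq.symm.trans (tsum_congr fun n => ?_)
  rw [← hd n]
  ring

theorem powerSum_apply_zero (c : ℕ → ℂ) : powerSum c 0 = c 0 := by
  rw [powerSum, tsum_eq_single 0 fun n hn => by simp [hn], pow_zero, mul_one]

theorem powerSum_const_mul (a : ℂ) (c : ℕ → ℂ) (z : ℂ) :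
    powerSum (fun n => a * c n) z = a * powerSum c z := by
  simp only [powerSum, mul_assoc, tsum_mul_left]

end PowerSum

/-! ### The unperturbed solution `u_m^0` -/

theorem hasDerivAt_powerSum_sq {c : ℕ → ℂ} (hc : IsEntireCoeff c) (x : ℝ) :
    HasDerivAt (fun x : ℝ => powerSum c ((x : ℂ) ^ 2))
      (2 * x * powerSum (derivCoeff c) ((x : ℂ) ^ 2)) x :=
  (((hc.hasDerivAt _).comp (x : ℂ) (hasDerivAt_pow 2 (x : ℂ))).comp_ofReal).congr_deriv (by
    push_cast
    ring)

theorem hasDerivAt_two_mul_mul_powerSum_sq {c : ℕ → ℂ} (hc : IsEntireCoeff c) (x : ℝ) :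
    HasDerivAt (fun x : ℝ => 2 * (x : ℂ) * powerSum c ((x : ℂ) ^ 2))
      (2 * powerSum c ((x : ℂ) ^ 2) +
        4 * (x : ℂ) ^ 2 * powerSum (derivCoeff c) ((x : ℂ) ^ 2)) x :=
  ((((hasDerivAt_id (x : ℂ)).comp_ofReal).const_mul 2).fun_mul
    (hasDerivAt_powerSum_sq hc x)).congr_deriv (by simp only [id]; ring)

theorem exists_forall_norm_powerSum_sq_le {c : ℕ → ℂ} (hc : IsEntireCoeff c) (a : ℝ) :
    ∃ C : ℝ, 0 ≤ C ∧ ∀ x ∈ Ioc 0 a, ‖powerSum c ((x : ℂ) ^ 2)‖ ≤ C := by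
  have hcont : Continuous fun x : ℝ => powerSum c ((x : ℂ) ^ 2) :=
    hc.continuous.comp (by fun_prop)
  obtain ⟨C, hC⟩ := (isCompact_Icc (a := (0 : ℝ)) (b := a)).exists_bound_of_continuousOn
    hcont.continuousOn
  exact ⟨|C|, abs_nonneg C, fun x hx => (hC x (Ioc_subset_Icc_self hx)).trans (le_abs_self C)⟩

section Reduction

variable {m k : ℂ} {F F₁ F₂ : ℝ → ℂ}

theorem hasDerivAt_ofReal_cpow_div (s : ℂ) {x : ℝ} (hx : 0 < x) :
    HasDerivAt (fun x : ℝ => (x : ℂ) ^ s) (s / x * (x : ℂ) ^ s) x := by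
  have hx' : (x : ℂ) ≠ 0 := Complex.ofReal_ne_zero.2 hx.ne'
  refine (((hasDerivAt_id (x : ℂ)).cpow_const
    (Complex.ofReal_mem_slitPlane.2 hx)).comp_ofReal).congr_deriv ?_
  rw [id, Complex.cpow_sub _ _ hx', Complex.cpow_one]
  ring

theorem isFreeSolution_cpow_mul (hF : ∀ x, 0 < x → HasDerivAt F (F₁ x) x)
    (hF₁ : ∀ x, 0 < x → HasDerivAt F₁ (F₂ x) x)
    (hode : ∀ x : ℝ, 0 < x → F₂ x + (1 + 2 * m) / x * F₁ x = k ^ 2 * F x) :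
    IsFreeSolution m k (fun x : ℝ => (x : ℂ) ^ (1 / 2 + m) * F x)
      (fun x : ℝ => (x : ℂ) ^ (1 / 2 + m) * ((1 / 2 + m) / x * F x + F₁ x)) := by
  intro x hx
  have hx' : (x : ℂ) ≠ 0 := Complex.ofReal_ne_zero.2 hx.ne'
  have hpow := hasDerivAt_ofReal_cpow_div (1 / 2 + m) hx
  have hdiv : HasDerivAt (fun x : ℝ => (1 / 2 + m) / (x : ℂ)) (-(1 / 2 + m) / (x : ℂ) ^ 2) x :=
    (((hasDerivAt_inv hx').const_mul (1 / 2 + m)).comp_ofReal).congr_deriv (by ring)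
  refine ⟨(hpow.fun_mul (hF x hx)).congr_deriv (by ring),
    (hpow.fun_mul ((hdiv.fun_mul (hF x hx)).fun_add (hF₁ x hx))).congr_deriv ?_⟩
  rw [eq_sub_of_add_eq (hode x hx)]
  field_simp
  ring

end Reduction

theorem norm_le_norm_add_natCast_add_one {μ : ℂ} {n : ℕ} (h : ‖μ‖ ≤ n) : 1 ≤ ‖μ + n + 1‖ := by
  have htri := norm_sub_le (μ + n + 1) μ
  rw [show μ + n + 1 - μ = ((n + 1 : ℕ) : ℂ) by push_cast; ring, Complex.norm_natCast] at htri
  push_cast at htri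
  linarith

theorem norm_inv_Gamma_add_natCast_succ_le {μ : ℂ} {n : ℕ} (h : ‖μ‖ ≤ n) :
    ‖(Complex.Gamma (μ + (n + 1 : ℕ) + 1))⁻¹‖ ≤ ‖(Complex.Gamma (μ + n + 1))⁻¹‖ := by
  rw [Complex.one_div_Gamma_eq_self_mul_one_div_Gamma_add_one (μ + n + 1), norm_mul,
    show μ + ((n + 1 : ℕ) : ℂ) + 1 = μ + n + 1 + 1 by push_cast; ring]
  exact le_mul_of_one_le_left (norm_nonneg _) (norm_le_norm_add_natCast_add_one h)

theorem exists_forall_norm_inv_Gamma_le (R : ℝ) : ∃ M : ℝ, ∀ μ : ℂ, ‖μ‖ ≤ R → ∀ n : ℕ,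
    ‖(Complex.Gamma (μ + n + 1))⁻¹‖ ≤ M := by
  have hcompact (n : ℕ) : ∃ C : ℝ, ∀ μ ∈ Metric.closedBall (0 : ℂ) R,
      ‖(Complex.Gamma (μ + n + 1))⁻¹‖ ≤ C :=
    (isCompact_closedBall (0 : ℂ) R).exists_bound_of_continuousOn
      (Complex.differentiable_one_div_Gamma.continuous.comp (by fun_prop)).continuousOn
  choose C hC using hcompact
  obtain ⟨N, hN⟩ := exists_nat_ge R
  refine ⟨(Finset.range (N + 1)).sup' Finset.nonempty_range_add_one C, fun μ hμ n => ?_⟩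
  have hsmall (n : ℕ) (hn : n ≤ N) : ‖(Complex.Gamma (μ + n + 1))⁻¹‖ ≤
      (Finset.range (N + 1)).sup' Finset.nonempty_range_add_one C :=
    (hC n μ (mem_closedBall_zero_iff.2 hμ)).trans
      (Finset.le_sup' C (Finset.mem_range.2 (Nat.lt_succ_of_le hn)))
  rcases le_total n N with hn | hn
  · exact hsmall n hn
  · induction n, hn using Nat.le_induction with
    | base => exact hsmall N le_rfl
    | succ n hn ih =>
      exact (norm_inv_Gamma_add_natCast_succ_le
        (hμ.trans (hN.trans (Nat.cast_le.2 hn)))).trans ih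

/-- The Taylor coefficients of `x^{-1/2-m} u_m^0(x,k)` in powers of `x²`. -/
def uCoeff (m k : ℂ) (n : ℕ) : ℂ :=
  (k ^ 2 / 4) ^ n / ((n.factorial : ℂ) * Complex.Gamma (m + n + 1))

theorem exists_forall_norm_uCoeff_le (k : ℂ) (R : ℝ) : ∃ M : ℝ, ∀ m : ℂ, ‖m‖ ≤ R → ∀ n,
    ‖uCoeff m k n‖ ≤ M * (‖k ^ 2 / 4‖ ^ n / n.factorial) := by
  obtain ⟨M, hM⟩ := exists_forall_norm_inv_Gamma_le R
  refine ⟨M, fun m hm n => ?_⟩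
  calc ‖uCoeff m k n‖ = ‖(Complex.Gamma (m + n + 1))⁻¹‖ * (‖k ^ 2 / 4‖ ^ n / n.factorial) := by
        rw [uCoeff, norm_div, norm_mul, norm_pow, norm_inv, Complex.norm_natCast]
        ring
    _ ≤ M * (‖k ^ 2 / 4‖ ^ n / n.factorial) := by
        gcongr
        exact hM m hm n

theorem isEntireCoeff_uCoeff (m k : ℂ) : IsEntireCoeff (uCoeff m k) :=
  have ⟨_, hM⟩ := exists_forall_norm_uCoeff_le k ‖m‖
  isEntireCoeff_of_norm_le_pow_div_factorial (hM m le_rfl)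

theorem uCoeff_succ (m k : ℂ) (n : ℕ) :
    (n + (m + 1)) * derivCoeff (uCoeff m k) n = k ^ 2 / 4 * uCoeff m k n := by
  have hn : (n : ℂ) + 1 ≠ 0 := Nat.cast_add_one_ne_zero n
  rw [derivCoeff, uCoeff, uCoeff, div_mul_eq_div_div_swap, div_mul_eq_div_div_swap,
    div_eq_mul_inv _ (Complex.Gamma (m + n + 1)),
    Complex.one_div_Gamma_eq_self_mul_one_div_Gamma_add_one (m + n + 1),
    show m + ((n + 1 : ℕ) : ℂ) + 1 = m + n + 1 + 1 by push_cast; ring,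
    Nat.factorial_succ, pow_succ]
  push_cast
  field_simp
  ring

theorem uCoeff_zero_right (m : ℂ) {n : ℕ} (hn : n ≠ 0) : uCoeff m 0 n = 0 := by
  simp [uCoeff, hn]

theorem uCoeff_mul_sq_pow (m k x : ℂ) (n : ℕ) :
    uCoeff m k n * (x ^ 2) ^ n =
      ((k * x) ^ 2 / 4) ^ n / ((n.factorial : ℂ) * Complex.Gamma (m + n + 1)) := by
  rw [uCoeff, div_mul_eq_mul_div, ← mul_pow]
  ring_nf

theorem uSeries_ode (m k z : ℂ) :
    z * powerSum (derivCoeff (derivCoeff (uCoeff m k))) z +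
      (m + 1) * powerSum (derivCoeff (uCoeff m k)) z = k ^ 2 / 4 * powerSum (uCoeff m k) z := by
  rw [(isEntireCoeff_uCoeff m k).mul_deriv_deriv_add_mul_deriv (m + 1) (uCoeff_succ m k),
    powerSum_const_mul]

theorem ofReal_cpow_half_add (m : ℂ) {x : ℝ} (hx : 0 < x) :
    (x : ℂ) ^ (1 / 2 + m) = (Real.sqrt x : ℂ) * (x : ℂ) ^ m := by
  rw [Complex.cpow_add _ _ (Complex.ofReal_ne_zero.2 hx.ne'), Real.sqrt_eq_rpow,
    Complex.ofReal_cpow hx.le]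
  norm_num

theorem norm_ofReal_cpow_half_add (m : ℂ) {x : ℝ} (hx : 0 < x) :
    ‖(x : ℂ) ^ (1 / 2 + m)‖ = x ^ (1 / 2 + m.re) := by
  rw [Complex.norm_cpow_eq_rpow_re_of_pos hx]
  norm_num

theorem powerSum_uCoeff_zero_right (m z : ℂ) :
    powerSum (uCoeff m 0) z = (Complex.Gamma (m + 1))⁻¹ := by
  rw [powerSum, tsum_eq_single 0 fun n hn => by rw [uCoeff_zero_right m hn, zero_mul]]
  simp [uCoeff]

theorem ofReal_mul_cpow {x : ℝ} (hx : 0 < x) {z : ℂ} (hz : z ≠ 0) (s : ℂ) :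
    ((x : ℂ) * z) ^ s = (x : ℂ) ^ s * z ^ s := by
  have hx' : (x : ℂ) ≠ 0 := Complex.ofReal_ne_zero.2 hx.ne'
  rw [Complex.cpow_def_of_ne_zero (mul_ne_zero hx' hz), Complex.cpow_def_of_ne_zero hx',
    Complex.cpow_def_of_ne_zero hz, Complex.log_ofReal_mul hx hz, ← Complex.exp_add,
    ← Complex.ofReal_log hx.le, add_mul]

theorem besselI_mul_ofReal (m : ℂ) {k : ℂ} (hk : k ≠ 0) {x : ℝ} (hx : 0 < x) :
    besselI m (k * x) = (x : ℂ) ^ m * (k / 2) ^ m * powerSum (uCoeff m k) ((x : ℂ) ^ 2) := by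
  rw [besselI, show k * x / 2 = (x : ℂ) * (k / 2) by ring,
    ofReal_mul_cpow hx (div_ne_zero hk two_ne_zero), powerSum]
  simp only [uCoeff_mul_sq_pow]

theorem u0_eq (m k : ℂ) {x : ℝ} (hx : 0 < x) :
    u0 m k x = (x : ℂ) ^ (1 / 2 + m) * powerSum (uCoeff m k) ((x : ℂ) ^ 2) := by
  rw [u0]
  split_ifs with hk
  · rw [hk, powerSum_uCoeff_zero_right, div_eq_mul_inv]
  · have hcancel : (k / 2) ^ (-m) * (k / 2) ^ m = 1 := by
      have hk2 : k / 2 ≠ 0 := div_ne_zero hk two_ne_zero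
      rw [← Complex.cpow_add _ _ hk2, neg_add_cancel, Complex.cpow_zero]
    rw [besselI_mul_ofReal m hk hx, ofReal_cpow_half_add m hx]
    linear_combination (Real.sqrt x : ℂ) * (x : ℂ) ^ m *
      powerSum (uCoeff m k) ((x : ℂ) ^ 2) * hcancel

theorem u0_isFreeSolution (m k : ℂ) :
    IsFreeSolution m k (u0 m k) (fun x : ℝ => (x : ℂ) ^ (1 / 2 + m) *
      ((1 / 2 + m) / x * powerSum (uCoeff m k) ((x : ℂ) ^ 2) +
        2 * x * powerSum (derivCoeff (uCoeff m k)) ((x : ℂ) ^ 2))) := by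
  have hu := isEntireCoeff_uCoeff m k
  refine IsFreeSolution.congr (isFreeSolution_cpow_mul
    (fun x _ => hasDerivAt_powerSum_sq hu x)
    (fun x _ => hasDerivAt_two_mul_mul_powerSum_sq hu.coeff_deriv x) fun x hx => ?_)
    fun x hx => u0_eq m k hx
  have hx' : (x : ℂ) ≠ 0 := Complex.ofReal_ne_zero.2 hx.ne'
  field_simp
  linear_combination 4 * uSeries_ode m k ((x : ℂ) ^ 2)

theorem u0_locallyDominated (m k : ℂ) :
    LocallyDominated (fun x => ‖u0 m k x‖) fun x => x ^ (1 / 2 + m.re) := by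
  intro a _
  obtain ⟨C, hC, h⟩ := exists_forall_norm_powerSum_sq_le (isEntireCoeff_uCoeff m k) a
  refine ⟨C, hC, fun x hx => ?_⟩
  have hx0 : 0 < x := hx.1
  simp only
  rw [u0_eq m k hx0, norm_mul, norm_ofReal_cpow_half_add m hx0, mul_comm]
  gcongr
  exact h x hx

/-! ### The logarithmic solution `p_0^0` -/

theorem norm_harmonic_le_two_pow (n : ℕ) : ‖(harmonic n : ℂ)‖ ≤ 2 ^ n := by
  induction n with
  | zero => simp
  | succ n ih =>
    have hinv : ‖((n : ℂ) + 1)⁻¹‖ ≤ 2 ^ n := by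
      rw [norm_inv, ← Nat.cast_add_one, Complex.norm_natCast]
      exact (inv_le_one_of_one_le₀ (by simp)).trans (one_le_pow₀ one_le_two)
    rw [harmonic_succ]
    push_cast
    calc ‖(harmonic n : ℂ) + ((n : ℂ) + 1)⁻¹‖ ≤ 2 ^ n + 2 ^ n := norm_add_le_of_le ih hinv
      _ = 2 ^ (n + 1) := by ring

theorem IsEntireCoeff.mul_of_norm_le_pow {b c : ℕ → ℂ} {A : ℝ} (hA : 0 ≤ A)
    (hc : IsEntireCoeff c) (hb : ∀ n, ‖b n‖ ≤ A ^ n) : IsEntireCoeff fun n => b n * c n := by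
  intro R hR
  refine Summable.of_nonneg_of_le (fun n => by positivity) (fun n => ?_)
    (hc (A * R) (by positivity))
  calc ‖b n * c n‖ * R ^ n = ‖b n‖ * (‖c n‖ * R ^ n) := by rw [norm_mul, mul_assoc]
    _ ≤ A ^ n * (‖c n‖ * R ^ n) := by
        gcongr
        exact hb n
    _ = ‖c n‖ * (A * R) ^ n := by rw [mul_pow]; ring

/-- The Taylor coefficients, in powers of `x²`, of the entire function subtracted from the
logarithmic term in `x^{-1/2} p_0^0(x,k)`. -/
def pCoeff (k : ℂ) (n : ℕ) : ℂ := (harmonic n : ℂ) * uCoeff 0 k n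

theorem isEntireCoeff_pCoeff (k : ℂ) : IsEntireCoeff (pCoeff k) :=
  (isEntireCoeff_uCoeff 0 k).mul_of_norm_le_pow zero_le_two norm_harmonic_le_two_pow

theorem hasDerivAt_inv_Gamma_add_natCast (n : ℕ) :
    HasDerivAt (fun μ : ℂ => (Complex.Gamma (μ + n + 1))⁻¹)
      (((Real.eulerMascheroniConstant : ℂ) - (harmonic n : ℂ)) / n.factorial) 0 := by
  have hn : (n.factorial : ℂ) ≠ 0 := Nat.cast_ne_zero.2 n.factorial_ne_zero
  have hGamma : HasDerivAt Complex.Gamma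
      (n.factorial * (-Real.eulerMascheroniConstant + harmonic n)) ((0 : ℂ) + (n + 1)) := by
    rw [zero_add]
    exact Complex.hasDerivAt_Gamma_nat n
  have hvalue : Complex.Gamma ((0 : ℂ) + (n + 1)) = n.factorial := by
    rw [zero_add, Complex.Gamma_nat_eq_factorial]
  simp only [add_assoc]
  refine ((hGamma.comp_add_const 0 (n + 1 : ℂ)).fun_inv (by rwa [hvalue])).congr_deriv ?_
  rw [hvalue]
  field_simp
  ring

theorem hasDerivAt_uCoeff_order (k : ℂ) (n : ℕ) :
    HasDerivAt (fun μ : ℂ => uCoeff μ k n)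
      (Real.eulerMascheroniConstant * uCoeff 0 k n - pCoeff k n) 0 := by
  simp only [pCoeff, uCoeff, div_mul_eq_div_div, zero_add, Complex.Gamma_nat_eq_factorial]
  simp only [div_eq_mul_inv _ (Complex.Gamma _)]
  exact ((hasDerivAt_inv_Gamma_add_natCast n).const_mul _).congr_deriv (by ring)

theorem hasDerivAt_powerSum_uCoeff_order (k z : ℂ) :
    HasDerivAt (fun μ : ℂ => powerSum (uCoeff μ k) z)
      (Real.eulerMascheroniConstant * powerSum (uCoeff 0 k) z - powerSum (pCoeff k) z) 0 := by
  obtain ⟨M, hM⟩ := exists_forall_norm_uCoeff_le k 1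
  have hterm (n : ℕ) := (hasDerivAt_uCoeff_order k n).mul_const (z ^ n)
  have hsum := ((Real.summable_pow_div_factorial (‖k ^ 2 / 4‖ * ‖z‖)).mul_left M)
  have hdiff (n : ℕ) : DifferentiableOn ℂ (fun μ => uCoeff μ k n * z ^ n) (Metric.ball 0 1) := by
    simp only [uCoeff, div_mul_eq_div_div]
    simp only [div_eq_mul_inv _ (Complex.Gamma _)]
    exact (((Complex.differentiable_one_div_Gamma.comp (by fun_prop)).const_mul _).mul_const
      _).differentiableOn
  have hle (n : ℕ) (μ : ℂ) (hμ : μ ∈ Metric.ball (0 : ℂ) 1) :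
      ‖uCoeff μ k n * z ^ n‖ ≤ M * ((‖k ^ 2 / 4‖ * ‖z‖) ^ n / n.factorial) := by
    rw [norm_mul, norm_pow]
    refine (mul_le_mul_of_nonneg_right (hM μ (mem_ball_zero_iff.1 hμ).le n)
      (by positivity)).trans_eq ?_
    rw [mul_pow]
    ring
  have hzero : (0 : ℂ) ∈ Metric.ball (0 : ℂ) 1 := Metric.mem_ball_self one_pos
  have hderiv := Complex.hasSum_deriv_of_summable_norm hsum hdiff Metric.isOpen_ball hle hzero
  refine ((Complex.differentiableOn_tsum_of_summable_norm hsum hdiff Metric.isOpen_ball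
    hle).differentiableAt (Metric.isOpen_ball.mem_nhds hzero)).hasDerivAt.congr_deriv
    (hderiv.unique ?_)
  refine ((((isEntireCoeff_uCoeff 0 k).hasSum z).mul_left _).sub
    ((isEntireCoeff_pCoeff k).hasSum z)).congr_fun fun n => ?_
  rw [(hterm n).deriv]
  ring

theorem hasDerivAt_besselI_order {k : ℂ} (hk : k ≠ 0) {x : ℝ} (hx : 0 < x) :
    HasDerivAt (fun μ : ℂ => besselI μ (k * x))
      ((Real.log x + Complex.log (k / 2) + Real.eulerMascheroniConstant) *
        powerSum (uCoeff 0 k) ((x : ℂ) ^ 2) - powerSum (pCoeff k) ((x : ℂ) ^ 2)) 0 := by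
  have hcpow {z : ℂ} (hz : z ≠ 0) : HasDerivAt (fun μ : ℂ => z ^ μ) (Complex.log z) 0 :=
    ((hasDerivAt_id (0 : ℂ)).const_cpow (Or.inl hz)).congr_deriv (by simp)
  simp only [besselI_mul_ofReal _ hk hx]
  refine (((hcpow (Complex.ofReal_ne_zero.2 hx.ne')).fun_mul
    (hcpow (div_ne_zero hk two_ne_zero))).fun_mul
      (hasDerivAt_powerSum_uCoeff_order k _)).congr_deriv ?_
  rw [Complex.cpow_zero, Complex.cpow_zero, Complex.ofReal_log hx.le]
  ring

theorem besselK_zero_eq_neg {z D : ℂ} (h : HasDerivAt (fun μ : ℂ => besselI μ z) D 0) :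
    besselK 0 z = -D := by
  have hneg : HasDerivAt (fun μ : ℂ => besselI (-μ) z) (-D) 0 := by
    rw [← neg_zero] at h
    exact (h.comp (0 : ℂ) (hasDerivAt_neg (0 : ℂ))).congr_deriv (by ring)
  have hsin : HasDerivAt (fun μ : ℂ => Complex.sin (Real.pi * μ)) (Real.pi : ℂ) 0 := by
    simpa using ((hasDerivAt_id (0 : ℂ)).const_mul (Real.pi : ℂ)).csin
  have hpi : (Real.pi : ℂ) ≠ 0 := Complex.ofReal_ne_zero.2 Real.pi_ne_zero
  have hquotient := (((hneg.fun_sub h).tendsto_slope.div hsin.tendsto_slope hpi).const_mul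
    ((Real.pi : ℂ) / 2))
  rw [show (Real.pi : ℂ) / 2 * ((-D - D) / Real.pi) = -D by field_simp; ring] at hquotient
  refine (hquotient.congr' ?_).limUnder_eq
  filter_upwards [self_mem_nhdsWithin] with μ (hμ : μ ≠ 0)
  simp only [Pi.div_apply, slope_def_field, neg_zero, sub_self, mul_zero, Complex.sin_zero,
    sub_zero]
  rw [div_div_div_cancel_right₀ hμ, mul_div_assoc]

/-- The function `x^{-1/2} p_0^0(x,k)`. -/
def pFactor (k : ℂ) (x : ℝ) : ℂ :=
  Real.log x * powerSum (uCoeff 0 k) ((x : ℂ) ^ 2) - powerSum (pCoeff k) ((x : ℂ) ^ 2)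

/-- The derivative of `pFactor`. -/
def pFactorDeriv (k : ℂ) (x : ℝ) : ℂ :=
  (x : ℂ)⁻¹ * powerSum (uCoeff 0 k) ((x : ℂ) ^ 2) +
    Real.log x * (2 * x * powerSum (derivCoeff (uCoeff 0 k)) ((x : ℂ) ^ 2)) -
    2 * x * powerSum (derivCoeff (pCoeff k)) ((x : ℂ) ^ 2)

theorem p00_eq (k : ℂ) {x : ℝ} (hx : 0 < x) :
    p00 k x = (x : ℂ) ^ (1 / 2 + 0 : ℂ) * pFactor k x := by
  rw [ofReal_cpow_half_add 0 hx, Complex.cpow_zero, mul_one, p00, pFactor]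
  split_ifs with hk
  · have hp : powerSum (pCoeff 0) ((x : ℂ) ^ 2) = 0 := by
      refine (tsum_congr fun n => ?_).trans tsum_zero
      rcases eq_or_ne n 0 with rfl | hn
      · simp [pCoeff]
      · simp [pCoeff, uCoeff_zero_right 0 hn]
    rw [hk, hp, powerSum_uCoeff_zero_right]
    simp
  · rw [v00, besselK_zero_eq_neg (hasDerivAt_besselI_order hk hx), u0_eq 0 k hx,
      ofReal_cpow_half_add 0 hx, Complex.cpow_zero]
    ring

theorem pCoeff_succ (k : ℂ) (n : ℕ) : (n + 1) * derivCoeff (pCoeff k) n =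
    k ^ 2 / 4 * pCoeff k n + derivCoeff (uCoeff 0 k) n := by
  have hn : (n : ℂ) + 1 ≠ 0 := Nat.cast_add_one_ne_zero n
  have hu := uCoeff_succ 0 k n
  rw [derivCoeff] at hu ⊢
  rw [derivCoeff, pCoeff, pCoeff, harmonic_succ]
  push_cast
  field_simp
  linear_combination 4 * (harmonic n : ℂ) * hu

theorem pSeries_ode (k z : ℂ) :
    z * powerSum (derivCoeff (derivCoeff (pCoeff k))) z + powerSum (derivCoeff (pCoeff k)) z =
      k ^ 2 / 4 * powerSum (pCoeff k) z + powerSum (derivCoeff (uCoeff 0 k)) z := by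
  have hp := isEntireCoeff_pCoeff k
  have hode := hp.mul_deriv_deriv_add_mul_deriv 1 (pCoeff_succ k) z
  rw [one_mul] at hode
  refine hode.trans (HasSum.tsum_eq ?_)
  exact (((hp.hasSum z).mul_left (k ^ 2 / 4)).add
    ((isEntireCoeff_uCoeff 0 k).coeff_deriv.hasSum z)).congr_fun fun n => by ring

theorem p00_isFreeSolution (k : ℂ) :
    IsFreeSolution 0 k (p00 k) (fun x : ℝ => (x : ℂ) ^ (1 / 2 + 0 : ℂ) *
      ((1 / 2 + 0) / x * pFactor k x + pFactorDeriv k x)) := by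
  have hu := isEntireCoeff_uCoeff 0 k
  have hp := isEntireCoeff_pCoeff k
  have hlog {x : ℝ} (hx : 0 < x) : HasDerivAt (fun x : ℝ => (Real.log x : ℂ)) (x : ℂ)⁻¹ x :=
    (Real.hasDerivAt_log hx.ne').ofReal_comp.congr_deriv (Complex.ofReal_inv x)
  have hinv {x : ℝ} (hx : 0 < x) : HasDerivAt (fun x : ℝ => (x : ℂ)⁻¹) (-((x : ℂ) ^ 2)⁻¹) x :=
    (hasDerivAt_inv (Complex.ofReal_ne_zero.2 hx.ne')).comp_ofReal
  refine IsFreeSolution.congr (isFreeSolution_cpow_mul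
    (fun x hx => ((hlog hx).fun_mul (hasDerivAt_powerSum_sq hu x)).fun_sub
      (hasDerivAt_powerSum_sq hp x))
    (fun x hx => (((hinv hx).fun_mul (hasDerivAt_powerSum_sq hu x)).fun_add
      ((hlog hx).fun_mul (hasDerivAt_two_mul_mul_powerSum_sq hu.coeff_deriv x))).fun_sub
      (hasDerivAt_two_mul_mul_powerSum_sq hp.coeff_deriv x)) fun x hx => ?_)
    fun x hx => p00_eq k hx
  have hx' : (x : ℂ) ≠ 0 := Complex.ofReal_ne_zero.2 hx.ne'
  have hode := uSeries_ode 0 k ((x : ℂ) ^ 2)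
  simp only [pFactor, pFactorDeriv]
  field_simp
  linear_combination 4 * (x : ℂ) ^ 2 * Real.log x * hode - 4 * (x : ℂ) ^ 2 * pSeries_ode k (x ^ 2)

/-! ### Energy estimates for `m ≠ 0` -/

section Gronwall

variable {F D : ℝ → ℝ} {q κ : ℝ}

theorem antitoneOn_mul_rpow_mul_exp (hF : ∀ x, 0 < x → HasDerivAt F (D x / x) x)
    (hD : ∀ x, 0 < x → D x ≤ (q + 2 * κ * x ^ 2) * F x) :
    AntitoneOn (fun x => F x * (x ^ (-q) * Real.exp (-(κ * x ^ 2)))) (Ioi 0) := by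
  have hd : ∀ x, 0 < x → HasDerivAt (fun x => F x * (x ^ (-q) * Real.exp (-(κ * x ^ 2))))
      (x ^ (-q) * Real.exp (-(κ * x ^ 2)) / x * (D x - (q + 2 * κ * x ^ 2) * F x)) x := by
    intro x hx
    refine ((hF x hx).fun_mul ((Real.hasDerivAt_rpow_const (Or.inl hx.ne')).fun_mul
      ((hasDerivAt_pow 2 x).const_mul κ).fun_neg.exp)).congr_deriv ?_
    rw [Real.rpow_sub_one hx.ne']
    push_cast
    field_simp
    ring
  refine antitoneOn_of_deriv_nonpos (convex_Ioi 0)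
    (fun x hx => (hd x hx).continuousAt.continuousWithinAt)
    (fun x hx => (hd x (interior_subset hx)).differentiableAt.differentiableWithinAt)
    fun x hx => ?_
  have hx : 0 < x := interior_subset hx
  rw [(hd x hx).deriv]
  exact mul_nonpos_of_nonneg_of_nonpos (by positivity) (sub_nonpos.2 (hD x hx))

theorem monotoneOn_mul_rpow_mul_exp (hF : ∀ x, 0 < x → HasDerivAt F (D x / x) x)
    (hD : ∀ x, 0 < x → (q - 2 * κ * x ^ 2) * F x ≤ D x) :
    MonotoneOn (fun x => F x * (x ^ (-q) * Real.exp (κ * x ^ 2))) (Ioi 0) := by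
  have h := (antitoneOn_mul_rpow_mul_exp (F := -F) (D := -D) (q := q) (κ := -κ)
    (fun x hx => (hF x hx).neg.congr_deriv (by simp [neg_div]))
    fun x hx => by simp only [Pi.neg_apply]; linarith [hD x hx]).neg
  refine h.congr fun x _ => ?_
  simp

theorem le_exp_mul_div_rpow_mul (hκ : 0 ≤ κ) (hF₀ : ∀ x, 0 ≤ F x)
    (hF : ∀ x, 0 < x → HasDerivAt F (D x / x) x)
    (hD : ∀ x, 0 < x → D x ≤ (q + 2 * κ * x ^ 2) * F x) {x y : ℝ} (hy : 0 < y) (hyx : y ≤ x) :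
    F x ≤ Real.exp (κ * x ^ 2) * (x / y) ^ q * F y := by
  have hx := hy.trans_le hyx
  have hexp : Real.exp (-(κ * y ^ 2)) ≤ 1 := Real.exp_le_one_iff.2 (neg_nonpos.2 (by positivity))
  have h : F x * (x ^ (-q) * Real.exp (-(κ * x ^ 2))) ≤ F y * y ^ (-q) :=
    (antitoneOn_mul_rpow_mul_exp hF hD hy hx hyx).trans
      (mul_le_mul_of_nonneg_left (mul_le_of_le_one_right (by positivity) hexp) (hF₀ y))
  rw [Real.exp_neg, Real.rpow_neg hx.le, Real.rpow_neg hy.le, ← mul_inv, ← div_eq_mul_inv,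
    div_le_iff₀ (by positivity)] at h
  rw [Real.div_rpow hx.le hy.le]
  exact h.trans_eq (by ring)

theorem le_exp_mul_div_rpow_mul' (hκ : 0 ≤ κ) (hF₀ : ∀ x, 0 ≤ F x)
    (hF : ∀ x, 0 < x → HasDerivAt F (D x / x) x)
    (hD : ∀ x, 0 < x → (q - 2 * κ * x ^ 2) * F x ≤ D x) {x y : ℝ} (hy : 0 < y) (hyx : y ≤ x) :
    F y ≤ Real.exp (κ * x ^ 2) * (y / x) ^ q * F x := by
  have hx := hy.trans_le hyx
  have hexp : 1 ≤ Real.exp (κ * y ^ 2) := Real.one_le_exp (by positivity)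
  have h : F y * y ^ (-q) ≤ F x * (x ^ (-q) * Real.exp (κ * x ^ 2)) :=
    (mul_le_mul_of_nonneg_left (le_mul_of_one_le_right (by positivity) hexp) (hF₀ y)).trans
      (monotoneOn_mul_rpow_mul_exp hF hD hy hx hyx)
  rw [Real.rpow_neg hx.le, Real.rpow_neg hy.le, ← div_eq_mul_inv, div_le_iff₀ (by positivity)] at h
  rw [Real.div_rpow hy.le hx.le]
  exact h.trans_eq (by ring)

end Gronwall

theorem hasDerivAt_norm_sq_of_euler {u : ℝ → ℂ} {a c : ℂ} {x : ℝ}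
    (hu : HasDerivAt u ((a * u x + c) / x) x) :
    HasDerivAt (fun y => ‖u y‖ ^ 2) ((2 * (a.re * ‖u x‖ ^ 2 + inner ℝ (u x) c)) / x) x := by
  refine hu.norm_sq.congr_deriv ?_
  have hre : inner ℝ (u x) (a * u x) = a.re * ‖u x‖ ^ 2 := by
    rw [Complex.inner, ← Complex.normSq_eq_norm_sq, mul_assoc, Complex.mul_conj]
    simp
  rw [div_eq_inv_mul, ← Complex.ofReal_inv, ← Complex.real_smul, inner_smul_right, inner_add_right,
    hre]
  ring

/-- The component `x f' + (s - 1/2) f`. For `s = ±m` these two components diagonalize the Euler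
operator `-∂² + (m² - 1/4) x⁻²`: one of them vanishes on `x^{1/2+m}`, the other on `x^{1/2-m}`. -/
def eulerComp (s : ℂ) (f f' : ℝ → ℂ) (x : ℝ) : ℂ := x * f' x + (s - 1 / 2) * f x

/-- The sum of the squares of the two Euler components of a function with derivative `f'`. -/
def energy (m : ℂ) (f f' : ℝ → ℂ) (x : ℝ) : ℝ :=
  ‖eulerComp m f f' x‖ ^ 2 + ‖eulerComp (-m) f f' x‖ ^ 2

section Energy

variable {m k : ℂ} {f f' : ℝ → ℂ} {x y : ℝ}

theorem energy_nonneg (m : ℂ) (f f' : ℝ → ℂ) (x : ℝ) : 0 ≤ energy m f f' x := by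
  unfold energy
  positivity

theorem eulerComp_sub_eulerComp_neg (m : ℂ) (f f' : ℝ → ℂ) (x : ℝ) :
    eulerComp m f f' x - eulerComp (-m) f f' x = 2 * m * f x := by
  unfold eulerComp
  ring

theorem eulerComp_add_eulerComp_neg (m : ℂ) (f f' : ℝ → ℂ) (x : ℝ) :
    eulerComp m f f' x + eulerComp (-m) f f' x = 2 * (x * f' x) - f x := by
  unfold eulerComp
  ring

theorem norm_le_sqrt_energy (hm : m ≠ 0) (f f' : ℝ → ℂ) (x : ℝ) :
    ‖f x‖ ≤ √(energy m f f' x) / ‖m‖ := by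
  have hp : ‖eulerComp m f f' x‖ ≤ √(energy m f f' x) :=
    Real.le_sqrt_of_sq_le (le_add_of_nonneg_right (sq_nonneg _))
  have hn : ‖eulerComp (-m) f f' x‖ ≤ √(energy m f f' x) :=
    Real.le_sqrt_of_sq_le (le_add_of_nonneg_left (sq_nonneg _))
  have hsub := norm_sub_le (eulerComp m f f' x) (eulerComp (-m) f f' x)
  rw [eulerComp_sub_eulerComp_neg, norm_mul, norm_mul, RCLike.norm_ofNat] at hsub
  rw [le_div_iff₀ (norm_pos_iff.2 hm)]
  linarith

theorem norm_deriv_le_sqrt_energy (hm : m ≠ 0) (f f' : ℝ → ℂ) (hx : 0 < x) :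
    ‖f' x‖ ≤ (1 + 1 / ‖m‖) * √(energy m f f' x) / x := by
  have hp : ‖eulerComp m f f' x‖ ≤ √(energy m f f' x) :=
    Real.le_sqrt_of_sq_le (le_add_of_nonneg_right (sq_nonneg _))
  have hn : ‖eulerComp (-m) f f' x‖ ≤ √(energy m f f' x) :=
    Real.le_sqrt_of_sq_le (le_add_of_nonneg_left (sq_nonneg _))
  have hadd := norm_add_le (eulerComp m f f' x) (eulerComp (-m) f f' x)
  have hf := norm_le_sqrt_energy hm f f' x
  have htri : ‖(2 : ℂ) * (x * f' x)‖ ≤ ‖2 * (x * f' x) - f x‖ + ‖f x‖ := by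
    simpa using norm_add_le (2 * (x * f' x) - f x) (f x)
  rw [norm_mul, norm_mul, RCLike.norm_ofNat, Complex.norm_of_nonneg hx.le] at htri
  rw [eulerComp_add_eulerComp_neg] at hadd
  rw [le_div_iff₀ hx, add_mul, one_mul, one_div_mul_eq_div]
  linarith [norm_nonneg (f x)]

theorem IsFreeSolution.neg (h : IsFreeSolution m k f f') : IsFreeSolution (-m) k f f' := by
  rwa [IsFreeSolution, neg_sq]

theorem IsFreeSolution.hasDerivAt_eulerComp (h : IsFreeSolution m k f f') (hx : 0 < x) :
    HasDerivAt (eulerComp m f f')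
      (((m + 1 / 2) * eulerComp m f f' x + k ^ 2 * x ^ 2 * f x) / x) x := by
  have hx' : (x : ℂ) ≠ 0 := Complex.ofReal_ne_zero.2 hx.ne'
  have hid : HasDerivAt (fun x : ℝ => (x : ℂ)) 1 x := (hasDerivAt_id (x : ℂ)).comp_ofReal
  refine ((hid.fun_mul (h x hx).2).fun_add ((h x hx).1.const_mul (m - 1 / 2))).congr_deriv ?_
  unfold eulerComp
  field_simp
  ring

-- Along the Euler flow the squared components scale like `x^{1 ± 2 Re m}`; the term `k² f` is a
-- perturbation of relative size `x²`.
theorem IsFreeSolution.exists_hasDerivAt_energy (hm : m ≠ 0) (h : IsFreeSolution m k f f')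
    (hx : 0 < x) : ∃ D : ℝ, HasDerivAt (energy m f f') (D / x) x ∧
      |D - energy m f f' x| ≤
        (2 * |m.re| + 2 * (‖k‖ ^ 2 / ‖m‖) * x ^ 2) * energy m f f' x := by
  refine ⟨_, ((hasDerivAt_norm_sq_of_euler (h.hasDerivAt_eulerComp hx)).fun_add
    (hasDerivAt_norm_sq_of_euler (h.neg.hasDerivAt_eulerComp hx))).congr_deriv
      (add_div _ _ _).symm, ?_⟩
  set p := eulerComp m f f' x with hp
  set n := eulerComp (-m) f f' x with hn
  set c := k ^ 2 * (x : ℂ) ^ 2 * f x with hc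
  have hE : energy m f f' x = ‖p‖ ^ 2 + ‖n‖ ^ 2 := rfl
  have hre : |m.re * (‖p‖ ^ 2 - ‖n‖ ^ 2)| ≤ |m.re| * energy m f f' x := by
    rw [abs_mul, hE]
    gcongr
    exact abs_sub_le_of_nonneg_of_le (sq_nonneg _) (by simp) (sq_nonneg _) (by simp)
  have hparallelogram : ‖p + n‖ * ‖p - n‖ ≤ energy m f f' x := by
    have := parallelogram_law_with_norm ℝ p n
    rw [hE]
    nlinarith [sq_nonneg (‖p + n‖ - ‖p - n‖)]
  have hpert : |inner ℝ (p + n) c| ≤ ‖k‖ ^ 2 / ‖m‖ * x ^ 2 * energy m f f' x := by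
    have hcn : ‖c‖ = ‖k‖ ^ 2 / ‖m‖ * x ^ 2 * (‖p - n‖ / 2) := by
      have := norm_pos_iff.2 hm
      rw [hc, hp, hn, eulerComp_sub_eulerComp_neg]
      simp only [norm_mul, norm_pow, RCLike.norm_ofNat, Complex.norm_of_nonneg hx.le]
      field_simp
    calc |inner ℝ (p + n) c| ≤ ‖p + n‖ * ‖c‖ := abs_real_inner_le_norm _ _
      _ = ‖k‖ ^ 2 / ‖m‖ * x ^ 2 * (‖p + n‖ * ‖p - n‖ / 2) := by rw [hcn]; ring
      _ ≤ ‖k‖ ^ 2 / ‖m‖ * x ^ 2 * energy m f f' x := by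
          gcongr
          linarith [energy_nonneg m f f' x]
  calc _ = |2 * (m.re * (‖p‖ ^ 2 - ‖n‖ ^ 2)) + 2 * inner ℝ (p + n) c| := by
        rw [hE, inner_add_left]
        congr 1
        simp only [Complex.add_re, Complex.neg_re, Complex.div_ofNat_re, Complex.one_re]
        ring
    _ ≤ 2 * |m.re * (‖p‖ ^ 2 - ‖n‖ ^ 2)| + 2 * |inner ℝ (p + n) c| := by
        refine (abs_add_le _ _).trans_eq ?_
        simp only [abs_mul, abs_two]
    _ ≤ _ := by linarith

theorem IsFreeSolution.energy_le (hm : m ≠ 0) (h : IsFreeSolution m k f f') (hy : 0 < y)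
    (hyx : y ≤ x) : energy m f f' x ≤
      Real.exp (‖k‖ ^ 2 / ‖m‖ * x ^ 2) * (x / y) ^ (1 + 2 * |m.re|) * energy m f f' y := by
  choose! D hD hDb using fun x (hx : 0 < x) => h.exists_hasDerivAt_energy hm hx
  exact le_exp_mul_div_rpow_mul (by positivity) (energy_nonneg m f f') hD
    (fun x hx => by linarith [(abs_le.1 (hDb x hx)).2]) hy hyx

theorem IsFreeSolution.energy_le' (hm : m ≠ 0) (h : IsFreeSolution m k f f') (hy : 0 < y)
    (hyx : y ≤ x) : energy m f f' y ≤
      Real.exp (‖k‖ ^ 2 / ‖m‖ * x ^ 2) * (y / x) ^ (1 - 2 * |m.re|) * energy m f f' x := by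
  choose! D hD hDb using fun x (hx : 0 < x) => h.exists_hasDerivAt_energy hm hx
  exact le_exp_mul_div_rpow_mul' (by positivity) (energy_nonneg m f f') hD
    (fun x hx => by linarith [(abs_le.1 (hDb x hx)).1]) hy hyx

end Energy

section EnergyBounds

variable {m k w : ℂ} {f f' h₁ h₂ : ℝ → ℂ}

theorem IsFreeSolution.isBigO_sqrt_energy (hm : m ≠ 0) (h : IsFreeSolution m k f f') :
    (fun x => √(energy m f f' x)) =O[𝓝[>] 0] fun x => x ^ (1 / 2 - |m.re|) := by
  refine IsBigO.of_bound √(Real.exp (‖k‖ ^ 2 / ‖m‖) * energy m f f' 1) ?_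
  filter_upwards [Ioo_mem_nhdsGT one_pos] with y hy
  have hE := h.energy_le' hm hy.1 hy.2.le
  rw [one_pow, mul_one, div_one] at hE
  rw [Real.norm_of_nonneg (Real.sqrt_nonneg _), Real.norm_of_nonneg (Real.rpow_nonneg hy.1.le _)]
  refine Real.sqrt_le_iff.2 ⟨by have := hy.1; positivity, hE.trans_eq ?_⟩
  rw [mul_pow, Real.sq_sqrt (mul_nonneg (Real.exp_nonneg _) (energy_nonneg _ _ _ _)),
    ← Real.rpow_mul_natCast hy.1.le]
  push_cast
  ring_nf

theorem IsFreeSolution.isBigO (hm : m ≠ 0) (h : IsFreeSolution m k f f') :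
    f =O[𝓝[>] 0] fun x => x ^ (1 / 2 - |m.re|) := by
  refine IsBigO.trans (IsBigO.of_bound (1 / ‖m‖) ?_) (h.isBigO_sqrt_energy hm)
  filter_upwards with x
  rw [Real.norm_of_nonneg (Real.sqrt_nonneg _), one_div_mul_eq_div]
  exact norm_le_sqrt_energy hm f f' x

theorem IsFreeSolution.isBigO_deriv (hm : m ≠ 0) (h : IsFreeSolution m k f f') :
    f' =O[𝓝[>] 0] fun x => x ^ (-1 / 2 - |m.re|) := by
  have hdiv : (fun x => √(energy m f f' x) * x⁻¹) =O[𝓝[>] 0] fun x => x ^ (-1 / 2 - |m.re|) := by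
    refine ((h.isBigO_sqrt_energy hm).mul (isBigO_refl _ _)).congr' EventuallyEq.rfl ?_
    filter_upwards [self_mem_nhdsWithin] with x (hx : 0 < x)
    rw [← div_eq_mul_inv, ← Real.rpow_sub_one hx.ne']
    ring_nf
  refine IsBigO.trans (IsBigO.of_bound (1 + 1 / ‖m‖) ?_) hdiv
  filter_upwards [self_mem_nhdsWithin] with x (hx : 0 < x)
  rw [Real.norm_of_nonneg (by positivity), ← div_eq_mul_inv, ← mul_div_assoc]
  exact norm_deriv_le_sqrt_energy hm f f' hx

theorem IsFundamentalPair.isFreeSolution_kernel (h : IsFundamentalPair m k h₁ h₂ w) (y : ℝ) :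
    IsFreeSolution m k (fun x => h₁ x * h₂ y - h₂ x * h₁ y)
      (fun x => deriv h₁ x * h₂ y - deriv h₂ x * h₁ y) := fun x hx =>
  ⟨((h.left x hx).1.mul_const _).fun_sub ((h.right x hx).1.mul_const _),
    (((h.left x hx).2.mul_const _).fun_sub ((h.right x hx).2.mul_const _)).congr_deriv (by ring)⟩

theorem IsFundamentalPair.energy_kernel (h : IsFundamentalPair m k h₁ h₂ w) {y : ℝ} (hy : 0 < y) :
    energy m (fun x => h₁ x * h₂ y - h₂ x * h₁ y)
      (fun x => deriv h₁ x * h₂ y - deriv h₂ x * h₁ y) y = 2 * (‖w‖ * y) ^ 2 := by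
  have hzero : h₁ y * h₂ y - h₂ y * h₁ y = 0 := by ring
  have hderiv : deriv h₁ y * h₂ y - deriv h₂ y * h₁ y = -w := by
    rw [← h.wronskian hy]
    ring
  simp only [energy, eulerComp, hzero, hderiv, mul_zero, add_zero, norm_mul, norm_neg,
    Complex.norm_of_nonneg hy.le]
  ring

-- The kernel solves the free equation in `x`, vanishes at `x = y`, and has slope `-w` there.
theorem IsFundamentalPair.sqrt_energy_kernel_le (hm : m ≠ 0) (h : IsFundamentalPair m k h₁ h₂ w)
    {x y a : ℝ} (hy : 0 < y) (hyx : y ≤ x) (hxa : x ≤ a) :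
    √(energy m (fun x => h₁ x * h₂ y - h₂ x * h₁ y)
      (fun x => deriv h₁ x * h₂ y - deriv h₂ x * h₁ y) x) ≤
      √(2 * Real.exp (‖k‖ ^ 2 / ‖m‖ * a ^ 2)) * ‖w‖ *
        (x ^ (1 / 2 + |m.re|) * y ^ (1 / 2 - |m.re|)) := by
  have hx := hy.trans_le hyx
  have hpow : (x / y) ^ (1 + 2 * |m.re|) * y ^ 2 =
      (x ^ (1 / 2 + |m.re|) * y ^ (1 / 2 - |m.re|)) ^ 2 := by
    rw [mul_pow, ← Real.rpow_mul_natCast hx.le, ← Real.rpow_mul_natCast hy.le,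
      Real.div_rpow hx.le hy.le, div_mul_eq_mul_div, mul_div_assoc, ← Real.rpow_natCast y,
      ← Real.rpow_sub hy]
    push_cast
    ring_nf
  refine Real.sqrt_le_iff.2 ⟨by positivity, ?_⟩
  calc _ ≤ Real.exp (‖k‖ ^ 2 / ‖m‖ * x ^ 2) * (x / y) ^ (1 + 2 * |m.re|) * (2 * (‖w‖ * y) ^ 2) :=
        h.energy_kernel hy ▸ (h.isFreeSolution_kernel y).energy_le hm hy hyx
    _ ≤ Real.exp (‖k‖ ^ 2 / ‖m‖ * a ^ 2) * (x / y) ^ (1 + 2 * |m.re|) * (2 * (‖w‖ * y) ^ 2) := by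
        gcongr
    _ = _ := by
        rw [mul_pow (_ * _), mul_pow √_, Real.sq_sqrt (by positivity), ← hpow]
        ring

theorem IsFundamentalPair.green_bound (hm : m ≠ 0) (h : IsFundamentalPair m k h₁ h₂ w) (a : ℝ) :
    ∃ C : ℝ, 0 ≤ C ∧ ∀ x y, 0 < y → y ≤ x → x ≤ a →
      ‖h₁ x * h₂ y - h₂ x * h₁ y‖ ≤ C * (x ^ (1 / 2 + |m.re|) * y ^ (1 / 2 - |m.re|)) ∧
      ‖deriv h₁ x * h₂ y - deriv h₂ x * h₁ y‖ ≤
        C * (x ^ (-1 / 2 + |m.re|) * y ^ (1 / 2 - |m.re|)) := by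
  set K := √(2 * Real.exp (‖k‖ ^ 2 / ‖m‖ * a ^ 2)) * ‖w‖ with hK
  refine ⟨(1 + 1 / ‖m‖) * K, by positivity, fun x y hy hyx hxa => ?_⟩
  have hx := hy.trans_le hyx
  have hE := h.sqrt_energy_kernel_le hm hy hyx hxa
  rw [← hK] at hE
  constructor
  · refine (norm_le_sqrt_energy hm (fun x => h₁ x * h₂ y - h₂ x * h₁ y)
      (fun x => deriv h₁ x * h₂ y - deriv h₂ x * h₁ y) x).trans ?_
    rw [← one_div_mul_eq_div, mul_assoc]
    gcongr
    simp
  · refine (norm_deriv_le_sqrt_energy hm (fun x => h₁ x * h₂ y - h₂ x * h₁ y)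
      (fun x => deriv h₁ x * h₂ y - deriv h₂ x * h₁ y) hx).trans ?_
    rw [show -1 / 2 + |m.re| = 1 / 2 + |m.re| - 1 by ring, Real.rpow_sub_one hx.ne', mul_assoc,
      div_mul_eq_mul_div, mul_div_assoc', mul_div_assoc']
    gcongr

end EnergyBounds

/-! ### Uniqueness -/

section Uniqueness

variable {m k w : ℂ} {e e' h h' h₁ h₂ : ℝ → ℂ}

theorem IsFreeSolution.wronskian_eq_of_tendsto {c : ℂ} (he : IsFreeSolution m k e e')
    (hh : IsFreeSolution m k h h')
    (hlim : Tendsto (fun y => e y * h' y - e' y * h y) (𝓝[>] 0) (𝓝 c)) {x : ℝ} (hx : 0 < x) :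
    e x * h' x - e' x * h x = c := by
  refine tendsto_nhds_unique (tendsto_const_nhds.congr' ?_) hlim
  filter_upwards [self_mem_nhdsWithin] with y hy using he.wronskian_eq hh hx hy

theorem IsFreeSolution.wronskian_eq_zero {s : ℝ} (he : IsFreeSolution m k e e')
    (hh : IsFreeSolution m k h h') (heo : e =o[𝓝[>] 0] fun x => x ^ (1 / 2 + s))
    (heo' : e' =o[𝓝[>] 0] fun x => x ^ (-1 / 2 + s))
    (hhO : h =O[𝓝[>] 0] fun x => x ^ (1 / 2 - s)) (hhO' : h' =O[𝓝[>] 0] fun x => x ^ (-1 / 2 - s))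
    {x : ℝ} (hx : 0 < x) : e x * h' x - e' x * h x = 0 := by
  have hleft : (fun y => e y * h' y) =o[𝓝[>] 0] fun _ => (1 : ℝ) := by
    refine (heo.mul_isBigO hhO').congr' EventuallyEq.rfl ?_
    filter_upwards [self_mem_nhdsWithin] with y hy
    rw [← Real.rpow_add hy]
    norm_num
  have hright : (fun y => e' y * h y) =o[𝓝[>] 0] fun _ => (1 : ℝ) := by
    refine (heo'.mul_isBigO hhO).congr' EventuallyEq.rfl ?_
    filter_upwards [self_mem_nhdsWithin] with y hy
    rw [← Real.rpow_add hy]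
    norm_num
  exact he.wronskian_eq_of_tendsto hh ((isLittleO_one_iff ℝ).1 (hleft.sub hright)) hx

theorem IsFundamentalPair.eqOn_zero_of_isLittleO (hm : m ≠ 0) (hp : IsFundamentalPair m k h₁ h₂ w)
    (he : IsFreeSolution m k e e') (heo : e =o[𝓝[>] 0] fun x => x ^ (1 / 2 + |m.re|))
    (heo' : e' =o[𝓝[>] 0] fun x => x ^ (-1 / 2 + |m.re|)) : EqOn e 0 (Ioi 0) := by
  intro x hx
  have hW₁ := he.wronskian_eq_zero hp.left heo heo' (hp.left.isBigO hm) (hp.left.isBigO_deriv hm) hx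
  have hW₂ := he.wronskian_eq_zero hp.right heo heo' (hp.right.isBigO hm)
    (hp.right.isBigO_deriv hm) hx
  refine (mul_eq_zero.1 ?_).resolve_left hp.wronskian_ne_zero
  rw [← hp.wronskian hx]
  linear_combination h₁ x * hW₂ - h₂ x * hW₁

end Uniqueness

/-! ### Existence of fundamental pairs -/

theorem ofReal_cpow_half_add_mul_cpow_half_sub (m : ℂ) {x : ℝ} (hx : 0 < x) :
    (x : ℂ) ^ (1 / 2 + m) * (x : ℂ) ^ (1 / 2 + -m) = x := by
  rw [← Complex.cpow_add _ _ (Complex.ofReal_ne_zero.2 hx.ne'),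
    show 1 / 2 + m + (1 / 2 + -m) = 1 by ring, Complex.cpow_one]

theorem wronskian_cpow_mul (m : ℂ) {x : ℝ} (hx : 0 < x) (F F' G G' : ℂ) :
    (x : ℂ) ^ (1 / 2 + m) * F * ((x : ℂ) ^ (1 / 2 + -m) * ((1 / 2 + -m) / x * G + G')) -
      (x : ℂ) ^ (1 / 2 + m) * ((1 / 2 + m) / x * F + F') * ((x : ℂ) ^ (1 / 2 + -m) * G) =
    -2 * m * (F * G) + x * (F * G' - F' * G) := by
  have hx' : (x : ℂ) ≠ 0 := Complex.ofReal_ne_zero.2 hx.ne'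
  have hpow := ofReal_cpow_half_add_mul_cpow_half_sub m hx
  generalize (x : ℂ) ^ (1 / 2 + m) = P at *
  generalize (x : ℂ) ^ (1 / 2 + -m) = R at *
  field_simp
  linear_combination (-2 * m * F * G + x * (F * G' - F' * G)) * 2 * hpow

theorem IsEntireCoeff.tendsto_powerSum_sq {c : ℕ → ℂ} (hc : IsEntireCoeff c) :
    Tendsto (fun x : ℝ => powerSum c ((x : ℂ) ^ 2)) (𝓝[>] 0) (𝓝 (c 0)) := by
  have hcont : Continuous fun x : ℝ => powerSum c ((x : ℂ) ^ 2) :=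
    hc.continuous.comp (by fun_prop)
  have hlim := hcont.tendsto 0
  rw [Complex.ofReal_zero, zero_pow two_ne_zero, powerSum_apply_zero] at hlim
  exact hlim.mono_left nhdsWithin_le_nhds

theorem tendsto_mul_sq_mul_nhdsGT_zero (a : ℂ) {F : ℝ → ℂ} {c : ℂ}
    (hF : Tendsto F (𝓝[>] 0) (𝓝 c)) :
    Tendsto (fun x : ℝ => a * (x : ℂ) ^ 2 * F x) (𝓝[>] 0) (𝓝 0) := by
  have hsq : Tendsto (fun x : ℝ => a * (x : ℂ) ^ 2) (𝓝[>] 0) (𝓝 0) := by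
    have hcont : Continuous fun x : ℝ => a * (x : ℂ) ^ 2 := by fun_prop
    simpa using (hcont.tendsto 0).mono_left nhdsWithin_le_nhds
  simpa using hsq.mul hF

theorem uCoeff_apply_zero (m k : ℂ) : uCoeff m k 0 = (Complex.Gamma (m + 1))⁻¹ := by
  simp [uCoeff]

theorem isFundamentalPair_zero (k : ℂ) : IsFundamentalPair 0 k (u0 0 k) (p00 k) 1 := by
  have hu := isEntireCoeff_uCoeff 0 k
  have hp := isEntireCoeff_pCoeff k
  refine (u0_isFreeSolution 0 k).isFundamentalPair (p00_isFreeSolution k) one_ne_zero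
    fun x hx => (u0_isFreeSolution 0 k).wronskian_eq_of_tendsto (p00_isFreeSolution k) ?_ hx
  have hlim := (hu.tendsto_powerSum_sq.pow 2).add (tendsto_mul_sq_mul_nhdsGT_zero 2
    ((hu.coeff_deriv.tendsto_powerSum_sq.mul hp.tendsto_powerSum_sq).sub
      (hu.tendsto_powerSum_sq.mul hp.coeff_deriv.tendsto_powerSum_sq)))
  rw [uCoeff_apply_zero, zero_add, Complex.Gamma_one, inv_one, one_pow, add_zero] at hlim
  refine hlim.congr' ?_
  filter_upwards [self_mem_nhdsWithin] with y (hy : 0 < y)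
  have hy' : (y : ℂ) ≠ 0 := Complex.ofReal_ne_zero.2 hy.ne'
  have hW := wronskian_cpow_mul 0 hy (powerSum (uCoeff 0 k) ((y : ℂ) ^ 2))
    (2 * y * powerSum (derivCoeff (uCoeff 0 k)) ((y : ℂ) ^ 2)) (pFactor k y) (pFactorDeriv k y)
  rw [neg_zero] at hW
  rw [u0_eq 0 k hy, p00_eq k hy, hW, pFactor, pFactorDeriv]
  field_simp
  ring

theorem isFundamentalPair_euler {m : ℂ} (hm : m ≠ 0) :
    IsFundamentalPair m 0 (fun x : ℝ => (x : ℂ) ^ (1 / 2 + m) * 1)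
      (fun x : ℝ => (x : ℂ) ^ (1 / 2 + -m) * 1) (-2 * m) := by
  have hpower (μ : ℂ) : IsFreeSolution μ 0 (fun x : ℝ => (x : ℂ) ^ (1 / 2 + μ) * 1)
      (fun x : ℝ => (x : ℂ) ^ (1 / 2 + μ) * ((1 / 2 + μ) / x * 1 + 0)) :=
    isFreeSolution_cpow_mul (F := fun _ => 1) (F₁ := fun _ => 0) (F₂ := fun _ => 0)
      (fun x _ => hasDerivAt_const x _) (fun x _ => hasDerivAt_const x _) fun x _ => by ring
  have hneg := (hpower (-m)).neg
  rw [neg_neg] at hneg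
  refine (hpower m).isFundamentalPair hneg (mul_ne_zero (by norm_num) hm) fun x hx => ?_
  rw [wronskian_cpow_mul m hx]
  ring

theorem isFundamentalPair_of_ne_intCast {m : ℂ} (k : ℂ) (hm : ∀ n : ℤ, m ≠ n) :
    IsFundamentalPair m k (u0 m k) (u0 (-m) k)
      (-2 * m * ((Complex.Gamma (m + 1))⁻¹ * (Complex.Gamma (-m + 1))⁻¹)) := by
  have hGamma {μ : ℂ} (hμ : ∀ n : ℤ, μ ≠ n) : (Complex.Gamma (μ + 1))⁻¹ ≠ 0 := by
    refine inv_ne_zero (Complex.Gamma_ne_zero fun n hn => hμ (-(n + 1)) ?_)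
    push_cast
    linear_combination hn
  have hm₀ : m ≠ 0 := by simpa using hm 0
  have hm' (n : ℤ) : -m ≠ n := fun h => hm (-n) (by rw [Int.cast_neg, ← h, neg_neg])
  have hneg := (u0_isFreeSolution (-m) k).neg
  rw [neg_neg] at hneg
  refine (u0_isFreeSolution m k).isFundamentalPair hneg
    (mul_ne_zero (mul_ne_zero (by norm_num) hm₀) (mul_ne_zero (hGamma hm) (hGamma hm')))
    fun x hx => (u0_isFreeSolution m k).wronskian_eq_of_tendsto hneg ?_ hx
  have hu := isEntireCoeff_uCoeff m k
  have hu' := isEntireCoeff_uCoeff (-m) k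
  have hlim := ((hu.tendsto_powerSum_sq.mul hu'.tendsto_powerSum_sq).const_mul (-2 * m)).add
    (tendsto_mul_sq_mul_nhdsGT_zero 2
      ((hu.tendsto_powerSum_sq.mul hu'.coeff_deriv.tendsto_powerSum_sq).sub
        (hu.coeff_deriv.tendsto_powerSum_sq.mul hu'.tendsto_powerSum_sq)))
  rw [uCoeff_apply_zero, uCoeff_apply_zero, add_zero] at hlim
  refine hlim.congr' ?_
  filter_upwards [self_mem_nhdsWithin] with y (hy : 0 < y)
  rw [u0_eq m k hy, u0_eq (-m) k hy, wronskian_cpow_mul m hy]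
  ring

section Raise

variable {m k w : ℂ} {f f' h₁ h₂ : ℝ → ℂ}

theorem IsFreeSolution.raise (h : IsFreeSolution m k f f') :
    IsFreeSolution (m + 1) k (fun x : ℝ => f' x - (m + 1 / 2) / x * f x)
      (fun x : ℝ => k ^ 2 * f x - (m + 1 / 2) / x * (f' x - (m + 1 / 2) / x * f x)) := by
  intro x hx
  have hx' : (x : ℂ) ≠ 0 := Complex.ofReal_ne_zero.2 hx.ne'
  obtain ⟨hf, hf'⟩ := h x hx
  have hdiv : HasDerivAt (fun x : ℝ => (m + 1 / 2) / (x : ℂ))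
      (-((m + 1 / 2) / (x : ℂ) ^ 2)) x :=
    ((hasDerivAt_inv hx').comp_ofReal.const_mul (m + 1 / 2)).congr_deriv (by ring)
  have hg := hf'.fun_sub (hdiv.fun_mul hf)
  refine ⟨hg.congr_deriv ?_, ((hf.const_mul (k ^ 2)).fun_sub (hdiv.fun_mul hg)).congr_deriv ?_⟩ <;>
  · field_simp
    ring

theorem IsFundamentalPair.raise (hk : k ≠ 0) (h : IsFundamentalPair m k h₁ h₂ w) :
    IsFundamentalPair (m + 1) k (fun x : ℝ => deriv h₁ x - (m + 1 / 2) / x * h₁ x)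
      (fun x : ℝ => deriv h₂ x - (m + 1 / 2) / x * h₂ x) (-k ^ 2 * w) := by
  refine h.left.raise.isFundamentalPair h.right.raise
    (mul_ne_zero (neg_ne_zero.2 (pow_ne_zero 2 hk)) h.wronskian_ne_zero) fun x hx => ?_
  rw [← h.wronskian hx]
  ring

theorem IsFundamentalPair.neg (h : IsFundamentalPair m k h₁ h₂ w) :
    IsFundamentalPair (-m) k h₁ h₂ w :=
  h.left.neg.isFundamentalPair h.right.neg h.wronskian_ne_zero fun _ hx => h.wronskian hx

end Raise

theorem exists_isFundamentalPair_natCast {k : ℂ} (hk : k ≠ 0) (n : ℕ) :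
    ∃ h₁ h₂ w, IsFundamentalPair n k h₁ h₂ w := by
  induction n with
  | zero => exact ⟨_, _, _, by simpa only [Nat.cast_zero] using isFundamentalPair_zero k⟩
  | succ n ih =>
    obtain ⟨h₁, h₂, w, h⟩ := ih
    exact ⟨_, _, _, by simpa only [Nat.cast_succ] using h.raise hk⟩

theorem exists_isFundamentalPair (m k : ℂ) : ∃ h₁ h₂ w, IsFundamentalPair m k h₁ h₂ w := by
  by_cases hm : ∀ n : ℤ, m ≠ n
  · exact ⟨_, _, _, isFundamentalPair_of_ne_intCast k hm⟩
  push Not at hm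
  obtain ⟨n, rfl⟩ := hm
  rcases eq_or_ne k 0 with rfl | hk
  · rcases eq_or_ne (n : ℂ) 0 with hn | hn
    · exact ⟨_, _, _, by simpa only [hn] using isFundamentalPair_zero 0⟩
    · exact ⟨_, _, _, isFundamentalPair_euler hn⟩
  · obtain ⟨h₁, h₂, w, h⟩ := exists_isFundamentalPair_natCast hk n.natAbs
    refine ⟨h₁, h₂, w, ?_⟩
    rcases n.natAbs_eq with hn | hn <;> rw [hn]
    · rwa [Int.cast_natCast]
    · rw [Int.cast_neg, Int.cast_natCast]
      exact h.neg

/-! ### Bounds for `m = 0` -/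

/-- The kernel `u_0^0(x) p_0^0(y) - p_0^0(x) u_0^0(y)` without its factor `√x √y`: here
`√x A` is `u_0^0(x)`, `√x (ln x A - T)` is `p_0^0(x)`, similarly `B`, `S` at `y`, and
`ℓ = ln x - ln y`. -/
def logKernel (ℓ : ℝ) (A T B S : ℂ) : ℂ := T * B - A * S - ℓ * (A * B)

theorem norm_mul_le_sq {M : ℝ} {A B : ℂ} (hA : ‖A‖ ≤ M) (hB : ‖B‖ ≤ M) : ‖A * B‖ ≤ M ^ 2 := by
  rw [norm_mul, sq]
  exact mul_le_mul hA hB (norm_nonneg _) ((norm_nonneg _).trans hA)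

theorem norm_logKernel_le {M ℓ : ℝ} (hℓ : 0 ≤ ℓ) {A T B S : ℂ} (hA : ‖A‖ ≤ M) (hT : ‖T‖ ≤ M)
    (hB : ‖B‖ ≤ M) (hS : ‖S‖ ≤ M) : ‖logKernel ℓ A T B S‖ ≤ 2 * M ^ 2 * (1 + ℓ) := by
  have hlog : ‖(ℓ : ℂ) * (A * B)‖ ≤ ℓ * M ^ 2 := by
    rw [norm_mul, Complex.norm_real, Real.norm_of_nonneg hℓ]
    exact mul_le_mul_of_nonneg_left (norm_mul_le_sq hA hB) hℓ
  calc ‖logKernel ℓ A T B S‖ ≤ M ^ 2 + M ^ 2 + ℓ * M ^ 2 :=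
        norm_sub_le_of_le (norm_sub_le_of_le (norm_mul_le_sq hT hB) (norm_mul_le_sq hA hS)) hlog
    _ ≤ 2 * M ^ 2 * (1 + ℓ) := by nlinarith [mul_nonneg hℓ (sq_nonneg M)]

theorem norm_half_mul_logKernel_add_le {M ℓ a x : ℝ} (hℓ : 0 ≤ ℓ) (hx : 0 ≤ x) (hxa : x ≤ a)
    {A A' T T' B S : ℂ} (hA : ‖A‖ ≤ M) (hA' : ‖A'‖ ≤ M) (hT : ‖T‖ ≤ M) (hT' : ‖T'‖ ≤ M)
    (hB : ‖B‖ ≤ M) (hS : ‖S‖ ≤ M) :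
    ‖1 / 2 * logKernel ℓ A T B S - A * B + 2 * (x : ℂ) ^ 2 * logKernel ℓ A' T' B S‖ ≤
      (2 + 4 * a ^ 2) * M ^ 2 * (1 + ℓ) := by
  have hsq : ‖2 * (x : ℂ) ^ 2‖ ≤ 2 * a ^ 2 := by
    rw [norm_mul, norm_pow, Complex.norm_real, Real.norm_of_nonneg hx, Complex.norm_ofNat]
    gcongr
  have hhalf : ‖(1 / 2 : ℂ)‖ ≤ 1 / 2 := by norm_num
  calc _ ≤ 1 / 2 * (2 * M ^ 2 * (1 + ℓ)) + M ^ 2 + 2 * a ^ 2 * (2 * M ^ 2 * (1 + ℓ)) :=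
        norm_add_le_of_le (norm_sub_le_of_le (norm_mul_le_of_le hhalf
          (norm_logKernel_le hℓ hA hT hB hS)) (norm_mul_le_sq hA hB))
          (norm_mul_le_of_le hsq (norm_logKernel_le hℓ hA' hT' hB hS))
    _ ≤ (2 + 4 * a ^ 2) * M ^ 2 * (1 + ℓ) := by linarith [mul_nonneg hℓ (sq_nonneg M)]

section LogKernel

variable (k : ℂ) {x y : ℝ}

theorem kernel_zero_eq (hx : 0 < x) (hy : 0 < y) :
    u0 0 k x * p00 k y - p00 k x * u0 0 k y =
      (x : ℂ) ^ (1 / 2 + 0 : ℂ) * (y : ℂ) ^ (1 / 2 + 0 : ℂ) * logKernel (Real.log x - Real.log y)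
        (powerSum (uCoeff 0 k) ((x : ℂ) ^ 2)) (powerSum (pCoeff k) ((x : ℂ) ^ 2))
        (powerSum (uCoeff 0 k) ((y : ℂ) ^ 2)) (powerSum (pCoeff k) ((y : ℂ) ^ 2)) := by
  rw [u0_eq 0 k hx, u0_eq 0 k hy, p00_eq k hx, p00_eq k hy, pFactor, pFactor, logKernel]
  push_cast
  ring

theorem deriv_kernel_zero_eq (hx : 0 < x) (hy : 0 < y) :
    deriv (u0 0 k) x * p00 k y - deriv (p00 k) x * u0 0 k y =
      (x : ℂ) ^ (1 / 2 + 0 : ℂ) / x * (y : ℂ) ^ (1 / 2 + 0 : ℂ) *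
        (1 / 2 * logKernel (Real.log x - Real.log y)
            (powerSum (uCoeff 0 k) ((x : ℂ) ^ 2)) (powerSum (pCoeff k) ((x : ℂ) ^ 2))
            (powerSum (uCoeff 0 k) ((y : ℂ) ^ 2)) (powerSum (pCoeff k) ((y : ℂ) ^ 2)) -
          powerSum (uCoeff 0 k) ((x : ℂ) ^ 2) * powerSum (uCoeff 0 k) ((y : ℂ) ^ 2) +
          2 * x ^ 2 * logKernel (Real.log x - Real.log y)
            (powerSum (derivCoeff (uCoeff 0 k)) ((x : ℂ) ^ 2))
            (powerSum (derivCoeff (pCoeff k)) ((x : ℂ) ^ 2))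
            (powerSum (uCoeff 0 k) ((y : ℂ) ^ 2)) (powerSum (pCoeff k) ((y : ℂ) ^ 2))) := by
  have hx' : (x : ℂ) ≠ 0 := Complex.ofReal_ne_zero.2 hx.ne'
  rw [(u0_isFreeSolution 0 k).eqOn_deriv hx, (p00_isFreeSolution k).eqOn_deriv hx,
    u0_eq 0 k hy, p00_eq k hy]
  simp only [pFactor, pFactorDeriv, logKernel]
  generalize (x : ℂ) ^ (1 / 2 + 0 : ℂ) = P
  generalize (y : ℂ) ^ (1 / 2 + 0 : ℂ) = R
  push_cast
  field_simp
  ring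

theorem exists_forall_norm_powerSum_coeff_le (a : ℝ) : ∃ M : ℝ, 0 ≤ M ∧ ∀ x ∈ Ioc 0 a,
    ‖powerSum (uCoeff 0 k) ((x : ℂ) ^ 2)‖ ≤ M ∧ ‖powerSum (pCoeff k) ((x : ℂ) ^ 2)‖ ≤ M ∧
    ‖powerSum (derivCoeff (uCoeff 0 k)) ((x : ℂ) ^ 2)‖ ≤ M ∧
    ‖powerSum (derivCoeff (pCoeff k)) ((x : ℂ) ^ 2)‖ ≤ M := by
  have hu := isEntireCoeff_uCoeff 0 k
  have hp := isEntireCoeff_pCoeff k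
  obtain ⟨M₁, hM₁, h₁⟩ := exists_forall_norm_powerSum_sq_le hu a
  obtain ⟨M₂, hM₂, h₂⟩ := exists_forall_norm_powerSum_sq_le hp a
  obtain ⟨M₃, hM₃, h₃⟩ := exists_forall_norm_powerSum_sq_le hu.coeff_deriv a
  obtain ⟨M₄, hM₄, h₄⟩ := exists_forall_norm_powerSum_sq_le hp.coeff_deriv a
  refine ⟨M₁ + M₂ + M₃ + M₄, by positivity, fun x hx => ⟨?_, ?_, ?_, ?_⟩⟩
  · linarith [h₁ x hx]
  · linarith [h₂ x hx]
  · linarith [h₃ x hx]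
  · linarith [h₄ x hx]

theorem norm_ofReal_cpow_half (hx : 0 < x) :
    ‖(x : ℂ) ^ (1 / 2 + 0 : ℂ)‖ = x ^ (1 / 2 : ℝ) := by
  rw [norm_ofReal_cpow_half_add 0 hx, Complex.zero_re, add_zero]

theorem norm_ofReal_cpow_half_div (hx : 0 < x) :
    ‖(x : ℂ) ^ (1 / 2 + 0 : ℂ) / x‖ = x ^ (-1 / 2 : ℝ) := by
  rw [norm_div, norm_ofReal_cpow_half hx, Complex.norm_real, Real.norm_of_nonneg hx.le,
    ← Real.rpow_sub_one hx.ne']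
  norm_num

theorem green_bound_zero (a : ℝ) : ∃ C : ℝ, 0 ≤ C ∧ ∀ x y, 0 < y → y ≤ x → x ≤ a →
    ‖u0 0 k x * p00 k y - p00 k x * u0 0 k y‖ ≤
      C * (x ^ (1 / 2 : ℝ) * y ^ (1 / 2 : ℝ) * (1 + (Real.log x - Real.log y))) ∧
    ‖deriv (u0 0 k) x * p00 k y - deriv (p00 k) x * u0 0 k y‖ ≤
      C * (x ^ (-1 / 2 : ℝ) * y ^ (1 / 2 : ℝ) * (1 + (Real.log x - Real.log y))) := by
  obtain ⟨M, -, hbound⟩ := exists_forall_norm_powerSum_coeff_le k a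
  refine ⟨(2 + 4 * a ^ 2) * M ^ 2, by positivity, fun x y hy hyx hxa => ?_⟩
  have hx := hy.trans_le hyx
  have hℓ : 0 ≤ Real.log x - Real.log y := sub_nonneg.2 (Real.log_le_log hy hyx)
  obtain ⟨hA, hT, hA', hT'⟩ := hbound x ⟨hx, hxa⟩
  obtain ⟨hB, hS, -, -⟩ := hbound y ⟨hy, hyx.trans hxa⟩
  have hM : 2 * M ^ 2 ≤ (2 + 4 * a ^ 2) * M ^ 2 := by
    gcongr
    linarith [sq_nonneg a]
  rw [kernel_zero_eq k hx hy, deriv_kernel_zero_eq k hx hy, ← norm_ofReal_cpow_half hy,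
    ← norm_ofReal_cpow_half hx, ← norm_ofReal_cpow_half_div hx, ← norm_mul, ← norm_mul, norm_mul,
    norm_mul _ (_ + _), mul_left_comm, mul_left_comm _ ‖_ / _ * _‖]
  constructor <;> refine mul_le_mul_of_nonneg_left ?_ (norm_nonneg _)
  · exact (norm_logKernel_le hℓ hA hT hB hS).trans (by gcongr)
  · exact norm_half_mul_logKernel_add_le hℓ hx.le hxa hA hA' hT hT' hB hS

theorem p00_locallyDominated :
    LocallyDominated (fun x => ‖p00 k x‖) fun x => x ^ (1 / 2 : ℝ) * (1 + |Real.log x|) := by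
  intro a _
  obtain ⟨M, hM, hbound⟩ := exists_forall_norm_powerSum_coeff_le k a
  refine ⟨M, hM, fun x hx => ?_⟩
  obtain ⟨hA, hT, -, -⟩ := hbound x hx
  have hlog : ‖(Real.log x : ℂ)‖ ≤ |Real.log x| := by
    rw [Complex.norm_real, Real.norm_eq_abs]
  have hfactor : ‖pFactor k x‖ ≤ |Real.log x| * M + M :=
    norm_sub_le_of_le (norm_mul_le_of_le hlog hA) hT
  have hx₀ := hx.1
  simp only
  calc ‖p00 k x‖ = x ^ (1 / 2 : ℝ) * ‖pFactor k x‖ := by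
        rw [p00_eq k hx.1, norm_mul, norm_ofReal_cpow_half hx.1]
    _ ≤ x ^ (1 / 2 : ℝ) * (|Real.log x| * M + M) := by gcongr
    _ = M * (x ^ (1 / 2 : ℝ) * (1 + |Real.log x|)) := by ring

end LogKernel

section BehaviourAtZero

variable (m k : ℂ)

theorem u0_isBigO : u0 m k =O[𝓝[>] 0] fun x => x ^ (1 / 2 + m.re) := by
  obtain ⟨C, -, hC⟩ := u0_locallyDominated m k 1 one_pos
  refine IsBigO.of_bound C ?_
  filter_upwards [Ioc_mem_nhdsGT one_pos] with x hx
  rw [Real.norm_of_nonneg (Real.rpow_nonneg hx.1.le _)]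
  exact hC x hx

theorem deriv_u0_isBigO : deriv (u0 m k) =O[𝓝[>] 0] fun x => x ^ (-1 / 2 + m.re) := by
  have hu := isEntireCoeff_uCoeff m k
  have hbounded := ((hu.tendsto_powerSum_sq.const_mul (1 / 2 + m)).add
    (tendsto_mul_sq_mul_nhdsGT_zero 2 hu.coeff_deriv.tendsto_powerSum_sq)).isBigO_one ℝ
  have hpow : (fun x : ℝ => (x : ℂ) ^ (1 / 2 + m) / x) =O[𝓝[>] 0]
      fun x => x ^ (-1 / 2 + m.re) := by
    refine IsBigO.of_norm_eventuallyLE ?_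
    filter_upwards [self_mem_nhdsWithin] with x (hx : 0 < x)
    rw [norm_div, norm_ofReal_cpow_half_add m hx, Complex.norm_real, Real.norm_of_nonneg hx.le,
      ← Real.rpow_sub_one hx.ne']
    exact (congrArg (x ^ ·) (by ring)).le
  refine (hpow.mul hbounded).congr' ?_ (by simp)
  filter_upwards [self_mem_nhdsWithin] with x (hx : 0 < x)
  have hx' : (x : ℂ) ≠ 0 := Complex.ofReal_ne_zero.2 hx.ne'
  rw [(u0_isFreeSolution m k).eqOn_deriv hx]
  field_simp

theorem not_u0_isLittleO {m : ℂ} (hm : Complex.Gamma (m + 1) ≠ 0) :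
    ¬ u0 m k =o[𝓝[>] 0] fun x => x ^ (1 / 2 + m.re) := by
  intro h
  have hlim := (isEntireCoeff_uCoeff m k).tendsto_powerSum_sq.norm
  refine inv_ne_zero hm (uCoeff_apply_zero m k ▸ norm_eq_zero.1 (tendsto_nhds_unique hlim
    (h.norm_left.tendsto_div_nhds_zero.congr' ?_)))
  filter_upwards [self_mem_nhdsWithin] with x (hx : 0 < x)
  rw [u0_eq m k hx, norm_mul, norm_ofReal_cpow_half_add m hx,
    mul_div_cancel_left₀ _ (Real.rpow_pos_of_pos hx _).ne']

variable {k} {e e' : ℝ → ℂ}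

theorem IsFreeSolution.eqOn_zero_of_isLittleO_zero (he : IsFreeSolution 0 k e e')
    (heo : e =o[𝓝[>] 0] fun x => x ^ (1 / 2 : ℝ))
    (heo' : e' =o[𝓝[>] 0] fun x => x ^ (-1 / 2 : ℝ)) : EqOn e 0 (Ioi 0) := by
  have hpair := isFundamentalPair_zero k
  obtain ⟨c₁, c₂, hc⟩ := hpair.exists_eq_combination he
  have hO := u0_isBigO 0 k
  have hO' := deriv_u0_isBigO 0 k
  rw [Complex.zero_re] at hO hO'
  have hW {x : ℝ} (hx : 0 < x) : e x * deriv (u0 0 k) x - e' x * u0 0 k x = 0 :=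
    he.wronskian_eq_zero (s := 0) hpair.left (by simpa using heo) (by simpa using heo')
      (by simpa using hO) (by simpa using hO') hx
  have hc₂ : c₂ = 0 := by
    have hW₁ := hW one_pos
    rw [(hc 1 one_pos).1, (hc 1 one_pos).2] at hW₁
    linear_combination -hW₁ - c₂ * hpair.wronskian one_pos
  have he_eq : EqOn e (fun x => c₁ * u0 0 k x) (Ioi 0) := fun x hx => by
    rw [(hc x hx).1, hc₂, zero_mul, add_zero]
  have hc₁ : c₁ = 0 := by
    by_contra hc₁
    refine not_u0_isLittleO k (m := 0) (by simp) ((isLittleO_const_mul_left_iff hc₁).1 ?_)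
    rw [Complex.zero_re, add_zero]
    exact heo.congr' (he_eq.eventuallyEq_of_mem self_mem_nhdsWithin) EventuallyEq.rfl
  intro x hx
  simp [he_eq hx, hc₁]

end BehaviourAtZero

/-! ### Admissibility of the perturbations -/

/-- The functions `x^p (1 + |ln x|)^j`, which serve both as weights `φ` and as majorants `ω`. -/
def logWeight (p : ℝ) (j : ℕ) (x : ℝ) : ℝ := x ^ p * (1 + |Real.log x|) ^ j

section LogWeight

variable {p q d x y : ℝ} {i j : ℕ}

theorem logWeight_zero : logWeight p 0 = fun x => x ^ p := by
  funext x
  rw [logWeight, pow_zero, mul_one]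

theorem logWeight_one : logWeight p 1 = fun x => x ^ p * (1 + |Real.log x|) := by
  funext x
  rw [logWeight, pow_one]

theorem logWeight_pos (hx : 0 < x) : 0 < logWeight p j x := by
  rw [logWeight]
  positivity

theorem continuousOn_logWeight : ContinuousOn (logWeight p j) (Ioi 0) := by
  intro x hx
  have hx₀ : x ≠ 0 := ne_of_gt hx
  exact ((Real.continuousAt_rpow_const x _ (Or.inl hx₀)).mul
    ((continuousAt_const.add (Real.continuousAt_log hx₀).abs).pow j)).continuousWithinAt

theorem isWeight_logWeight (a : ℝ) : IsWeight a (logWeight p j) where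
  pos := fun _ hx => logWeight_pos hx.1
  continuousOn := continuousOn_logWeight.mono Ioo_subset_Ioi_self

theorem rpow_mul_rpow_le_rpow_add_mul_rpow_sub (hd : 0 ≤ d) (hy : 0 < y) (hyx : y ≤ x) :
    x ^ p * y ^ q ≤ x ^ (p + d) * y ^ (q - d) := by
  have hx := hy.trans_le hyx
  calc x ^ p * y ^ q = x ^ p * (y ^ d * y ^ (q - d)) := by
        rw [← Real.rpow_add hy, add_sub_cancel]
    _ ≤ x ^ p * (x ^ d * y ^ (q - d)) := by gcongr
    _ = x ^ (p + d) * y ^ (q - d) := by rw [Real.rpow_add hx, mul_assoc]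

theorem rpow_locallyDominated_logWeight (h : p ≤ q) :
    LocallyDominated (fun x => x ^ q) (logWeight p j) := by
  refine fun a ha => ⟨a ^ (q - p), by positivity, fun x ⟨hx, hxa⟩ => ?_⟩
  have hlog : 1 ≤ (1 + |Real.log x|) ^ j := one_le_pow₀ (by linarith [abs_nonneg (Real.log x)])
  calc x ^ q = x ^ (q - p) * x ^ p := by rw [← Real.rpow_add hx, sub_add_cancel]
    _ ≤ a ^ (q - p) * x ^ p := by gcongr
    _ ≤ a ^ (q - p) * logWeight p j x := by
      gcongr
      exact le_mul_of_one_le_right (by positivity) hlog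

theorem integrableOn_logWeight_mul_norm {Q : ℝ → ℂ} (hQ : LocallyIntegrableOn Q (Ioi 0))
    (hI : IntegrableOn (fun x => logWeight q i x * ‖Q x‖) (Ioo 0 1)) (a : ℝ) :
    IntegrableOn (fun x => logWeight q i x * ‖Q x‖) (Ioc 0 a) := by
  have hpos : Icc (1 : ℝ) a ⊆ Ioi 0 := fun x hx => one_pos.trans_le hx.1
  have hI' : IntegrableOn (fun x => logWeight q i x * ‖Q x‖) (Icc 1 a) :=
    IntegrableOn.continuousOn_mul (continuousOn_logWeight.mono hpos)
      (hQ.integrableOn_compact_subset hpos isCompact_Icc).norm isCompact_Icc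
  refine (hI.union hI').mono_set fun x hx => ?_
  exact (lt_or_ge x 1).imp (fun h => ⟨hx.1, h⟩) fun h => ⟨h, hx.2⟩

theorem admissible_logWeight {m k : ℂ} {Q h₁ h₂ : ℝ → ℂ} {w : ℂ} {s : ℝ}
    (hp : IsFundamentalPair m k h₁ h₂ w) (hps : p ≤ 1 / 2 + s)
    (hQ : LocallyIntegrableOn Q (Ioi 0))
    (hI : IntegrableOn (fun x => logWeight q i x * ‖Q x‖) (Ioo 0 1))
    (hG : ∀ a, 0 < a → ∃ C, 0 ≤ C ∧ ∀ x y, 0 < y → y ≤ x → x ≤ a →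
      ‖h₁ x * h₂ y - h₂ x * h₁ y‖ * logWeight p j y ≤
        C * x ^ (1 / 2 + s) * logWeight q i y ∧
      ‖deriv h₁ x * h₂ y - deriv h₂ x * h₁ y‖ * logWeight p j y ≤
        C * x ^ (-1 / 2 + s) * logWeight q i y) :
    Admissible m k Q (logWeight p j) (logWeight q i) s h₁ h₂ w where
  pair := hp
  weight := isWeight_logWeight
  weight_lower := rpow_locallyDominated_logWeight hps
  meas := hQ.aestronglyMeasurable
  majorant_nonneg := fun _ hx => (logWeight_pos hx).le
  majorant_int := fun a _ => integrableOn_logWeight_mul_norm hQ hI a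
  green := hG

end LogWeight

section Perturbation

variable {m k : ℂ} {Q : ℝ → ℂ} {ε : ℝ}

theorem abs_le_add_of_two_mul_max_neg_zero_le {r : ℝ} (h : 2 * max (-r) 0 ≤ ε) : |r| ≤ r + ε :=
  abs_le'.2 ⟨by linarith [le_max_right (-r) 0], by linarith [le_max_left (-r) 0]⟩

theorem L0.integrableOn_logWeight (hQ : L0 ε Q) :
    IntegrableOn (fun x => logWeight (1 - ε) 0 x * ‖Q x‖) (Ioo 0 1) := by
  rw [logWeight_zero]
  exact hQ.2

theorem L0ln.integrableOn_logWeight {n : ℕ} (hQ : L0ln ε n Q) :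
    IntegrableOn (fun x => logWeight (1 - ε) n x * ‖Q x‖) (Ioo 0 1) := by
  refine (hQ.2.const_mul (2 ^ (n - 1))).mono'
    (((continuousOn_logWeight.mono Ioo_subset_Ioi_self).aestronglyMeasurable
      measurableSet_Ioo).mul (hQ.1.aestronglyMeasurable.mono_set Ioo_subset_Ioi_self).norm) ?_
  filter_upwards [ae_mem_Ioo 1] with x hx
  have hx₀ := hx.1
  have hpow := add_pow_le zero_le_one (abs_nonneg (Real.log x)) n
  rw [one_pow] at hpow
  rw [norm_mul, norm_norm, Real.norm_of_nonneg (logWeight_pos hx₀).le, Real.rpow_natCast]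
  calc logWeight (1 - ε) n x * ‖Q x‖
      ≤ x ^ (1 - ε) * (2 ^ (n - 1) * (1 + |Real.log x| ^ n)) * ‖Q x‖ := by
        rw [logWeight]
        gcongr
    _ = 2 ^ (n - 1) * (x ^ (1 - ε) * (1 + |Real.log x| ^ n) * ‖Q x‖) := by ring

theorem admissible_of_ne_zero (hm : m ≠ 0) (hr : |m.re| ≤ m.re + ε) (hQ : L0 ε Q)
    {h₁ h₂ : ℝ → ℂ} {w : ℂ} (hp : IsFundamentalPair m k h₁ h₂ w) :
    Admissible m k Q (logWeight (1 / 2 + m.re) 0) (logWeight (1 - ε) 0) (m.re + ε) h₁ h₂ w := by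
  refine admissible_logWeight hp (by linarith [le_abs_self m.re]) hQ.1
    hQ.integrableOn_logWeight fun a _ => ?_
  obtain ⟨C, hC, hG⟩ := hp.green_bound hm a
  refine ⟨C, hC, fun x y hy hyx hxa => ?_⟩
  have bound {q b : ℝ} (hb : b ≤ C * (x ^ (q + |m.re|) * y ^ (1 / 2 - |m.re|))) :
      b * logWeight (1 / 2 + m.re) 0 y ≤ C * x ^ (q + (m.re + ε)) * logWeight (1 - ε) 0 y := by
    rw [logWeight_zero, logWeight_zero]
    calc b * y ^ (1 / 2 + m.re)
        ≤ C * (x ^ (q + |m.re|) * y ^ (1 / 2 - |m.re|)) * y ^ (1 / 2 + m.re) := by gcongr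
      _ = C * (x ^ (q + |m.re|) * y ^ (1 / 2 - |m.re| + (1 / 2 + m.re))) := by
        rw [Real.rpow_add hy (1 / 2 - |m.re|), mul_assoc, mul_assoc]
      _ ≤ C * (x ^ (q + |m.re| + (m.re + ε - |m.re|)) *
          y ^ (1 / 2 - |m.re| + (1 / 2 + m.re) - (m.re + ε - |m.re|))) := by
        exact mul_le_mul_of_nonneg_left
          (rpow_mul_rpow_le_rpow_add_mul_rpow_sub (sub_nonneg.2 hr) hy hyx) hC
      _ = C * x ^ (q + (m.re + ε)) * y ^ (1 - ε) := by
        ring_nf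
  exact (hG x y hy hyx hxa).imp bound bound

theorem one_add_log_sub_log_le {a x y : ℝ} (hx : 0 < x) (hxa : x ≤ a) :
    1 + (Real.log x - Real.log y) ≤ (1 + |Real.log a|) * (1 + |Real.log y|) := by
  have hlog_x : Real.log x ≤ |Real.log a| := (Real.log_le_log hx hxa).trans (le_abs_self _)
  have hlog_y := neg_le_abs (Real.log y)
  linarith [mul_nonneg (abs_nonneg (Real.log a)) (abs_nonneg (Real.log y))]

theorem mul_logWeight_le_of_le_log {a b C q x y : ℝ} (hε : 0 ≤ ε) (hC : 0 ≤ C) (hy : 0 < y)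
    (hyx : y ≤ x) (hxa : x ≤ a) (j : ℕ)
    (hb : b ≤ C * (x ^ q * y ^ (1 / 2 : ℝ) * (1 + (Real.log x - Real.log y)))) :
    b * logWeight (1 / 2) j y ≤
      C * (1 + |Real.log a|) * x ^ (q + ε) * logWeight (1 - ε) (j + 1) y := by
  have hx := hy.trans_le hyx
  have hlog := one_add_log_sub_log_le (y := y) hx hxa
  have hpow := rpow_mul_rpow_le_rpow_add_mul_rpow_sub (p := q) (q := 1) hε hy hyx
  have hhalf : y ^ (1 / 2 : ℝ) * y ^ (1 / 2 : ℝ) = y ^ (1 : ℝ) := by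
    rw [← Real.rpow_add hy, add_halves]
  have hlog_nonneg : 0 ≤ 1 + (Real.log x - Real.log y) := by linarith [Real.log_le_log hy hyx]
  rw [logWeight, logWeight]
  calc b * (y ^ (1 / 2 : ℝ) * (1 + |Real.log y|) ^ j)
      ≤ C * (x ^ q * y ^ (1 / 2 : ℝ) * (1 + (Real.log x - Real.log y))) *
          (y ^ (1 / 2 : ℝ) * (1 + |Real.log y|) ^ j) := by gcongr
    _ = C * (x ^ q * y ^ (1 : ℝ)) * (1 + (Real.log x - Real.log y)) * (1 + |Real.log y|) ^ j := by
      rw [← hhalf]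
      ring
    _ ≤ C * (x ^ (q + ε) * y ^ (1 - ε)) * ((1 + |Real.log a|) * (1 + |Real.log y|)) *
          (1 + |Real.log y|) ^ j := by gcongr
    _ = _ := by ring

theorem admissible_zero (hε : 0 ≤ ε) {j : ℕ} (hQ : L0ln ε (j + 1 : ℕ) Q)
    {h₁ h₂ : ℝ → ℂ} {w : ℂ} (hp : IsFundamentalPair 0 k h₁ h₂ w) :
    Admissible 0 k Q (logWeight (1 / 2) j) (logWeight (1 - ε) (j + 1)) ε h₁ h₂ w := by
  refine admissible_logWeight hp (by linarith) hQ.1 hQ.integrableOn_logWeight fun a _ => ?_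
  obtain ⟨C, hC, hG⟩ := green_bound_zero k a
  obtain ⟨c, -, hkernel⟩ := (isFundamentalPair_zero k).exists_kernel_eq_mul hp
  refine ⟨‖c‖ * C * (1 + |Real.log a|), by positivity, fun x y hy hyx hxa => ?_⟩
  rw [(hkernel x y (hy.trans_le hyx) hy).1, (hkernel x y (hy.trans_le hyx) hy).2, norm_mul,
    norm_mul]
  obtain ⟨hG₁, hG₂⟩ := hG x y hy hyx hxa
  have hc := norm_nonneg c
  constructor <;> refine mul_logWeight_le_of_le_log hε (mul_nonneg hc hC) hy hyx hxa j ?_ <;>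
    rw [mul_assoc]
  · exact mul_le_mul_of_nonneg_left hG₁ hc
  · exact mul_le_mul_of_nonneg_left hG₂ hc

theorem u0_approximation_of_ne_zero (hm : m ≠ 0) (hr : |m.re| ≤ m.re + ε) (hQ : L0 ε Q) :
    ∃ u : ℝ → ℂ, IsInverseImage m k Q (fun x => x ^ (1 / 2 + m.re)) (u0 m k) u ∧
      IsUniqueApproximation m k Q (u0 m k) (m.re + ε) u ∧
      IsUniqueApproximation m k Q (u0 m k) |m.re| u := by
  obtain ⟨h₁, h₂, w, hp⟩ := exists_isFundamentalPair m k
  have hA {h₁ h₂ w} := admissible_of_ne_zero (k := k) (h₁ := h₁) (h₂ := h₂) (w := w) hm hr hQ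
  rw [← logWeight_zero]
  exact exists_unique_approximation hr
    (rpow_locallyDominated_logWeight (by linarith [le_abs_self m.re]))
    (fun _ _ => hp.eqOn_zero_of_isLittleO hm) ⟨h₁, h₂, w, hp⟩ (fun _ _ _ => hA)
    (u0_isFreeSolution m k) (logWeight_zero ▸ u0_locallyDominated m k)

theorem approximation_zero (hε : 0 ≤ ε) {j : ℕ} (hQ : L0ln ε (j + 1 : ℕ) Q)
    {g0 g0' : ℝ → ℂ} (hg0 : IsFreeSolution 0 k g0 g0')
    (hg0φ : LocallyDominated (fun x => ‖g0 x‖) (logWeight (1 / 2) j)) :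
    ∃ g : ℝ → ℂ, IsInverseImage 0 k Q (logWeight (1 / 2) j) g0 g ∧
      IsUniqueApproximation 0 k Q g0 ε g ∧ IsUniqueApproximation 0 k Q g0 0 g :=
  exists_unique_approximation hε (rpow_locallyDominated_logWeight (by simp))
    (fun _ _ he heo heo' =>
      he.eqOn_zero_of_isLittleO_zero (by simpa using heo) (by simpa using heo'))
    (exists_isFundamentalPair 0 k) (fun _ _ _ => admissible_zero hε hQ) hg0 hg0φ

theorem u0_approximation (hε : 2 * max (-m.re) 0 ≤ ε) (hQ : m ≠ 0 → L0 ε Q)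
    (hQ0 : m = 0 → L0ln ε 1 Q) :
    ∃ u : ℝ → ℂ, IsInverseImage m k Q (fun x => x ^ (1 / 2 + m.re)) (u0 m k) u ∧
      IsUniqueApproximation m k Q (u0 m k) (m.re + ε) u ∧
      IsUniqueApproximation m k Q (u0 m k) |m.re| u := by
  rcases eq_or_ne m 0 with rfl | hm
  · have hu0 := u0_locallyDominated 0 k
    simp only [Complex.zero_re, neg_zero, max_self, mul_zero, add_zero, zero_add, abs_zero]
      at hε hu0 ⊢
    rw [← logWeight_zero] at hu0 ⊢
    exact approximation_zero hε (by simpa using hQ0 rfl)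
      (u0_isFreeSolution 0 k) hu0
  · exact u0_approximation_of_ne_zero hm (abs_le_add_of_two_mul_max_neg_zero_le hε) (hQ hm)

theorem p00_approximation (hε : 0 ≤ ε) (hQ : L0ln ε 2 Q) :
    ∃ p : ℝ → ℂ, IsInverseImage 0 k Q (fun x => x ^ (1 / 2 : ℝ) * (1 + |Real.log x|)) (p00 k) p ∧
      IsUniqueApproximation 0 k Q (p00 k) ε p ∧ IsUniqueApproximation 0 k Q (p00 k) 0 p := by
  rw [← logWeight_one]
  exact approximation_zero hε (by simpa using hQ) (p00_isFreeSolution k)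
    (logWeight_one ▸ p00_locallyDominated k)

end Perturbation

end PerturbedBessel

end

theorem mainTheorem2 (k : ℂ) (ε : ℝ) (Q : ℝ → ℂ) :
    (∀ m : ℂ, 2 * max (-m.re) 0 ≤ ε →
      (m ≠ 0 → PerturbedBessel.L0 ε Q) → (m = 0 → PerturbedBessel.L0ln ε 1 Q) →
      ∃ u : ℝ → ℂ,
        PerturbedBessel.IsInverseImage m k Q (fun x => x ^ (1 / 2 + m.re))
          (PerturbedBessel.u0 m k) u ∧
        PerturbedBessel.IsUniqueApproximation m k Q (PerturbedBessel.u0 m k) (m.re + ε) u ∧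
        PerturbedBessel.IsUniqueApproximation m k Q (PerturbedBessel.u0 m k) |m.re| u) ∧
    (0 ≤ ε → PerturbedBessel.L0ln ε 2 Q →
      ∃ p : ℝ → ℂ,
        PerturbedBessel.IsInverseImage 0 k Q (fun x => x ^ (1 / 2 : ℝ) * (1 + |Real.log x|))
          (PerturbedBessel.p00 k) p ∧
        PerturbedBessel.IsUniqueApproximation 0 k Q (PerturbedBessel.p00 k) ε p ∧
        PerturbedBessel.IsUniqueApproximation 0 k Q (PerturbedBessel.p00 k) 0 p) :=
  ⟨fun _ hε hQ hQ0 => PerturbedBessel.u0_approximation hε hQ hQ0,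
    fun hε hQ => PerturbedBessel.p00_approximation hε hQ⟩
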